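/- Work over $\mathbb C$. Let $\mathfrak{gl}(m|n)$ act on its standard module $GL_{m|n}=\mathbb C^{m|n}$, with even basis $v_1,\dots,v_m$ of weights $\epsilon_i$ and odd basis $w_1,\dots,w_n$ of weights $\delta_j$; let $S^d$, $\Lambda^d$ be the super symmetric and exterior powers and $\Pi$ the parity shift. A Borel subalgebra of a Lie superalgebra $\mathfrak g$ is $\mathfrak b=\mathfrak h\oplus\mathfrak n^+$, given by a Cartan subalgebra $\mathfrak h_{\bar 0}$ of $\mathfrak g_{\bar 0}$ and $h\in\mathfrak h_{\bar 0}$ on which all roots take nonzero real values: $\mathfrak h$ is the centralizer of $\mathfrak h_{\bar 0}$ and $\mathfrak n^+$ the sum of the root spaces of the roots positive on $h$. A nonzero $\mathfrak g$-module $V$ is *spherical for* $\mathfrak b$ if $(\mathfrak b+\mathbb C\,\mathrm{id}_V)v=V$ for some $v\in V_{\bar 0}$ (a *spherical vector*); it is *spherical* if it is so for some Borel subalgebra, and *numerically spherical* if $V_{\bar 0}$ is a spherical $\mathfrak g_{\bar 0}$-module and $\dim V_{\bar 1}\le\max_{\mathfrak b}\dim\mathfrak b_{\bar 1}$. Two modules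 $(V,\mathfrak g,\rho)$, $(V',\mathfrak g',\rho')$ are *equivalent* if an isomorphism of super vector spaces $V\cong V'$ carries $\rho(\mathfrak g)+\mathbb C\,\mathrm{id}$ onto $\rho'(\mathfrak g')+\mathbb C\,\mathrm{id}$. Conjugacy classes of Borel subalgebras of $\mathfrak{gl}(m|n)$ are labelled by strings with $m$ letters $\epsilon$ and $n$ letters $\delta$: the Borel subalgebra of a string is spanned by the diagonal matrices and the matrix units $E_{ab}$ with $a$ to the left of $b$, where the $i$-th $\epsilon$ (the $j$-th $\delta$) stands for $v_i$ (for $w_j$). **Proposition.** Let $1\le m\le n$ with $m\ge2$ or $n\ge3$. Among the modules $(\Pi)S^dGL_{m|n}$ and $(\Pi)\Lambda^dGL_{m|n}$, $d\ge1$, the numerically spherical ones are exactly $$(\Pi)GL_{m|n},\quad S^2GL_{m|n},\quad \Lambda^2GL_{m|n},\quad \Pi S^2GL_{n|n}\text{ and }\Pi\Lambda^2GL_{n|n}\ (\text{if }m=n),\quad \Pi S^2GL_{m|m+1}\ (\text{if }n=m+1),$$ and they are all spherical. Moreover, for all $m,n\ge1$, $\Pi GL_{m|n}$ is equivalent to $GL_{n|m}$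 and $\Lambda^2GL_{m|n}$ is equivalent to $S^2GL_{n|m}$. For all $n\ge1$, $\Pi S^2GL_{n|n}$ is isomorphic to the twist of $\Pi\Lambda^2GL_{n|n}$ by the parity shift automorphism $\begin{pmatrix}A&B\\C&D\end{pmatrix}\mapsto\begin{pmatrix}D&C\\B&A\end{pmatrix}$ of $\mathfrak{gl}(n|n)$, so $\Pi\Lambda^2GL_{n|n}$ is equivalent to $\Pi S^2GL_{n|n}$. Finally, for all $m,n\ge1$ the following holds; in each case the stabilizer is $\{X : Xv=0\}$ for an arbitrary spherical vector $v$. 1. $GL_{m|n}$ has superdimension $(m|n)$ and is spherical exactly for the Borel subalgebras whose string ends in $\epsilon$. The stabilizer is isomorphic to $\mathfrak{gl}(m-1|n)\ltimes(\mathbb C^{m-1|n})^*$. 2. $S^2GL_{m|n}$ has superdimension $\bigl(\tfrac{n(n-1)}2+\tfrac{m(m+1)}2\,\big|\,mn\bigr)$ and is spherical exactly for the Borel subalgebras in whose string every $\epsilon$ is followed, in total, by an even number of $\delta$'s. The stabilizer is $\mathfrak{osp}(GL_{m|n}^*,v)$, the superalgebra of all matrices that preserve the (possibly degenerate) form on $GL_{m|n}^*$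 induced by $v$. 3. $\Pi S^2GL_{n|n}$ has superdimension $(n^2|n^2)$ and is spherical exactly for the Borel subalgebras with string $\epsilon\delta\epsilon\delta\cdots\epsilon\delta$. The stabilizer is conjugate, under even invertible matrices, to $\mathfrak p(n)^\Pi$, the image under the parity shift automorphism of the algebra $\mathfrak p(n)$ of the matrices $\begin{pmatrix}A&B\\C&-A^t\end{pmatrix}$ with $B^t=B$, $C^t=-C$. 4. $\Pi S^2GL_{n|n+1}$ has superdimension $(n(n+1)|n(n+1))$ and is spherical exactly for the Borel subalgebras with string $\delta\epsilon\delta\epsilon\cdots\epsilon\delta$. The stabilizer is isomorphic to $(\mathfrak p(n)^\Pi\times\mathbb C)\ltimes\Pi\mathbb C^{n|n}$, where $\mathfrak p(n)^\Pi\subset\mathfrak{gl}(n|n)$ acts on $\mathbb C^{n|n}$ by restriction of the standard representation and $\mathbb C$ acts by the character $-1$. -/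

import Mathlib

noncomputable section

namespace SuperSph

open Matrix

set_option linter.unusedSectionVars false

/-! ### Super vector spaces -/

/-- The sign `(-1)^a` attached to a parity `a`. -/
def sgn (a : ZMod 2) : ℂ := if a = 0 then 1 else -1

theorem sgn_zero : sgn 0 = 1 := by simp [sgn]

theorem sgn_one : sgn 1 = -1 := by simp [sgn]

theorem zmod2_cases (a : ZMod 2) : a = 0 ∨ a = 1 := by
  revert a; decide

theorem sgn_add (a b : ZMod 2) : sgn (a + b) = sgn a * sgn b := by
  have h : (1 : ZMod 2) + 1 = 0 := by decide
  rcases zmod2_cases a with rfl | rfl <;> rcases zmod2_cases b with rfl | rfl <;> simp [sgn, h]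

/-- A super vector space structure on a complex vector space: a decomposition into an even part
`part 0` and an odd part `part 1`. -/
structure Grading (V : Type*) [AddCommGroup V] [Module ℂ V] where
  part : ZMod 2 → Submodule ℂ V
  isCompl : IsCompl (part 0) (part 1)

namespace Grading

variable {V : Type*} [AddCommGroup V] [Module ℂ V]

/-- The projection onto the odd part along the even part. -/
def oddProj (G : Grading V) : V →ₗ[ℂ] V :=
  (G.part 1).projection (G.part 0) G.isCompl.symm

theorem oddProj_of_even (G : Grading V) {v : V} (h : v ∈ G.part 0) : G.oddProj v = 0 :=
  (Submodule.projection_apply_eq_zero_iff _).2 h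

theorem oddProj_of_odd (G : Grading V) {v : V} (h : v ∈ G.part 1) : G.oddProj v = v :=
  Submodule.projection_apply_of_mem_left _ h

/-- The parity shift of a super vector space. -/
def shift (G : Grading V) : Grading V where
  part i := G.part (i + 1)
  isCompl := by
    have h : (1 : ZMod 2) + 1 = 0 := by decide
    rw [h, zero_add]
    exact G.isCompl.symm

/-- A subspace is graded when it contains the homogeneous components of its elements. -/
def IsGraded (G : Grading V) (W : Submodule ℂ V) : Prop :=
  W ≤ (W ⊓ G.part 0) ⊔ (W ⊓ G.part 1)

/-- The super vector space structure on a graded subspace. -/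
def restrict (G : Grading V) (W : Submodule ℂ V) (hW : G.IsGraded W) : Grading W where
  part i := (G.part i).comap W.subtype
  isCompl := by
    constructor
    · rw [Submodule.disjoint_def]
      rintro ⟨x, hx⟩ h0 h1
      have := (Submodule.disjoint_def.1 G.isCompl.disjoint) x h0 h1
      exact Subtype.ext this
    · rw [codisjoint_iff, eq_top_iff]
      rintro ⟨x, hx⟩ -
      obtain ⟨y, hy, z, hz, rfl⟩ := Submodule.mem_sup.1 (hW hx)
      exact Submodule.mem_sup.2 ⟨⟨y, hy.1⟩, hy.2, ⟨z, hz.1⟩, hz.2, rfl⟩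

/-- The direct sum of two super vector spaces. -/
def prod {W : Type*} [AddCommGroup W] [Module ℂ W] (G : Grading V) (G' : Grading W) :
    Grading (V × W) where
  part i := (G.part i).prod (G'.part i)
  isCompl := by
    constructor
    · rw [Submodule.disjoint_def]
      rintro ⟨x, y⟩ ⟨hx0, hy0⟩ ⟨hx1, hy1⟩
      exact Prod.ext ((Submodule.disjoint_def.1 G.isCompl.disjoint) x hx0 hx1)
        ((Submodule.disjoint_def.1 G'.isCompl.disjoint) y hy0 hy1)
    · rw [codisjoint_iff, eq_top_iff]
      rintro ⟨x, y⟩ -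
      have hx : x ∈ G.part 0 ⊔ G.part 1 := by
        rw [codisjoint_iff.1 G.isCompl.codisjoint]; trivial
      have hy : y ∈ G'.part 0 ⊔ G'.part 1 := by
        rw [codisjoint_iff.1 G'.isCompl.codisjoint]; trivial
      obtain ⟨x0, hx0, x1, hx1, rfl⟩ := Submodule.mem_sup.1 hx
      obtain ⟨y0, hy0, y1, hy1, rfl⟩ := Submodule.mem_sup.1 hy
      exact Submodule.mem_sup.2 ⟨(x0, y0), ⟨hx0, hy0⟩, (x1, y1), ⟨hx1, hy1⟩, rfl⟩

/-- The superdimension `(dim V₀ | dim V₁)`. -/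
def sdim (G : Grading V) : ℕ × ℕ :=
  (Module.finrank ℂ (G.part 0), Module.finrank ℂ (G.part 1))

/-- The super vector space of functions on a set `ι` whose points carry parities. -/
def ofParity {ι : Type*} (q : ι → ZMod 2) : Grading (ι → ℂ) where
  part i :=
    { carrier := {t | ∀ a, q a ≠ i → t a = 0}
      zero_mem' := fun _ _ => rfl
      add_mem' := fun {s t} hs ht a ha => by simp [hs a ha, ht a ha]
      smul_mem' := fun c t ht a ha => by simp [ht a ha] }
  isCompl := by
    constructor
    · rw [Submodule.disjoint_def]
      intro t h0 h1
      funext a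
      rcases zmod2_cases (q a) with h | h
      · exact h1 a (by rw [h]; decide)
      · exact h0 a (by rw [h]; decide)
    · rw [codisjoint_iff, eq_top_iff]
      intro t _
      refine Submodule.mem_sup.2 ⟨fun a => if q a = 0 then t a else 0, ?_,
        fun a => if q a = 0 then 0 else t a, ?_, ?_⟩
      · intro a ha
        simp [ha]
      · intro a ha
        rcases zmod2_cases (q a) with h | h
        · simp [h]
        · exact absurd h ha
      · funext a
        by_cases h : q a = 0 <;> simp [h]

end Grading

/-! ### Lie superalgebras and their representations -/

/-- A complex Lie superalgebra structure on the vector space `L`. -/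
structure SuperLieAlg (L : Type*) [AddCommGroup L] [Module ℂ L] extends Grading L where
  br : L →ₗ[ℂ] L →ₗ[ℂ] L
  br_mem : ∀ {i j x y}, x ∈ part i → y ∈ part j → br x y ∈ part (i + j)
  br_skew : ∀ {i j x y}, x ∈ part i → y ∈ part j → br x y = -(sgn (i * j) • br y x)
  jacobi : ∀ {i j k x y z}, x ∈ part i → y ∈ part j → z ∈ part k →
    br x (br y z) = br (br x y) z + sgn (i * j) • br y (br x z)

/-- A representation of a Lie superalgebra on a super vector space. -/
structure SuperRep {L : Type*} [AddCommGroup L] [Module ℂ L] (A : SuperLieAlg L)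
    (V : Type*) [AddCommGroup V] [Module ℂ V] extends Grading V where
  act : L →ₗ[ℂ] Module.End ℂ V
  act_mem : ∀ {i j x v}, x ∈ A.part i → v ∈ part j → act x v ∈ part (i + j)
  act_br : ∀ {i j x y}, x ∈ A.part i → y ∈ A.part j → ∀ v,
    act (A.br x y) v = act x (act y v) - sgn (i * j) • act y (act x v)

section General

variable {L : Type*} [AddCommGroup L] [Module ℂ L] {L' : Type*} [AddCommGroup L'] [Module ℂ L']
variable {V : Type*} [AddCommGroup V] [Module ℂ V] {V' : Type*} [AddCommGroup V'] [Module ℂ V']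

namespace SuperLieAlg

/-- Two Lie superalgebras are isomorphic. -/
def Iso (A : SuperLieAlg L) (B : SuperLieAlg L') : Prop :=
  ∃ e : L ≃ₗ[ℂ] L', (∀ i, ∀ x ∈ A.part i, e x ∈ B.part i) ∧
    ∀ x y, e (A.br x y) = B.br (e x) (e y)

theorem br_even_mem (A : SuperLieAlg L) {x y : L} (hx : x ∈ A.part 0) (hy : y ∈ A.part 0) :
    A.br x y ∈ A.part 0 := by
  have := A.br_mem hx hy
  rwa [add_zero] at this

/-- The even part of a Lie superalgebra is a Lie algebra. -/
instance evenLieRing (A : SuperLieAlg L) : LieRing (A.part 0) where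
  bracket x y := ⟨A.br x y, A.br_even_mem x.2 y.2⟩
  add_lie x y z := Subtype.ext (by simp)
  lie_add x y z := Subtype.ext (by simp)
  lie_self x := Subtype.ext (by
    have h := A.br_skew x.2 x.2
    simp only [mul_zero, sgn_zero, one_smul] at h
    have h2 : (2 : ℂ) • A.br (x : L) (x : L) = 0 := by
      rw [two_smul]
      exact eq_neg_iff_add_eq_zero.1 h
    exact (smul_eq_zero.1 h2).resolve_left two_ne_zero)
  leibniz_lie x y z := Subtype.ext (by
    have h := A.jacobi x.2 y.2 z.2
    simpa [sgn_zero] using h)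

instance evenLieAlgebra (A : SuperLieAlg L) : LieAlgebra ℂ (A.part 0) where
  lie_smul c x y := Subtype.ext (by simp [Bracket.bracket])

/-- The weight space of weight `α` for the action of a subalgebra `H` of `𝔤₀` on `S ⊆ 𝔤`. -/
def weightSpace (A : SuperLieAlg L) (S : Submodule ℂ L) (H : LieSubalgebra ℂ (A.part 0))
    (α : Module.Dual ℂ H) : Submodule ℂ L where
  carrier := {x | x ∈ S ∧ ∀ t : H, A.br (t : A.part 0) x = α t • x}
  zero_mem' := ⟨S.zero_mem, fun t => by simp⟩
  add_mem' := fun {x y} hx hy => ⟨S.add_mem hx.1 hy.1, fun t => by simp [hx.2 t, hy.2 t]⟩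
  smul_mem' := fun c x hx => ⟨S.smul_mem c hx.1, fun t => by simp [hx.2 t, smul_comm c]⟩

/-- The roots of `S` with respect to `H`: the nonzero weights with nonzero weight space. -/
def IsRoot (A : SuperLieAlg L) (S : Submodule ℂ L) (H : LieSubalgebra ℂ (A.part 0))
    (α : Module.Dual ℂ H) : Prop :=
  α ≠ 0 ∧ A.weightSpace S H α ≠ ⊥

/-- Borel subalgebras `𝔟 = 𝔥 ⊕ 𝔫⁺` of the subalgebra `S ⊇ 𝔤₀` of `𝔤`; only `S = 𝔤` and `S = 𝔤₀`
are used. They are given by a Cartan subalgebra `H` of `𝔤₀` and a coweight `h ∈ H` on which all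
roots take nonzero real values; `𝔥` is the centralizer of `H` and `𝔫⁺` is the sum of the root
spaces for the roots that are positive on `h`. -/
def IsBorelIn (A : SuperLieAlg L) (S b : Submodule ℂ L) : Prop :=
  ∃ H : LieSubalgebra ℂ (A.part 0), H.IsCartanSubalgebra ∧
    ∃ h : H, (∀ α, A.IsRoot S H α → (α h).im = 0 ∧ α h ≠ 0) ∧
      b = A.weightSpace S H 0 ⊔
        ⨆ α : Module.Dual ℂ H, ⨆ _ : A.IsRoot S H α ∧ 0 < (α h).re, A.weightSpace S H α

/-- Borel subalgebras of `𝔤`. -/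
def IsBorel (A : SuperLieAlg L) (b : Submodule ℂ L) : Prop := A.IsBorelIn ⊤ b

/-- Borel subalgebras of the Lie algebra `𝔤₀`. -/
def IsEvenBorel (A : SuperLieAlg L) (b : Submodule ℂ L) : Prop := A.IsBorelIn (A.part 0) b

theorem br_mem_of_homogeneous (A : SuperLieAlg L) {S : Submodule ℂ L} (hS : A.IsGraded S)
    (h : ∀ i j, ∀ x ∈ S, x ∈ A.part i → ∀ y ∈ S, y ∈ A.part j → A.br x y ∈ S)
    {x y : L} (hx : x ∈ S) (hy : y ∈ S) : A.br x y ∈ S := by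
  obtain ⟨x0, hx0, x1, hx1, rfl⟩ := Submodule.mem_sup.1 (hS hx)
  obtain ⟨y0, hy0, y1, hy1, rfl⟩ := Submodule.mem_sup.1 (hS hy)
  simp only [map_add, LinearMap.add_apply]
  exact S.add_mem
    (S.add_mem (h _ _ _ hx0.1 hx0.2 _ hy0.1 hy0.2) (h _ _ _ hx1.1 hx1.2 _ hy0.1 hy0.2))
    (S.add_mem (h _ _ _ hx0.1 hx0.2 _ hy1.1 hy1.2) (h _ _ _ hx1.1 hx1.2 _ hy1.1 hy1.2))

/-- Sub-superalgebras. -/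
structure Sub (A : SuperLieAlg L) where
  carrier : Submodule ℂ L
  graded : A.IsGraded carrier
  br_mem : ∀ {x y}, x ∈ carrier → y ∈ carrier → A.br x y ∈ carrier

/-- A sub-superalgebra as a Lie superalgebra. -/
def Sub.toAlg {A : SuperLieAlg L} (S : A.Sub) : SuperLieAlg S.carrier where
  toGrading := A.restrict S.carrier S.graded
  br := LinearMap.mk₂ ℂ (fun x y => (⟨A.br x y, S.br_mem x.2 y.2⟩ : S.carrier))
    (fun x y z => Subtype.ext (by simp)) (fun c x y => Subtype.ext (by simp))
    (fun x y z => Subtype.ext (by simp)) (fun c x y => Subtype.ext (by simp))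
  br_mem := fun hx hy => A.br_mem hx hy
  br_skew := fun hx hy => Subtype.ext (A.br_skew hx hy)
  jacobi := fun hx hy hz => Subtype.ext (A.jacobi hx hy hz)

/-- The direct product of two Lie superalgebras. -/
def prod (A : SuperLieAlg L) (B : SuperLieAlg L') : SuperLieAlg (L × L') where
  toGrading := A.toGrading.prod B.toGrading
  br := LinearMap.mk₂ ℂ (fun x y => (A.br x.1 y.1, B.br x.2 y.2))
    (fun x y z => by simp) (fun c x y => by simp)
    (fun x y z => by simp) (fun c x y => by simp)
  br_mem := fun hx hy => ⟨A.br_mem hx.1 hy.1, B.br_mem hx.2 hy.2⟩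
  br_skew := fun hx hy => Prod.ext (A.br_skew hx.1 hy.1) (B.br_skew hx.2 hy.2)
  jacobi := fun hx hy hz => Prod.ext (A.jacobi hx.1 hy.1 hz.1) (B.jacobi hx.2 hy.2 hz.2)

/-- The one-dimensional even Lie algebra `ℂ`. -/
def line : SuperLieAlg ℂ where
  part i := if i = 0 then ⊤ else ⊥
  isCompl := by simpa using isCompl_top_bot
  br := 0
  br_mem := fun _ _ => by simp
  br_skew := fun _ _ => by simp
  jacobi := fun _ _ _ => by simp

end SuperLieAlg

namespace SuperRep

variable {A : SuperLieAlg L} {A' : SuperLieAlg L'}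

/-- The parity shift `ΠV` of a representation. -/
def shift (R : SuperRep A V) : SuperRep A V where
  toGrading := R.toGrading.shift
  act := R.act
  act_mem := fun {i j x v} hx hv => by
    have h := R.act_mem hx (show v ∈ R.part (j + 1) from hv)
    rw [← add_assoc] at h
    exact h
  act_br := fun hx hy v => R.act_br hx hy v

/-- The restriction of a representation to a sub-superalgebra. -/
def restrictAlg (R : SuperRep A V) (S : A.Sub) : SuperRep S.toAlg V where
  toGrading := R.toGrading
  act := R.act ∘ₗ S.carrier.subtype
  act_mem := fun hx hv => R.act_mem hx hv
  act_br := fun hx hy v => R.act_br hx hy v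

/-- The representation on an invariant graded subspace. -/
def restrictSpace (R : SuperRep A V) (W : Submodule ℂ V) (hW : R.IsGraded W)
    (hA : ∀ x, ∀ v ∈ W, R.act x v ∈ W) : SuperRep A W where
  toGrading := R.restrict W hW
  act :=
    { toFun := fun x => (R.act x).restrict (hA x)
      map_add' := fun x y => by ext v; simp [LinearMap.restrict_apply]
      map_smul' := fun c x => by ext v; simp [LinearMap.restrict_apply] }
  act_mem := fun hx hv => R.act_mem hx hv
  act_br := fun hx hy v => Subtype.ext (R.act_br hx hy (v : V))

/-- A representation of `A` extended to `A × ℂ`, with `ℂ` acting by the character `c ↦ a c`. -/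
def withScalar (R : SuperRep A V) (a : ℂ) : SuperRep (A.prod SuperLieAlg.line) V where
  toGrading := R.toGrading
  act := R.act.coprod (LinearMap.toSpanSingleton ℂ (Module.End ℂ V) (a • LinearMap.id))
  act_mem := fun {i j x v} hx hv => by
    have h1 := R.act_mem hx.1 hv
    have h2 : x.2 ∈ (if i = 0 then (⊤ : Submodule ℂ ℂ) else ⊥) := hx.2
    by_cases hi : i = 0
    · subst hi
      rw [zero_add] at h1 ⊢
      simpa using (R.part j).add_mem h1 ((R.part j).smul_mem x.2 ((R.part j).smul_mem a hv))
    · rw [if_neg hi, Submodule.mem_bot] at h2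
      simpa [h2] using h1
  act_br := fun {i j x y} hx hy v => by
    have h := R.act_br hx.1 hy.1 v
    have hx2 : x.2 ∈ (if i = 0 then (⊤ : Submodule ℂ ℂ) else ⊥) := hx.2
    have hy2 : y.2 ∈ (if j = 0 then (⊤ : Submodule ℂ ℂ) else ⊥) := hy.2
    have e : (A.prod SuperLieAlg.line).br x y = (A.br x.1 y.1, 0) := rfl
    rw [e]
    by_cases hi : i = 0
    · subst hi
      by_cases hj : j = 0
      · subst hj
        simp only [mul_zero, sgn_zero, one_smul] at h ⊢
        simp [h]
        module
      · rw [if_neg hj, Submodule.mem_bot] at hy2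
        simp only [zero_mul, sgn_zero, one_smul] at h ⊢
        simp [h, hy2]
    · rw [if_neg hi, Submodule.mem_bot] at hx2
      by_cases hj : j = 0
      · subst hj
        simp only [mul_zero, sgn_zero, one_smul] at h ⊢
        simp [h, hx2]
      · rw [if_neg hj, Submodule.mem_bot] at hy2
        simp [h, hx2, hy2]

theorem semidirect_aux (R : SuperRep A V) {i j : ZMod 2} {y : L} {u : V}
    (hu : u ∈ R.part i) (hy : y ∈ A.part j) :
    (2 : ℂ) • R.act (A.oddProj y) (R.oddProj u) - R.act y u = -(sgn (i * j) • R.act y u) := by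
  rcases zmod2_cases i with rfl | rfl
  · simp [R.oddProj_of_even hu, sgn_zero]
  · rcases zmod2_cases j with rfl | rfl
    · simp [A.oddProj_of_even hy, sgn_zero]
    · simp only [R.oddProj_of_odd hu, A.oddProj_of_odd hy, mul_one, sgn_one]
      module

/-- The bracket of the semidirect product. -/
def semidirectBr (R : SuperRep A V) : L × V →ₗ[ℂ] L × V →ₗ[ℂ] L × V :=
  LinearMap.mk₂ ℂ
    (fun x y => (A.br x.1 y.1, R.act x.1 y.2 +
      ((2 : ℂ) • R.act (A.oddProj y.1) (R.oddProj x.2) - R.act y.1 x.2)))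
    (fun x y z => by ext <;> simp; module)
    (fun c x y => by ext <;> simp; module)
    (fun x y z => by ext <;> simp; module)
    (fun c x y => by ext <;> simp; module)

theorem semidirectBr_apply (R : SuperRep A V) {i j : ZMod 2} {x y : L × V}
    (hx : x ∈ (A.toGrading.prod R.toGrading).part i)
    (hy : y ∈ (A.toGrading.prod R.toGrading).part j) :
    R.semidirectBr x y =
      (A.br x.1 y.1, R.act x.1 y.2 - sgn (i * j) • R.act y.1 x.2) := by
  rw [sub_eq_add_neg, ← R.semidirect_aux hx.2 hy.1]
  rfl

theorem semidirectBr_mem (R : SuperRep A V) {i j : ZMod 2} {x y : L × V}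
    (hx : x ∈ (A.toGrading.prod R.toGrading).part i)
    (hy : y ∈ (A.toGrading.prod R.toGrading).part j) :
    R.semidirectBr x y ∈ (A.toGrading.prod R.toGrading).part (i + j) := by
  rw [R.semidirectBr_apply hx hy]
  refine ⟨A.br_mem hx.1 hy.1, Submodule.sub_mem _ (R.act_mem hx.1 hy.2) ?_⟩
  have := R.act_mem hy.1 hx.2
  rw [add_comm] at this
  exact Submodule.smul_mem _ _ this

/-- The semidirect product `𝔤 ⋉ V`, in which `V` is an abelian ideal and `[(x, 0), (0, v)] =
(0, x v)`. For homogeneous elements the second component of `[(x, u), (y, w)]` is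
`x w - (-1)^{|x||y|} y u`, where `|u| = |x|` and `|w| = |y|`. -/
def semidirect (R : SuperRep A V) : SuperLieAlg (L × V) where
  toGrading := A.toGrading.prod R.toGrading
  br := R.semidirectBr
  br_mem := fun hx hy => R.semidirectBr_mem hx hy
  br_skew := fun {i j x y} hx hy => by
    rw [R.semidirectBr_apply hx hy, R.semidirectBr_apply hy hx]
    refine Prod.ext (A.br_skew hx.1 hy.1) ?_
    rcases zmod2_cases i with rfl | rfl <;> rcases zmod2_cases j with rfl | rfl <;>
      simp [sgn_zero, sgn_one, add_comm]
  jacobi := fun {i j k x y z} hx hy hz => by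
    rw [R.semidirectBr_apply hx (R.semidirectBr_mem hy hz),
      R.semidirectBr_apply (R.semidirectBr_mem hx hy) hz,
      R.semidirectBr_apply hy (R.semidirectBr_mem hx hz),
      R.semidirectBr_apply hx hy, R.semidirectBr_apply hy hz, R.semidirectBr_apply hx hz]
    refine Prod.ext (A.jacobi hx.1 hy.1 hz.1) ?_
    have h1 := R.act_br hx.1 hy.1 z.2
    have h2 := R.act_br hx.1 hz.1 y.2
    have h3 := R.act_br hy.1 hz.1 x.2
    have e : (1 : ZMod 2) + 1 = 0 := by decide
    rcases zmod2_cases i with rfl | rfl <;> rcases zmod2_cases j with rfl | rfl <;>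
      rcases zmod2_cases k with rfl | rfl <;>
      simp [sgn_zero, sgn_one, e] at h1 h2 h3 ⊢ <;> simp [h1, h2, h3] <;> module

/-! ### Sphericity -/

/-- `v` is a spherical vector for `𝔟`: it is even and `(𝔟 + ℂ id) v = V`. -/
def IsSphericalVector (R : SuperRep A V) (b : Submodule ℂ L) (v : V) : Prop :=
  v ∈ R.part 0 ∧ ∀ w : V, ∃ x ∈ b, ∃ c : ℂ, R.act x v + c • v = w

/-- `V` is spherical with respect to `𝔟`. -/
def IsSphericalFor (R : SuperRep A V) (b : Submodule ℂ L) : Prop :=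
  Nontrivial V ∧ ∃ v, R.IsSphericalVector b v

/-- `V` is spherical: it is spherical with respect to some Borel subalgebra. -/
def IsSpherical (R : SuperRep A V) : Prop :=
  ∃ b, A.IsBorel b ∧ R.IsSphericalFor b

/-- `V₀` is a spherical `𝔤₀`-module. -/
def IsEvenSpherical (R : SuperRep A V) : Prop :=
  R.part 0 ≠ ⊥ ∧ ∃ b, A.IsEvenBorel b ∧
    ∃ v ∈ R.part 0, ∀ w ∈ R.part 0, ∃ x ∈ b, ∃ c : ℂ, R.act x v + c • v = w

/-- `V` is numerically spherical: `V₀` is a spherical `𝔤₀`-module, and `dim V₁` is at most the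
maximum over all Borel subalgebras `𝔟` of `dim 𝔟₁`. -/
def IsNumericallySpherical (R : SuperRep A V) : Prop :=
  R.IsEvenSpherical ∧ ∃ b, A.IsBorel b ∧
    Module.finrank ℂ (R.part 1) ≤ Module.finrank ℂ (b ⊓ A.part 1 : Submodule ℂ L)

/-- Two representations `(V, 𝔤, ρ)` and `(V', 𝔤', ρ')` are equivalent: some isomorphism `V ≅ V'`
of super vector spaces carries `ρ(𝔤) + ℂ id` onto `ρ'(𝔤') + ℂ id`. -/
def Equivalent (R : SuperRep A V) (R' : SuperRep A' V') : Prop :=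
  ∃ e : V ≃ₗ[ℂ] V', (∀ i, ∀ v ∈ R.part i, e v ∈ R'.part i) ∧
    (∀ x (c : ℂ), ∃ x' : L', ∃ c' : ℂ, ∀ v, e (R.act x v + c • v) = R'.act x' (e v) + c' • e v) ∧
    (∀ x' (c' : ℂ), ∃ x : L, ∃ c : ℂ, ∀ v, e (R.act x v + c • v) = R'.act x' (e v) + c' • e v)

theorem ker_isGraded (R : SuperRep A V) {v : V} (hv : v ∈ R.part 0) :
    A.IsGraded (LinearMap.ker (R.act.flip v)) := by
  intro x hx
  have hx' : R.act x v = 0 := hx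
  have hx2 : x ∈ A.part 0 ⊔ A.part 1 := by
    rw [codisjoint_iff.1 A.isCompl.codisjoint]; trivial
  obtain ⟨y, hy, z, hz, rfl⟩ := Submodule.mem_sup.1 hx2
  have h0 : R.act y v ∈ R.part 0 := by simpa using R.act_mem hy hv
  have h1 : R.act z v ∈ R.part 1 := by simpa using R.act_mem hz hv
  have hs : R.act y v + R.act z v = 0 := by simpa using hx'
  have hy0 : R.act y v = 0 := by
    refine (Submodule.disjoint_def.1 R.isCompl.disjoint) _ h0 ?_
    rw [eq_neg_of_add_eq_zero_left hs]
    exact Submodule.neg_mem _ h1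
  have hz0 : R.act z v = 0 := by rwa [hy0, zero_add] at hs
  exact Submodule.mem_sup.2 ⟨y, ⟨hy0, hy⟩, z, ⟨hz0, hz⟩, rfl⟩

/-- Isomorphism of `R` with the twist of `R'` by the map `σ`. -/
def IsoAlong (σ : L → L') (R : SuperRep A V) (R' : SuperRep A' V') : Prop :=
  ∃ e : V ≃ₗ[ℂ] V', (∀ i, ∀ v ∈ R.part i, e v ∈ R'.part i) ∧
    ∀ x v, e (R.act x v) = R'.act (σ x) (e v)

/-- The stabilizer `{x | x v = 0}` in `𝔤` of an even vector `v`. -/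
def stabilizer (R : SuperRep A V) (v : V) (hv : v ∈ R.part 0) : A.Sub where
  carrier := LinearMap.ker (R.act.flip v)
  graded := R.ker_isGraded hv
  br_mem := fun {x y} hx hy => by
    refine A.br_mem_of_homogeneous (R.ker_isGraded hv) ?_ hx hy
    intro i j x hx hxi y hy hyj
    have hx' : R.act x v = 0 := hx
    have hy' : R.act y v = 0 := hy
    have h : R.act (A.br x y) v = 0 := by rw [R.act_br hxi hyj, hx', hy']; simp
    exact h

end SuperRep

end General

/-! ### The general linear Lie superalgebra -/

section GenLin

variable {ι : Type*} [Fintype ι] [DecidableEq ι]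

/-- The grading of the square matrices indexed by a set with parities `p`: the matrix unit
`E_{ab}` has parity `p a + p b`. -/
def matGrading (p : ι → ZMod 2) : Grading (Matrix ι ι ℂ) where
  part i :=
    { carrier := {X | ∀ a b, p a + p b ≠ i → X a b = 0}
      zero_mem' := fun _ _ _ => rfl
      add_mem' := fun {X Y} hX hY a b h => by simp [hX a b h, hY a b h]
      smul_mem' := fun c X hX a b h => by simp [hX a b h] }
  isCompl := by
    constructor
    · rw [Submodule.disjoint_def]
      intro X h0 h1
      ext a b
      rcases zmod2_cases (p a + p b) with h | h
      · exact h1 a b (by rw [h]; decide)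
      · exact h0 a b (by rw [h]; decide)
    · rw [codisjoint_iff, eq_top_iff]
      intro X _
      refine Submodule.mem_sup.2 ⟨Matrix.of fun a b => if p a + p b = 0 then X a b else 0, ?_,
        Matrix.of fun a b => if p a + p b = 0 then 0 else X a b, ?_, ?_⟩
      · intro a b h
        simp [h]
      · intro a b h
        rcases zmod2_cases (p a + p b) with h' | h'
        · simp [h']
        · exact absurd h' h
      · ext a b
        by_cases h : p a + p b = 0 <;> simp [h]

theorem matGrading_mul_mem (p : ι → ZMod 2) {i j : ZMod 2} {X Y : Matrix ι ι ℂ}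
    (hX : X ∈ (matGrading p).part i) (hY : Y ∈ (matGrading p).part j) :
    X * Y ∈ (matGrading p).part (i + j) := by
  intro a b h
  rw [Matrix.mul_apply]
  refine Finset.sum_eq_zero fun c _ => ?_
  by_cases h1 : p a + p c = i
  · by_cases h2 : p c + p b = j
    · refine absurd ?_ h
      have e : p c + p c = 0 := by rcases zmod2_cases (p c) with h | h <;> rw [h] <;> decide
      rw [← h1, ← h2, add_assoc, ← add_assoc (p c), e, zero_add]
    · rw [hY c b h2, mul_zero]
  · rw [hX a c h1, zero_mul]

/-- The superbracket, the bilinear extension of `[X, Y] = X Y - (-1)^{|X||Y|} Y X`. -/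
def matBr (p : ι → ZMod 2) : Matrix ι ι ℂ →ₗ[ℂ] Matrix ι ι ℂ →ₗ[ℂ] Matrix ι ι ℂ :=
  LinearMap.mk₂ ℂ
    (fun X Y => X * Y - Y * X + (2 : ℂ) • ((matGrading p).oddProj Y * (matGrading p).oddProj X))
    (fun X Y Z => by simp only [map_add, mul_add, add_mul]; module)
    (fun c X Y => by simp only [map_smul, smul_mul_assoc, mul_smul_comm]; module)
    (fun X Y Z => by simp only [map_add, mul_add, add_mul]; module)
    (fun c X Y => by simp only [map_smul, smul_mul_assoc, mul_smul_comm]; module)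

theorem matBr_apply (p : ι → ZMod 2) {i j : ZMod 2} {X Y : Matrix ι ι ℂ}
    (hX : X ∈ (matGrading p).part i) (hY : Y ∈ (matGrading p).part j) :
    matBr p X Y = X * Y - sgn (i * j) • (Y * X) := by
  have h : matBr p X Y = X * Y - Y * X +
    (2 : ℂ) • ((matGrading p).oddProj Y * (matGrading p).oddProj X) := rfl
  rw [h]
  rcases zmod2_cases i with rfl | rfl
  · simp [(matGrading p).oddProj_of_even hX, sgn_zero]
  · rcases zmod2_cases j with rfl | rfl
    · simp [(matGrading p).oddProj_of_even hY, sgn_zero]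
    · rw [(matGrading p).oddProj_of_odd hX, (matGrading p).oddProj_of_odd hY, mul_one, sgn_one]
      module

theorem matBr_mem (p : ι → ZMod 2) {i j : ZMod 2} {X Y : Matrix ι ι ℂ}
    (hX : X ∈ (matGrading p).part i) (hY : Y ∈ (matGrading p).part j) :
    matBr p X Y ∈ (matGrading p).part (i + j) := by
  rw [matBr_apply p hX hY]
  refine Submodule.sub_mem _ (matGrading_mul_mem p hX hY) (Submodule.smul_mem _ _ ?_)
  have h := matGrading_mul_mem p hY hX
  rwa [add_comm] at h

/-- The Lie superalgebra `𝔤𝔩` of all matrices indexed by a finite set with parities `p`. -/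
def gl (p : ι → ZMod 2) : SuperLieAlg (Matrix ι ι ℂ) where
  toGrading := matGrading p
  br := matBr p
  br_mem := fun hX hY => matBr_mem p hX hY
  br_skew := fun {i j X Y} hX hY => by
    rw [matBr_apply p hX hY, matBr_apply p hY hX]
    rcases zmod2_cases i with rfl | rfl <;> rcases zmod2_cases j with rfl | rfl <;>
      simp [sgn_zero, sgn_one, add_comm]
  jacobi := fun {i j k X Y Z} hX hY hZ => by
    rw [matBr_apply p hX (matBr_mem p hY hZ), matBr_apply p (matBr_mem p hX hY) hZ,
      matBr_apply p hY (matBr_mem p hX hZ), matBr_apply p hX hY, matBr_apply p hY hZ,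
      matBr_apply p hX hZ]
    have e : (1 : ZMod 2) + 1 = 0 := by decide
    rcases zmod2_cases i with rfl | rfl <;> rcases zmod2_cases j with rfl | rfl <;>
      rcases zmod2_cases k with rfl | rfl <;>
      simp [sgn_zero, sgn_one, e] <;> noncomm_ring

/-- The standard representation on column vectors. -/
def std (p : ι → ZMod 2) : SuperRep (gl p) (ι → ℂ) where
  toGrading := Grading.ofParity p
  act := Matrix.toLin'.toLinearMap
  act_mem := fun {i j X v} hX hv a ha => by
    simp only [LinearEquiv.coe_coe, Matrix.toLin'_apply, Matrix.mulVec, dotProduct]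
    refine Finset.sum_eq_zero fun b _ => ?_
    by_cases h1 : p a + p b = i
    · by_cases h2 : p b = j
      · refine absurd ?_ ha
        have e : p b + p b = 0 := by rcases zmod2_cases (p b) with h | h <;> rw [h] <;> decide
        rw [← h1, ← h2, add_assoc, e, add_zero]
      · rw [hv b h2, mul_zero]
    · rw [hX a b h1, zero_mul]
  act_br := fun {i j X Y} hX hY v => by
    have h : (gl p).br X Y = _ := matBr_apply p hX hY
    rw [h]
    simp

/-- The matrix of the action of `X` on the dual of the standard representation, in the basis dual
to the standard one. -/
def dualMat (p : ι → ZMod 2) : Matrix ι ι ℂ →ₗ[ℂ] Matrix ι ι ℂ where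
  toFun X := Matrix.of fun b a => -(sgn ((p a + p b) * p a) * X a b)
  map_add' X Y := by ext; simp; ring
  map_smul' c X := by ext; simp; ring

theorem dualMat_mul (p : ι → ZMod 2) {i j : ZMod 2} {X Y : Matrix ι ι ℂ}
    (hX : X ∈ (matGrading p).part i) (hY : Y ∈ (matGrading p).part j) :
    dualMat p X * dualMat p Y = -(sgn (i * j) • dualMat p (Y * X)) := by
  ext c a
  simp only [Matrix.mul_apply, dualMat, LinearMap.coe_mk, AddHom.coe_mk, Matrix.of_apply,
    Matrix.neg_apply, Matrix.smul_apply, smul_eq_mul, mul_neg, neg_neg, Finset.mul_sum]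
  refine Finset.sum_congr rfl fun b _ => ?_
  by_cases h1 : p b + p c = i
  · by_cases h2 : p a + p b = j
    · have e : sgn ((p b + p c) * p b) * sgn ((p a + p b) * p a) =
          sgn (i * j) * sgn ((p a + p c) * p a) := by
        rw [← h1, ← h2, ← sgn_add, ← sgn_add]
        congr 1
        generalize p a = x, p b = y, p c = z
        revert x y z
        decide
      linear_combination (X b c * Y a b) * e
    · rw [hY a b h2]; simp
  · rw [hX b c h1]; simp

/-- The dual of the standard representation, in the basis dual to the standard one (where `e_a*`
has the parity of `e_a`). For homogeneous `X` and `φ`, `(X φ)(v) = -(-1)^{|X||φ|} φ(X v)`. -/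
def dualStd (p : ι → ZMod 2) : SuperRep (gl p) (ι → ℂ) where
  toGrading := Grading.ofParity p
  act := Matrix.toLin'.toLinearMap ∘ₗ dualMat p
  act_mem := fun {i j X v} hX hv => by
    refine (std p).act_mem (x := dualMat p X) ?_ hv
    intro a b h
    have h' : X b a = 0 := hX b a (by rwa [add_comm])
    simp [dualMat, h']
  act_br := fun {i j X Y} hX hY v => by
    have h : (gl p).br X Y = _ := matBr_apply p hX hY
    have h1 := dualMat_mul p hX hY
    have h2 := dualMat_mul p hY hX
    have e : dualMat p (X * Y - sgn (i * j) • (Y * X)) =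
        dualMat p X * dualMat p Y - sgn (i * j) • (dualMat p Y * dualMat p X) := by
      rw [h1, h2, map_sub, map_smul, mul_comm j i]
      have hs : sgn (i * j) * sgn (i * j) = 1 := by
        rcases zmod2_cases (i * j) with h | h <;> simp [h, sgn_zero, sgn_one]
      rw [smul_neg, smul_smul, hs, one_smul]
      abel
    rw [h]
    simp only [LinearMap.comp_apply, LinearEquiv.coe_coe, e]
    simp

/-! ### Tensor powers, symmetric powers and exterior powers

The `d`-th tensor power of `ℂ^ι` is the space of functions on `Fin d → ι`; the function `t` stands
for `∑ f, t f • e_{f 0} ⊗ ⋯ ⊗ e_{f (d - 1)}`. -/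

/-- The parity of the first `k` factors of a basis tensor. -/
def preParity (p : ι → ZMod 2) {d : ℕ} (k : Fin d) (f : Fin d → ι) : ZMod 2 :=
  ∑ l with l < k, p (f l)

/-- The action of a matrix in the `k`-th tensor factor:
`v_1 ⊗ ⋯ ⊗ v_d ↦ (-1)^{|X|(|v_1| + ⋯ + |v_{k-1}|)} v_1 ⊗ ⋯ ⊗ X v_k ⊗ ⋯ ⊗ v_d`. -/
def slotAct (p : ι → ZMod 2) {d : ℕ} (k : Fin d) :
    Matrix ι ι ℂ →ₗ[ℂ] Module.End ℂ ((Fin d → ι) → ℂ) :=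
  LinearMap.mk₂ ℂ
    (fun X t f => ∑ a, sgn ((p (f k) + p a) * preParity p k f) * X (f k) a *
      t (Function.update f k a))
    (fun X Y t => by
      funext f
      simp only [Matrix.add_apply, Pi.add_apply, ← Finset.sum_add_distrib]
      exact Finset.sum_congr rfl fun _ _ => by ring)
    (fun c X t => by
      funext f
      simp only [Matrix.smul_apply, Pi.smul_apply, smul_eq_mul, Finset.mul_sum]
      exact Finset.sum_congr rfl fun _ _ => by ring)
    (fun X t u => by
      funext f
      simp only [Pi.add_apply, ← Finset.sum_add_distrib]
      exact Finset.sum_congr rfl fun _ _ => by ring)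
    (fun c X t => by
      funext f
      simp only [Pi.smul_apply, smul_eq_mul, Finset.mul_sum]
      exact Finset.sum_congr rfl fun _ _ => by ring)

theorem slotAct_apply (p : ι → ZMod 2) {d : ℕ} (k : Fin d) (X : Matrix ι ι ℂ)
    (t : (Fin d → ι) → ℂ) (f : Fin d → ι) :
    slotAct p k X t f = ∑ a, sgn ((p (f k) + p a) * preParity p k f) * X (f k) a *
      t (Function.update f k a) := rfl

theorem slotAct_apply_hom (p : ι → ZMod 2) {d : ℕ} (k : Fin d) {i : ZMod 2} {X : Matrix ι ι ℂ}
    (hX : X ∈ (matGrading p).part i) (t : (Fin d → ι) → ℂ) (f : Fin d → ι) :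
    slotAct p k X t f = ∑ a, sgn (i * preParity p k f) * X (f k) a *
      t (Function.update f k a) := by
  rw [slotAct_apply]
  refine Finset.sum_congr rfl fun a _ => ?_
  by_cases h : p (f k) + p a = i
  · rw [h]
  · rw [hX _ _ h]; simp

theorem preParity_update_of_le (p : ι → ZMod 2) {d : ℕ} {k l : Fin d} (h : l ≤ k) (f : Fin d → ι)
    (a : ι) : preParity p l (Function.update f k a) = preParity p l f := by
  refine Finset.sum_congr rfl fun m hm => ?_
  have hm' : m < l := by simpa using hm
  rw [Function.update_of_ne (hm'.trans_le h).ne]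

theorem sum_update (p : ι → ZMod 2) {d : ℕ} (s : Finset (Fin d)) {k : Fin d} (h : k ∈ s)
    (f : Fin d → ι) (a : ι) :
    ∑ l ∈ s, p (Function.update f k a l) = ∑ l ∈ s, p (f l) + (p (f k) + p a) := by
  rw [← Finset.add_sum_erase s _ h, ← Finset.add_sum_erase s _ h, Function.update_self]
  have e : ∑ l ∈ s.erase k, p (Function.update f k a l) = ∑ l ∈ s.erase k, p (f l) :=
    Finset.sum_congr rfl fun m hm => by rw [Function.update_of_ne (Finset.ne_of_mem_erase hm)]
  rw [e]
  generalize p a = x, p (f k) = y, ∑ l ∈ s.erase k, p (f l) = z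
  revert x y z
  decide

theorem slotAct_mul (p : ι → ZMod 2) {d : ℕ} (k : Fin d) (X Y : Matrix ι ι ℂ)
    (t : (Fin d → ι) → ℂ) : slotAct p k (X * Y) t = slotAct p k X (slotAct p k Y t) := by
  funext f
  simp only [slotAct_apply, Matrix.mul_apply, Finset.mul_sum, Finset.sum_mul,
    Function.update_self, Function.update_idem, preParity_update_of_le p le_rfl]
  rw [Finset.sum_comm]
  refine Finset.sum_congr rfl fun b _ => Finset.sum_congr rfl fun a _ => ?_
  have e : sgn ((p (f k) + p b) * preParity p k f) * sgn ((p b + p a) * preParity p k f) =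
      sgn ((p (f k) + p a) * preParity p k f) := by
    rw [← sgn_add]
    congr 1
    generalize p a = x, p (f k) = y, p b = z, preParity p k f = w
    revert x y z w
    decide
  rw [← e]
  ring

theorem slotAct_comm (p : ι → ZMod 2) {d : ℕ} {k l : Fin d} (hkl : k < l) {i j : ZMod 2}
    {X Y : Matrix ι ι ℂ} (hX : X ∈ (matGrading p).part i) (hY : Y ∈ (matGrading p).part j)
    (t : (Fin d → ι) → ℂ) :
    slotAct p k X (slotAct p l Y t) = sgn (i * j) • slotAct p l Y (slotAct p k X t) := by
  funext f
  simp only [Pi.smul_apply, smul_eq_mul, slotAct_apply_hom p k hX, slotAct_apply_hom p l hY,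
    Finset.mul_sum, preParity_update_of_le p hkl.le]
  rw [Finset.sum_comm]
  refine Finset.sum_congr rfl fun b _ => Finset.sum_congr rfl fun a _ => ?_
  rw [Function.update_of_ne hkl.ne', Function.update_of_ne hkl.ne,
    Function.update_comm hkl.ne']
  by_cases h : p (f k) + p a = i
  · have e : preParity p l (Function.update f k a) = preParity p l f + i := by
      rw [← h]
      exact sum_update p _ (by simpa using hkl) f a
    rw [e, mul_add, sgn_add, mul_comm j i]
    ring
  · rw [hX _ _ h]; simp

/-- The representation on the `d`-th tensor power of the standard representation. -/
def tensor (p : ι → ZMod 2) (d : ℕ) : SuperRep (gl p) ((Fin d → ι) → ℂ) where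
  toGrading := Grading.ofParity fun f => ∑ k, p (f k)
  act := ∑ k, slotAct p k
  act_mem := fun {i j X t} hX ht => by
    rw [LinearMap.sum_apply, LinearMap.sum_apply]
    refine Submodule.sum_mem _ fun k _ => ?_
    intro f hf
    rw [slotAct_apply]
    refine Finset.sum_eq_zero fun a _ => ?_
    by_cases h1 : p (f k) + p a = i
    · by_cases h2 : ∑ l, p (Function.update f k a l) = j
      · refine absurd ?_ hf
        rw [← h2, sum_update p _ (Finset.mem_univ k), h1]
        change ∑ l, p (f l) = _
        generalize ∑ l, p (f l) = x
        clear hX h1 hf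
        revert x i
        decide
      · rw [ht _ h2, mul_zero]
    · rw [hX _ _ h1]; simp
  act_br := fun {i j X Y} hX hY t => by
    have h : (gl p).br X Y = _ := matBr_apply p hX hY
    rw [h]
    simp only [LinearMap.sum_apply, map_sum, Finset.smul_sum]
    rw [Finset.sum_comm (f := fun x y => sgn (i * j) • slotAct p y Y (slotAct p x X t)),
      ← Finset.sum_sub_distrib]
    refine Finset.sum_congr rfl fun k _ => ?_
    rw [← Finset.sum_sub_distrib, Finset.sum_eq_single k]
    · rw [map_sub, map_smul, LinearMap.sub_apply, LinearMap.smul_apply, slotAct_mul, slotAct_mul]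
    · intro l _ hl
      rcases lt_or_gt_of_ne hl with h | h
      · rw [slotAct_comm p h hX hY t, sub_self]
      · rw [slotAct_comm p h hY hX t, smul_smul, mul_comm j i]
        have hs : sgn (i * j) * sgn (i * j) = 1 := by
          rcases zmod2_cases (i * j) with h | h <;> simp [h, sgn_zero, sgn_one]
        rw [hs, one_smul, sub_self]
    · simp

/-- The tensors on which the transposition of two neighbouring factors, acting by
`u ⊗ v ↦ (-1)^{|u||v|} v ⊗ u`, is multiplication by `η`. -/
def superSym (p : ι → ZMod 2) (η : ℂ) (d : ℕ) : Submodule ℂ ((Fin d → ι) → ℂ) where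
  carrier := {t | ∀ k l : Fin d, (k : ℕ) + 1 = l → ∀ f,
    t (f ∘ Equiv.swap k l) = η * (sgn (p (f k) * p (f l)) * t f)}
  zero_mem' := fun k l _ f => by simp
  add_mem' := fun {t u} ht hu k l h f => by
    simp only [Pi.add_apply, ht k l h f, hu k l h f]; ring
  smul_mem' := fun c t ht k l h f => by
    simp only [Pi.smul_apply, smul_eq_mul, ht k l h f]; ring

theorem superSym_isGraded (p : ι → ZMod 2) (η : ℂ) (d : ℕ) :
    (tensor p d).IsGraded (superSym p η d) := by
  intro t ht
  have key : ∀ (k l : Fin d) (f : Fin d → ι),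
      ∑ m, p ((f ∘ Equiv.swap k l) m) = ∑ m, p (f m) := fun k l f =>
    Equiv.sum_comp (Equiv.swap k l) fun m => p (f m)
  refine Submodule.mem_sup.2 ⟨fun f => if ∑ m, p (f m) = 0 then t f else 0, ⟨?_, ?_⟩,
    fun f => if ∑ m, p (f m) = 0 then 0 else t f, ⟨?_, ?_⟩, ?_⟩
  · intro k l h f
    simp only [key, ht k l h f]
    split_ifs <;> simp
  · intro f hf
    simp [hf]
  · intro k l h f
    simp only [key, ht k l h f]
    split_ifs <;> simp
  · intro f hf
    rcases zmod2_cases (∑ m, p (f m)) with h | h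
    · simp [h]
    · exact absurd h hf
  · funext f
    by_cases h : ∑ m, p (f m) = 0 <;> simp [h]

theorem preParity_swap_of_le (p : ι → ZMod 2) {d : ℕ} {k l m : Fin d} (hk : m ≤ k) (hl : m ≤ l)
    (f : Fin d → ι) : preParity p m (f ∘ Equiv.swap k l) = preParity p m f := by
  refine Finset.sum_congr rfl fun n hn => ?_
  have hn' : n < m := by simpa using hn
  rw [Function.comp_apply, Equiv.swap_apply_of_ne_of_ne (hn'.trans_le hk).ne (hn'.trans_le hl).ne]

theorem preParity_swap_of_lt (p : ι → ZMod 2) {d : ℕ} {k l m : Fin d} (hk : k < m) (hl : l < m)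
    (f : Fin d → ι) : preParity p m (f ∘ Equiv.swap k l) = preParity p m f := by
  refine Finset.sum_equiv (Equiv.swap k l) (fun n => ?_) fun _ _ => rfl
  simp only [Finset.mem_filter, Finset.mem_univ, true_and]
  by_cases h1 : n = k
  · subst h1; simp [hk, hl]
  · by_cases h2 : n = l
    · subst h2; simp [hk, hl]
    · rw [Equiv.swap_apply_of_ne_of_ne h1 h2]

theorem preParity_succ (p : ι → ZMod 2) {d : ℕ} {k l : Fin d} (h : (k : ℕ) + 1 = l)
    (f : Fin d → ι) : preParity p l f = preParity p k f + p (f k) := by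
  have e : (Finset.univ.filter fun m : Fin d => m < l) =
      insert k (Finset.univ.filter fun m : Fin d => m < k) := by
    ext m
    simp only [Finset.mem_filter, Finset.mem_univ, true_and, Finset.mem_insert, Fin.lt_def,
      Fin.ext_iff]
    omega
  rw [preParity, preParity, e, Finset.sum_insert (by simp), add_comm]

theorem update_swap {d : ℕ} (f : Fin d → ι) (k l m : Fin d) (a : ι) :
    Function.update (f ∘ Equiv.swap k l) m a =
      Function.update f (Equiv.swap k l m) a ∘ Equiv.swap k l := by
  funext n
  by_cases h : n = m
  · subst h; simp
  · rw [Function.update_of_ne h, Function.comp_apply, Function.comp_apply,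
      Function.update_of_ne (fun e => h ((Equiv.swap k l).injective e))]

theorem slotAct_swap (p : ι → ZMod 2) {η : ℂ} {d : ℕ} (X : Matrix ι ι ℂ)
    {t : (Fin d → ι) → ℂ} (ht : t ∈ superSym p η d) {k l : Fin d} (h : (k : ℕ) + 1 = l)
    (m : Fin d) (f : Fin d → ι) :
    slotAct p m X t (f ∘ Equiv.swap k l) =
      η * (sgn (p (f k) * p (f l)) * slotAct p (Equiv.swap k l m) X t f) := by
  have hkl : k < l := by rw [Fin.lt_def]; omega
  simp only [slotAct_apply, Finset.mul_sum]
  refine Finset.sum_congr rfl fun a _ => ?_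
  rw [update_swap, ht k l h, Function.comp_apply]
  by_cases h1 : m = k
  · subst h1
    rw [Equiv.swap_apply_left, preParity_swap_of_le p le_rfl hkl.le, preParity_succ p h,
      Function.update_self, Function.update_of_ne hkl.ne]
    have e : sgn ((p (f l) + p a) * preParity p m f) * sgn (p (f m) * p a) =
        sgn (p (f m) * p (f l)) * sgn ((p (f l) + p a) * (preParity p m f + p (f m))) := by
      rw [← sgn_add, ← sgn_add]
      congr 1
      generalize p a = x, p (f m) = y, p (f l) = z, preParity p m f = w
      revert x y z w
      decide
    linear_combination (η * X (f l) a * t (Function.update f l a)) * e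
  · by_cases h2 : m = l
    · subst h2
      rw [Equiv.swap_apply_right, preParity_succ p h, preParity_swap_of_le p le_rfl hkl.le,
        Function.comp_apply, Equiv.swap_apply_left, Function.update_self,
        Function.update_of_ne hkl.ne']
      have e : sgn ((p (f k) + p a) * (preParity p k f + p (f m))) * sgn (p a * p (f m)) =
          sgn (p (f k) * p (f m)) * sgn ((p (f k) + p a) * preParity p k f) := by
        rw [← sgn_add, ← sgn_add]
        congr 1
        generalize p a = x, p (f k) = y, p (f m) = z, preParity p k f = w
        revert x y z w
        decide
      linear_combination (η * X (f k) a * t (Function.update f k a)) * e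
    · rw [Equiv.swap_apply_of_ne_of_ne h1 h2, Function.update_of_ne (Ne.symm h1),
        Function.update_of_ne (Ne.symm h2)]
      have e : preParity p m (f ∘ Equiv.swap k l) = preParity p m f := by
        rcases lt_or_gt_of_ne h1 with h3 | h3
        · exact preParity_swap_of_le p h3.le (h3.trans hkl).le f
        · refine preParity_swap_of_lt p h3 ?_ f
          have h2' : (m : ℕ) ≠ l := fun e => h2 (Fin.ext e)
          rw [Fin.lt_def] at h3 ⊢
          omega
      rw [e]
      ring

theorem superSym_stable (p : ι → ZMod 2) (η : ℂ) (d : ℕ) (X : Matrix ι ι ℂ)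
    (t : (Fin d → ι) → ℂ) (ht : t ∈ superSym p η d) : (tensor p d).act X t ∈ superSym p η d := by
  intro k l h f
  have e : ∀ g, (tensor p d).act X t g = ∑ m, slotAct p m X t g := fun g => by
    simp [tensor]
  rw [e, e, Finset.mul_sum, Finset.mul_sum]
  simp only [slotAct_swap p X ht h]
  exact Equiv.sum_comp (Equiv.swap k l) fun m =>
    η * (sgn (p (f k) * p (f l)) * slotAct p m X t f)

/-- The `d`-th (super)symmetric power of the standard representation, as the space of symmetric
tensors. -/
def symPow (p : ι → ZMod 2) (d : ℕ) : SuperRep (gl p) (superSym p 1 d) :=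
  (tensor p d).restrictSpace _ (superSym_isGraded p 1 d) (superSym_stable p 1 d)

/-- The `d`-th (super)exterior power of the standard representation, as the space of
antisymmetric tensors. -/
def extPow (p : ι → ZMod 2) (d : ℕ) : SuperRep (gl p) (superSym p (-1) d) :=
  (tensor p d).restrictSpace _ (superSym_isGraded p (-1) d) (superSym_stable p (-1) d)

/-- The form on the dual of the standard representation induced by a tensor of degree two:
`B(φ, ψ) = (φ ⊗ ψ)(t)`, where `(φ ⊗ ψ)(u ⊗ v) = (-1)^{|ψ||u|} φ(u) ψ(v)`. -/
def inducedForm (p : ι → ZMod 2) (t : (Fin 2 → ι) → ℂ) (φ ψ : ι → ℂ) : ℂ :=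
  ∑ a, ∑ b, sgn (p b * p a) * t ![a, b] * (φ a * ψ b)

/-- The homogeneous matrices of parity `i` that preserve the form induced by `t` on the dual of
the standard representation: `B(X φ, ψ) + (-1)^{|X||φ|} B(φ, X ψ) = 0`. -/
def ospPart (p : ι → ZMod 2) (t : (Fin 2 → ι) → ℂ) (i : ZMod 2) : Submodule ℂ (Matrix ι ι ℂ) where
  carrier := {X | X ∈ (gl p).part i ∧ ∀ j, ∀ φ ∈ (dualStd p).part j, ∀ ψ,
    inducedForm p t ((dualStd p).act X φ) ψ +
      sgn (i * j) * inducedForm p t φ ((dualStd p).act X ψ) = 0}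
  zero_mem' := ⟨Submodule.zero_mem _, fun j φ _ ψ => by simp [inducedForm]⟩
  add_mem' := by
    rintro X Y ⟨hX, hX'⟩ ⟨hY, hY'⟩
    refine ⟨Submodule.add_mem _ hX hY, fun j φ hφ ψ => ?_⟩
    have h := congrArg₂ (· + ·) (hX' j φ hφ ψ) (hY' j φ hφ ψ)
    simp only [add_zero] at h
    rw [← h]
    simp only [inducedForm, map_add, LinearMap.add_apply, Pi.add_apply, mul_add, add_mul,
      Finset.sum_add_distrib]
    ring
  smul_mem' := by
    rintro c X ⟨hX, hX'⟩
    refine ⟨Submodule.smul_mem _ c hX, fun j φ hφ ψ => ?_⟩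
    have h := congrArg (c * ·) (hX' j φ hφ ψ)
    simp only [mul_zero] at h
    rw [← h]
    simp only [inducedForm, map_smul, LinearMap.smul_apply, Pi.smul_apply, smul_eq_mul, mul_add,
      Finset.mul_sum]
    congr 1 <;> refine Finset.sum_congr rfl fun a _ => Finset.sum_congr rfl fun b _ => by ring

/-- The superalgebra `𝔬𝔰𝔭(V*, t)` of all matrices that preserve the form induced by `t` on the
dual of the standard representation. -/
def ospDual (p : ι → ZMod 2) (t : (Fin 2 → ι) → ℂ) : Submodule ℂ (Matrix ι ι ℂ) :=
  ospPart p t 0 ⊔ ospPart p t 1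

/-- Two subspaces of `𝔤𝔩` are conjugate under the even invertible matrices. -/
def Conj (p : ι → ZMod 2) (S T : Submodule ℂ (Matrix ι ι ℂ)) : Prop :=
  ∃ g : (Matrix ι ι ℂ)ˣ, (g : Matrix ι ι ℂ) ∈ (gl p).part 0 ∧
    ∀ X, X ∈ S ↔ (g : Matrix ι ι ℂ) * X * (↑g⁻¹ : Matrix ι ι ℂ) ∈ T

end GenLin

/-! ### The case of `𝔤𝔩(m|n)` -/

/-- The parities of the standard basis of `ℂ^{m|n}`: the basis vectors indexed by `inl i` are even
(of weight `ε_i`), those indexed by `inr j` are odd (of weight `δ_j`). -/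
def par (m n : ℕ) : Fin m ⊕ Fin n → ZMod 2 := Sum.elim (fun _ => 0) (fun _ => 1)

/-- An `εδ`-string with `m` letters `ε` and `n` letters `δ`, given by the position of the `i`-th
letter `ε`, `pos (inl i)`, and of the `j`-th letter `δ`, `pos (inr j)`, counted from `0`. -/
structure EDString (m n : ℕ) where
  pos : Fin m ⊕ Fin n ≃ Fin (m + n)
  strictMono_eps : StrictMono fun i => pos (Sum.inl i)
  strictMono_delta : StrictMono fun j => pos (Sum.inr j)

/-- The Borel subalgebra attached to an `εδ`-string, spanned by the diagonal matrices and the root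
vectors `E_{ab}` for `a` to the left of `b` in the string; its even part consists of upper
triangular matrices. -/
def EDString.borel {m n : ℕ} (s : EDString m n) :
    Submodule ℂ (Matrix (Fin m ⊕ Fin n) (Fin m ⊕ Fin n) ℂ) where
  carrier := {X | ∀ a b, s.pos b < s.pos a → X a b = 0}
  zero_mem' := fun _ _ _ => rfl
  add_mem' := fun {X Y} hX hY a b h => by simp [hX a b h, hY a b h]
  smul_mem' := fun c X hX a b h => by simp [hX a b h]

/-- The representation `R` of `𝔤𝔩(m|n)` is spherical exactly for the Borel subalgebras in the
conjugacy classes of the `εδ`-strings with property `C`. -/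
def SphericalExactly {m n : ℕ} {V : Type*} [AddCommGroup V] [Module ℂ V]
    (R : SuperRep (gl (par m n)) V) (C : EDString m n → Prop) : Prop :=
  (∀ s : EDString m n, R.IsSphericalFor s.borel ↔ C s) ∧
    ∀ b, (gl (par m n)).IsBorel b →
      (R.IsSphericalFor b ↔ ∃ s : EDString m n, C s ∧ Conj (par m n) b s.borel)

/-- The string is of the form `⋯ε`. -/
def EDString.EndsInEps {m n : ℕ} (s : EDString m n) : Prop :=
  ∃ i, ∀ a, s.pos a ≤ s.pos (Sum.inl i)

/-- After every `ε` in the string, the number of letters `δ` is even. -/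
def EDString.EvenDeltas {m n : ℕ} (s : EDString m n) : Prop :=
  ∀ i, Even (Nat.card {j : Fin n // s.pos (Sum.inl i) < s.pos (Sum.inr j)})

/-- The string is `εδεδ⋯εδ`. -/
def EDString.IsEpsDelta {n : ℕ} (s : EDString n n) : Prop :=
  ∀ i : Fin n, (s.pos (Sum.inl i) : ℕ) = 2 * i ∧ (s.pos (Sum.inr i) : ℕ) = 2 * i + 1

/-- The string is `δεδε⋯εδ`. -/
def EDString.IsDeltaEpsDelta {n : ℕ} (s : EDString n (n + 1)) : Prop :=
  (∀ i : Fin n, (s.pos (Sum.inl i) : ℕ) = 2 * i + 1) ∧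
    ∀ j : Fin (n + 1), (s.pos (Sum.inr j) : ℕ) = 2 * j

/-- The parity shift automorphism of `𝔤𝔩(n|n)`, which maps the block matrix `[[A, B], [C, D]]` to
`[[D, C], [B, A]]`. -/
def parityAut (n : ℕ) (X : Matrix (Fin n ⊕ Fin n) (Fin n ⊕ Fin n) ℂ) :
    Matrix (Fin n ⊕ Fin n) (Fin n ⊕ Fin n) ℂ :=
  X.submatrix Sum.swap Sum.swap

theorem parityAut_parityAut (n : ℕ) (X : Matrix (Fin n ⊕ Fin n) (Fin n ⊕ Fin n) ℂ) :
    parityAut n (parityAut n X) = X := by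
  ext a b
  simp [parityAut]

theorem parityAut_mem {n : ℕ} {i : ZMod 2} {X : Matrix (Fin n ⊕ Fin n) (Fin n ⊕ Fin n) ℂ}
    (hX : X ∈ (gl (par n n)).part i) : parityAut n X ∈ (gl (par n n)).part i := by
  intro a b h
  have e : (1 : ZMod 2) + 1 = 0 := by decide
  refine hX _ _ ?_
  rcases a with a | a <;> rcases b with b | b <;> simpa [par, e, Eq.comm] using h

theorem parityAut_br {n : ℕ} {i j : ZMod 2} {X Y : Matrix (Fin n ⊕ Fin n) (Fin n ⊕ Fin n) ℂ}
    (hX : X ∈ (gl (par n n)).part i) (hY : Y ∈ (gl (par n n)).part j) :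
    parityAut n ((gl (par n n)).br X Y) =
      (gl (par n n)).br (parityAut n X) (parityAut n Y) := by
  have h1 : (gl (par n n)).br X Y = _ := matBr_apply _ hX hY
  have h2 : (gl (par n n)).br (parityAut n X) (parityAut n Y) = _ :=
    matBr_apply _ (parityAut_mem hX) (parityAut_mem hY)
  have hm : ∀ X Y, parityAut n (X * Y) = parityAut n X * parityAut n Y := fun X Y =>
    (Matrix.submatrix_mul_equiv X Y Sum.swap (Equiv.sumComm (Fin n) (Fin n)) Sum.swap).symm
  rw [h1, h2, ← hm, ← hm]
  rfl

/-- The underlying space of the Lie superalgebra `𝔭(n)`: the block matrices `[[A, B], [C, -Aᵗ]]`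
with `Bᵗ = B` and `Cᵗ = -C`. -/
def periSpace (n : ℕ) : Submodule ℂ (Matrix (Fin n ⊕ Fin n) (Fin n ⊕ Fin n) ℂ) where
  carrier := {X | ∃ A B C : Matrix (Fin n) (Fin n) ℂ, Bᵀ = B ∧ Cᵀ = -C ∧
    X = Matrix.fromBlocks A B C (-Aᵀ)}
  zero_mem' := ⟨0, 0, 0, by simp, by simp, by simp⟩
  add_mem' := by
    rintro _ _ ⟨A, B, C, hB, hC, rfl⟩ ⟨A', B', C', hB', hC', rfl⟩
    refine ⟨A + A', B + B', C + C', by simp [hB, hB'], ?_, ?_⟩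
    · rw [Matrix.transpose_add, hC, hC', neg_add]
    · rw [Matrix.fromBlocks_add, Matrix.transpose_add, neg_add]
  smul_mem' := by
    rintro c _ ⟨A, B, C, hB, hC, rfl⟩
    refine ⟨c • A, c • B, c • C, by simp [hB], by simp [hC], ?_⟩
    rw [Matrix.fromBlocks_smul, Matrix.transpose_smul, smul_neg]

theorem fromBlocks_mem_even {n : ℕ} {A B C D : Matrix (Fin n) (Fin n) ℂ} :
    Matrix.fromBlocks A B C D ∈ (gl (par n n)).part 0 ↔ B = 0 ∧ C = 0 := by
  constructor
  · intro h
    constructor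
    · ext i j; exact h (Sum.inl i) (Sum.inr j) (by simp [par])
    · ext i j; exact h (Sum.inr i) (Sum.inl j) (by simp [par])
  · rintro ⟨rfl, rfl⟩ a b h
    have e : (1 : ZMod 2) + 1 = 0 := by decide
    rcases a with a | a <;> rcases b with b | b <;> simp [par, e] at h ⊢

theorem fromBlocks_mem_odd {n : ℕ} {A B C D : Matrix (Fin n) (Fin n) ℂ} :
    Matrix.fromBlocks A B C D ∈ (gl (par n n)).part 1 ↔ A = 0 ∧ D = 0 := by
  have e : (1 : ZMod 2) + 1 = 0 := by decide
  constructor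
  · intro h
    constructor
    · ext i j; exact h (Sum.inl i) (Sum.inl j) (by simp [par])
    · ext i j; exact h (Sum.inr i) (Sum.inr j) (by simp [par, e])
  · rintro ⟨rfl, rfl⟩ a b h
    rcases a with a | a <;> rcases b with b | b <;> simp [par] at h ⊢

theorem periSpace_isGraded (n : ℕ) : (gl (par n n)).IsGraded (periSpace n) := by
  rintro _ ⟨A, B, C, hB, hC, rfl⟩
  refine Submodule.mem_sup.2 ⟨Matrix.fromBlocks A 0 0 (-Aᵀ),
    ⟨⟨A, 0, 0, by simp, by simp, rfl⟩, fromBlocks_mem_even.2 ⟨rfl, rfl⟩⟩,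
    Matrix.fromBlocks 0 B C 0,
    ⟨⟨0, B, C, hB, hC, by simp⟩, fromBlocks_mem_odd.2 ⟨rfl, rfl⟩⟩, ?_⟩
  simp [Matrix.fromBlocks_add]

/-- The Lie superalgebra `𝔭(n)`. -/
def periplectic (n : ℕ) : (gl (par n n)).Sub where
  carrier := periSpace n
  graded := periSpace_isGraded n
  br_mem := fun {x y} hx hy => by
    refine (gl (par n n)).br_mem_of_homogeneous (periSpace_isGraded n) ?_ hx hy
    rintro i j _ ⟨A, B, C, hB, hC, rfl⟩ hX _ ⟨A', B', C', hB', hC', rfl⟩ hY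
    have h : (gl (par n n)).br _ _ = _ := matBr_apply _ hX hY
    rw [h, Matrix.fromBlocks_multiply, Matrix.fromBlocks_multiply]
    rcases zmod2_cases i with rfl | rfl <;> rcases zmod2_cases j with rfl | rfl
    · obtain ⟨rfl, rfl⟩ := fromBlocks_mem_even.1 hX
      obtain ⟨rfl, rfl⟩ := fromBlocks_mem_even.1 hY
      refine ⟨A * A' - A' * A, 0, 0, by simp, by simp, ?_⟩
      simp [sgn_zero, sub_eq_add_neg, Matrix.fromBlocks_neg, Matrix.fromBlocks_add, add_comm]
    · obtain ⟨rfl, rfl⟩ := fromBlocks_mem_even.1 hX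
      obtain ⟨rfl, -⟩ := fromBlocks_mem_odd.1 hY
      refine ⟨0, A * B' + B' * Aᵀ, -(Aᵀ * C') - C' * A, ?_, ?_, ?_⟩
      · simp [hB', add_comm]
      · simp [hC']
      · simp [sgn_zero, sub_eq_add_neg, Matrix.fromBlocks_neg, Matrix.fromBlocks_add]
    · obtain ⟨rfl, -⟩ := fromBlocks_mem_odd.1 hX
      obtain ⟨rfl, rfl⟩ := fromBlocks_mem_even.1 hY
      refine ⟨0, -(A' * B) - B * A'ᵀ, C * A' + A'ᵀ * C, ?_, ?_, ?_⟩
      · simp [hB, sub_eq_add_neg, add_comm]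
      · simp [hC, add_comm]
      · simp [sgn_zero, sub_eq_add_neg, Matrix.fromBlocks_neg, Matrix.fromBlocks_add, add_comm]
    · obtain ⟨rfl, -⟩ := fromBlocks_mem_odd.1 hX
      obtain ⟨rfl, -⟩ := fromBlocks_mem_odd.1 hY
      refine ⟨B * C' + B' * C, 0, 0, by simp, by simp, ?_⟩
      simp [sgn_one, Matrix.fromBlocks_add, hB, hB', hC, hC', add_comm]

/-- The underlying space of `𝔭(n)^Π`. -/
def periPiSpace (n : ℕ) : Submodule ℂ (Matrix (Fin n ⊕ Fin n) (Fin n ⊕ Fin n) ℂ) where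
  carrier := {X | parityAut n X ∈ periSpace n}
  zero_mem' := (periSpace n).zero_mem
  add_mem' := fun hX hY => (periSpace n).add_mem hX hY
  smul_mem' := fun c _ hX => (periSpace n).smul_mem c hX

theorem parityAut_mem_periPiSpace {n : ℕ} {X : Matrix (Fin n ⊕ Fin n) (Fin n ⊕ Fin n) ℂ}
    (hX : X ∈ periSpace n) : parityAut n X ∈ periPiSpace n := by
  change parityAut n (parityAut n X) ∈ periSpace n
  rwa [parityAut_parityAut]

theorem periPiSpace_isGraded (n : ℕ) : (gl (par n n)).IsGraded (periPiSpace n) := by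
  intro X hX
  obtain ⟨y, hy, z, hz, e⟩ := Submodule.mem_sup.1 (periSpace_isGraded n hX)
  refine Submodule.mem_sup.2
    ⟨parityAut n y, ⟨parityAut_mem_periPiSpace hy.1, parityAut_mem hy.2⟩,
      parityAut n z, ⟨parityAut_mem_periPiSpace hz.1, parityAut_mem hz.2⟩, ?_⟩
  rw [← parityAut_parityAut n X, ← e]
  rfl

/-- The image `𝔭(n)^Π` of `𝔭(n)` under the parity shift automorphism of `𝔤𝔩(n|n)`. -/
def periplecticPi (n : ℕ) : (gl (par n n)).Sub where
  carrier := periPiSpace n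
  graded := periPiSpace_isGraded n
  br_mem := fun {x y} hx hy => by
    refine (gl (par n n)).br_mem_of_homogeneous (periPiSpace_isGraded n) ?_ hx hy
    intro i j X hX hXi Y hY hYj
    change parityAut n _ ∈ periSpace n
    rw [parityAut_br hXi hYj]
    exact (periplectic n).br_mem hX hY

/-- The Lie superalgebra `(𝔭(n)^Π × ℂ) ⋉ Π ℂ^{n|n}`, where `𝔭(n)^Π ⊆ 𝔤𝔩(n|n)` acts on `ℂ^{n|n}` by
the restriction of the standard representation and `ℂ` acts by the character `-1`. -/
def periSemidirect (n : ℕ) :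
    SuperLieAlg (((periplecticPi n).carrier × ℂ) × (Fin n ⊕ Fin n → ℂ)) :=
  (((std (par n n)).restrictAlg (periplecticPi n)).shift.withScalar (-1)).semidirect

end SuperSph

end

open SuperSph

noncomputable section

namespace SuperSph

open Matrix

set_option linter.unusedSectionVars false

/-! ### Generalities on graded spaces and spherical vectors -/

section General

variable {L : Type*} [AddCommGroup L] [Module ℂ L] {L' : Type*} [AddCommGroup L'] [Module ℂ L']
variable {V : Type*} [AddCommGroup V] [Module ℂ V] {V' : Type*} [AddCommGroup V'] [Module ℂ V']

/-! Everything rests on one splitting. For an even vector `v` and a graded Borel subalgebra `b`, the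
condition `(b + ℂ) v = V` separates into `b₀ v + ℂ v = V₀` and `b₁ v = V₁`. Hence `dim V₁ ≤ dim b₁`,
and for `𝔤𝔩(m|n)` the right side is `mn` for every Borel subalgebra, because exactly one of two
opposite odd roots is positive. A spherical module is therefore numerically spherical, and a
numerically spherical one satisfies `dim V₁ ≤ mn`.

Classification: this bound alone excludes everything outside the list. Monomials give lower bounds
for the parts of the super powers (`le_finrank_superPow_part`). For `d ≥ 3` these exceed `mn`; for
`ΠS²` the bound reads `(n - m)² ≤ n - m`. The remaining modules are spherical by explicit vectors.

Borel subalgebras: `𝔤₀` is the commutant of the parity involution. An argument with rank one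
operators shows that a Cartan subalgebra of `𝔤₀` acts diagonally on homogeneous vectors, so it is
conjugate to the diagonal one. Every Borel subalgebra is then conjugate to that of a string, and
sphericity needs to be tested only on strings.

Degree two: a tensor is a matrix `M` fixed by the signed transposition, and `X` acts by `XM +
(XM)^flip`. A matching of the letters of a string gives a monomial `M`, and `XM = Y` can be solved
entry by entry (`matchMat_spherical`). For necessity, upper triangularity makes the final block of
`XM` depend only on final blocks, so sphericity passes to final segments of the string. For `ΠS²`
the dimension bound on all segments forces the letters to alternate. For `S²` the bound on odd parts
is attained, so no nonzero element of `b₁` kills `v`; a segment that starts with `ε` and has an odd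
number of `δ`'s contains such an element, made from a null vector of a skew block of odd size.

Stabilizers: for `S²`, invariance of the induced form is the equation `Xv = 0`, entry by entry. For
`ΠS²`, `M` is given by its `ε`-`δ` block `B`, and sphericity forbids nonzero left and right kernels
of `B` simultaneously (`eq_zero_or_eq_zero_of_kernel`). So `B` is invertible for `n|n` and of full
rank for `n|n+1`, hence equivalent to a normal form whose stabilizer is computed directly. Parity
exchange turns `Λ²` into `S²`. -/

theorem zmod2_one_add_one : (1 : ZMod 2) + 1 = 0 := by decide

theorem zmod2_add_self (a : ZMod 2) : a + a = 0 := by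
  revert a; decide

theorem zmod2_add_eq_zero {a b : ZMod 2} : a + b = 0 ↔ a = b := by
  revert a b; decide

theorem sgn_mul_self (a : ZMod 2) : sgn a * sgn a = 1 := by
  rw [← sgn_add, zmod2_add_self, sgn_zero]

theorem sgn_ne_zero (a : ZMod 2) : sgn a ≠ 0 := fun h => by
  simpa [h] using sgn_mul_self a

theorem sgn_eq_one {a : ZMod 2} : sgn a = 1 ↔ a = 0 := by
  constructor
  · intro h
    by_contra ha
    rw [sgn, if_neg ha] at h
    norm_num at h
  · rintro rfl
    exact sgn_zero

theorem sgn_injective : Function.Injective sgn := fun a b h => by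
  rw [← zmod2_add_eq_zero, ← sgn_eq_one, sgn_add, h, sgn_mul_self]

namespace Grading

theorem exists_add (G : Grading V) (v : V) : ∃ x ∈ G.part 0, ∃ y ∈ G.part 1, x + y = v := by
  have h : v ∈ G.part 0 ⊔ G.part 1 := by
    rw [codisjoint_iff.1 G.isCompl.codisjoint]; trivial
  exact Submodule.mem_sup.1 h

theorem eq_zero_of_mem (G : Grading V) {i : ZMod 2} {v : V} (h0 : v ∈ G.part i)
    (h1 : v ∈ G.part (i + 1)) : v = 0 := by
  rcases zmod2_cases i with rfl | rfl
  · exact (Submodule.disjoint_def.1 G.isCompl.disjoint) v h0 (by simpa using h1)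
  · rw [zmod2_one_add_one] at h1
    exact (Submodule.disjoint_def.1 G.isCompl.disjoint) v h1 h0

theorem exists_add' (G : Grading V) (i : ZMod 2) (v : V) :
    ∃ x ∈ G.part i, ∃ y ∈ G.part (i + 1), x + y = v := by
  obtain ⟨x, hx, y, hy, rfl⟩ := G.exists_add v
  rcases zmod2_cases i with rfl | rfl
  · exact ⟨x, hx, y, by simpa using hy, rfl⟩
  · exact ⟨y, hy, x, by rwa [zmod2_one_add_one], add_comm _ _⟩

end Grading

namespace SuperRep

variable {A : SuperLieAlg L} {A' : SuperLieAlg L'} {R : SuperRep A V} {R' : SuperRep A' V'}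

namespace IsSphericalVector

variable {b : Submodule ℂ L} {v : V}

/-- The odd component of `x` sends `v` into the odd part, where an even right-hand side leaves
nothing, so this component can be dropped. -/
theorem exists_even (h : R.IsSphericalVector b v) (hb : A.IsGraded b) {w : V}
    (hw : w ∈ R.part 0) : ∃ x ∈ b ⊓ A.part 0, ∃ c : ℂ, R.act x v + c • v = w := by
  obtain ⟨x, hx, c, rfl⟩ := h.2 w
  obtain ⟨y, hy, z, hz, rfl⟩ := Submodule.mem_sup.1 (hb hx)
  refine ⟨y, hy, c, ?_⟩
  have hz1 : R.act z v ∈ R.part (0 + 1) := by simpa using R.act_mem hz.2 h.1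
  have hy0 : R.act y v ∈ R.part 0 := by simpa using R.act_mem hy.2 h.1
  have hz0 : R.act z v ∈ R.part 0 := by
    have := Submodule.sub_mem _ (Submodule.sub_mem _ hw hy0) (Submodule.smul_mem _ c h.1)
    rw [map_add, LinearMap.add_apply] at this
    convert this using 1
    abel
  simp [R.eq_zero_of_mem hz0 hz1]

/-- The even component of `x` and the scalar term together contribute an even vector, which vanishes
when the right-hand side is odd. So the scalars are of no help in the odd part. -/
theorem exists_odd (h : R.IsSphericalVector b v) (hb : A.IsGraded b) {w : V}
    (hw : w ∈ R.part 1) : ∃ x ∈ b ⊓ A.part 1, R.act x v = w := by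
  obtain ⟨x, hx, c, rfl⟩ := h.2 w
  obtain ⟨y, hy, z, hz, rfl⟩ := Submodule.mem_sup.1 (hb hx)
  refine ⟨z, hz, ?_⟩
  have hz1 : R.act z v ∈ R.part 1 := by simpa using R.act_mem hz.2 h.1
  have hy0 : R.act y v + c • v ∈ R.part 0 :=
    Submodule.add_mem _ (by simpa using R.act_mem hy.2 h.1) (Submodule.smul_mem _ c h.1)
  have hy1 : R.act y v + c • v ∈ R.part (0 + 1) := by
    have := Submodule.sub_mem _ hw hz1
    rw [map_add, LinearMap.add_apply] at this
    rw [zero_add]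
    convert this using 1
    abel
  have := R.eq_zero_of_mem hy0 hy1
  rw [map_add, LinearMap.add_apply, add_right_comm, this, zero_add]

/-- The orbit map `𝔟₁ → V₁` of an even vector. -/
def oddOrbit (R : SuperRep A V) (b : Submodule ℂ L) {v : V} (hv : v ∈ R.part 0) :
    (b ⊓ A.part 1 : Submodule ℂ L) →ₗ[ℂ] R.part 1 :=
  ((R.act.flip v).comp (b ⊓ A.part 1).subtype).codRestrict (R.part 1) fun x => by
    simpa using R.act_mem x.2.2 hv

theorem oddOrbit_surjective (h : R.IsSphericalVector b v) (hb : A.IsGraded b) :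
    Function.Surjective (oddOrbit R b h.1) := fun w => by
  obtain ⟨x, hx, hw⟩ := h.exists_odd hb w.2
  exact ⟨⟨x, hx⟩, Subtype.ext hw⟩

theorem finrank_odd_le [FiniteDimensional ℂ L] (h : R.IsSphericalVector b v)
    (hb : A.IsGraded b) :
    Module.finrank ℂ (R.part 1) ≤ Module.finrank ℂ (b ⊓ A.part 1 : Submodule ℂ L) :=
  LinearMap.finrank_le_finrank_of_surjective (h.oddOrbit_surjective hb)

/-- When the dimension bound is attained, the surjection `𝔟₁ → V₁` is bijective. This rigidity is
what yields the parity condition on the strings of `S²`. -/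
theorem eq_zero_of_odd [FiniteDimensional ℂ L] [FiniteDimensional ℂ V]
    (h : R.IsSphericalVector b v) (hb : A.IsGraded b)
    (hd : Module.finrank ℂ (b ⊓ A.part 1 : Submodule ℂ L) ≤ Module.finrank ℂ (R.part 1))
    {x : L} (hx : x ∈ b ⊓ A.part 1) (hxv : R.act x v = 0) : x = 0 := by
  have hinj : Function.Injective (oddOrbit R b h.1) :=
    (LinearMap.injective_iff_surjective_of_finrank_eq_finrank
      (le_antisymm hd (h.finrank_odd_le hb))).2 (h.oddOrbit_surjective hb)
  have h0 : (⟨x, hx⟩ : (b ⊓ A.part 1 : Submodule ℂ L)) = 0 := by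
    apply hinj
    rw [map_zero]
    exact Subtype.ext hxv
  exact congrArg Subtype.val h0

theorem ne_zero [Nontrivial V] (h : R.IsSphericalVector b v) : v ≠ 0 := by
  rintro rfl
  obtain ⟨w, hw⟩ := exists_ne (0 : V)
  obtain ⟨x, -, c, e⟩ := h.2 w
  exact hw (by rw [← e]; simp)

end IsSphericalVector

theorem IsSphericalFor.isNumericallySpherical [FiniteDimensional ℂ L] {b : Submodule ℂ L}
    (h : R.IsSphericalFor b) (hb : A.IsGraded b) (hB : A.IsBorel b)
    (hB0 : A.IsEvenBorel (b ⊓ A.part 0)) : R.IsNumericallySpherical := by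
  obtain ⟨hV, v, hv⟩ := h
  refine ⟨⟨fun h0 => hv.ne_zero ?_, _, hB0, v, hv.1, fun w hw => hv.exists_even hb hw⟩, b, hB,
    hv.finrank_odd_le hb⟩
  have := hv.1
  rwa [h0, Submodule.mem_bot] at this

namespace IsoAlong

variable {σ : L → L'}

theorem isSphericalFor (h : IsoAlong σ R R') {b : Submodule ℂ L} {b' : Submodule ℂ L'}
    (hb : ∀ x ∈ b, σ x ∈ b') (hs : R.IsSphericalFor b) : R'.IsSphericalFor b' := by
  obtain ⟨e, he, hσ⟩ := h
  obtain ⟨hV, v, hv, hs⟩ := hs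
  refine ⟨e.symm.toEquiv.nontrivial, e v, he 0 v hv, fun w => ?_⟩
  obtain ⟨x, hx, c, hw⟩ := hs (e.symm w)
  refine ⟨σ x, hb x hx, c, ?_⟩
  rw [← hσ, ← map_smul, ← map_add, hw, e.apply_symm_apply]

theorem shift (h : IsoAlong σ R R') : IsoAlong σ R.shift R'.shift := by
  obtain ⟨e, he, hσ⟩ := h
  exact ⟨e, fun i => he (i + 1), hσ⟩

theorem equivalent (h : IsoAlong σ R R') (hs : Function.Surjective σ) : R.Equivalent R' := by
  obtain ⟨e, he, hσ⟩ := h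
  refine ⟨e, he, fun x c => ⟨σ x, c, fun v => ?_⟩, fun x' c' => ?_⟩
  · rw [map_add, map_smul, hσ]
  · obtain ⟨x, rfl⟩ := hs x'
    exact ⟨x, c', fun v => by rw [map_add, map_smul, hσ]⟩

/-- The inverse preserves parities automatically: the component of wrong parity of a preimage is
mapped into both parts, so it is zero. -/
theorem symm (h : IsoAlong σ R R') {τ : L' → L} (hστ : ∀ y, σ (τ y) = y) :
    IsoAlong τ R' R := by
  obtain ⟨e, he, hσ⟩ := h
  refine ⟨e.symm, fun i v hv => ?_, fun x v => ?_⟩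
  · obtain ⟨y, hy, z, hz, hyz⟩ := R.exists_add' i (e.symm v)
    have hz' : e z ∈ R'.part i := by
      have := Submodule.sub_mem _ hv (he i y hy)
      rw [← e.apply_symm_apply v, ← hyz, map_add] at this
      simpa using this
    have hz0 : z = 0 := by
      simpa using R'.eq_zero_of_mem hz' (he _ z hz)
    rw [← hyz, hz0, add_zero]
    exact hy
  · apply e.injective
    rw [hσ, hστ, e.apply_symm_apply, e.apply_symm_apply]

end IsoAlong

end SuperRep

namespace SuperLieAlg

variable {L'' : Type*} [AddCommGroup L''] [Module ℂ L'']
variable {A : SuperLieAlg L} {B : SuperLieAlg L'} {C : SuperLieAlg L''}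

theorem Iso.trans (h : A.Iso B) (h' : B.Iso C) : A.Iso C := by
  obtain ⟨e, he, hb⟩ := h
  obtain ⟨e', he', hb'⟩ := h'
  exact ⟨e.trans e', fun i x hx => he' i _ (he i x hx), fun x y => by simp [hb, hb']⟩

/-- It suffices to check compatibility with the bracket on homogeneous elements. -/
theorem Iso.of_homogeneous (e : L ≃ₗ[ℂ] L') (he : ∀ i, ∀ x ∈ A.part i, e x ∈ B.part i)
    (hb : ∀ i j, ∀ x ∈ A.part i, ∀ y ∈ A.part j, e (A.br x y) = B.br (e x) (e y)) : A.Iso B := by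
  refine ⟨e, he, fun x y => ?_⟩
  obtain ⟨x0, hx0, x1, hx1, rfl⟩ := A.exists_add x
  obtain ⟨y0, hy0, y1, hy1, rfl⟩ := A.exists_add y
  simp only [map_add, LinearMap.add_apply, hb _ _ _ hx0 _ hy0, hb _ _ _ hx0 _ hy1,
    hb _ _ _ hx1 _ hy0, hb _ _ _ hx1 _ hy1]

end SuperLieAlg

end General

/-! ### Cartan subalgebras act diagonalizably -/

section Cartan

open LieModule

variable {L V : Type*} [LieRing L] [LieAlgebra ℂ L] [FiniteDimensional ℂ L]
  [AddCommGroup V] [Module ℂ V] [FiniteDimensional ℂ V] [LieRingModule L V] [LieModule ℂ L V]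

/-- A rank one operator supported on a single weight space lies in the Cartan subalgebra. -/
theorem mem_cartan_of_smulRight (H : LieSubalgebra ℂ L) [H.IsCartanSubalgebra]
    (hinj : Function.Injective (toEnd ℂ L V)) {χ : H → ℂ} {u : V}
    (hu : u ∈ genWeightSpace V χ) {f : Module.Dual ℂ V}
    (hf : ∀ χ' ≠ χ, ∀ v ∈ genWeightSpace V χ', f v = 0) {x : L}
    (hx : toEnd ℂ L V x = f.smulRight u) : x ∈ H := by
  rw [← LieAlgebra.zeroRootSubalgebra_eq_of_is_cartan ℂ L H, LieAlgebra.mem_zeroRootSubalgebra]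
  intro y
  -- Subtracting a scalar does not change commutators, so `F` is `ad y` on operators, written
  -- through `n`, which is nilpotent on the weight space of `χ`.
  set n : Module.End ℂ V := toEnd ℂ H V y - χ y • (1 : Module.End ℂ V) with hn
  set F : Module.End ℂ (Module.End ℂ V) :=
    LinearMap.mulLeft ℂ n + LinearMap.mulRight ℂ (-n) with hF
  have had : ∀ k : ℕ, toEnd ℂ L V ((toEnd ℂ H L y ^ k) x) = (F ^ k) (toEnd ℂ L V x) := by
    intro k
    induction k with
    | zero => simp
    | succ k ih =>
      rw [pow_succ', pow_succ', Module.End.mul_apply, Module.End.mul_apply, ← ih]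
      ext v
      simp [hF, hn, sub_mul, mul_sub]
  set N := Module.finrank ℂ V
  have hV : ∀ v ∈ genWeightSpace V χ, (n ^ N) v = 0 := by
    intro v hv
    have h1 : v ∈ (toEnd ℂ H V y).maxGenEigenspace (χ y) := by
      rw [Module.End.mem_maxGenEigenspace]
      exact (mem_genWeightSpace V χ v).1 hv y
    rw [Module.End.maxGenEigenspace_eq_genEigenspace_finrank, Module.End.mem_genEigenspace_nat] at h1
    exact h1
  have hstab : ∀ (χ' : H → ℂ) (k : ℕ), ∀ v ∈ genWeightSpace V χ', (n ^ k) v ∈ genWeightSpace V χ' := by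
    intro χ' k
    induction k with
    | zero => intro v hv; simpa using hv
    | succ k ih =>
      intro v hv
      rw [pow_succ', Module.End.mul_apply, hn, LinearMap.sub_apply, toEnd_apply_apply]
      exact (genWeightSpace V χ').sub_mem ((genWeightSpace V χ').lie_mem (ih v hv))
        ((genWeightSpace V χ').smul_mem _ (ih v hv))
  -- On the weight space of `χ` the power of `n` vanishes; the other weight spaces are stable under
  -- `n` and are killed by `f`.
  have hfn : ∀ v, f ((n ^ N) v) = 0 := by
    intro v
    have hv : v ∈ (⨆ χ' : H → ℂ, (genWeightSpace V χ').toSubmodule) := by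
      rw [← LieSubmodule.iSup_toSubmodule, iSup_genWeightSpace_eq_top ℂ H V]
      trivial
    refine Submodule.iSup_induction _ (motive := fun v => f ((n ^ N) v) = 0) hv ?_ (by simp) ?_
    · intro χ' v hv
      by_cases h : χ' = χ
      · subst h
        rw [hV v hv, map_zero]
      · exact hf χ' h _ (hstab χ' N v hv)
    · intro v w hv hw
      rw [map_add, map_add, hv, hw, add_zero]
  set l : Module.End ℂ (Module.End ℂ V) := LinearMap.mulLeft ℂ n with hl
  set r : Module.End ℂ (Module.End ℂ V) := LinearMap.mulRight ℂ (-n) with hr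
  have hc : Commute l r := LinearMap.commute_mulLeft_right n (-n)
  have h1 : toEnd ℂ L V x ∈ l.genEigenspace 0 N := by
    rw [Module.End.mem_genEigenspace_nat, zero_smul, sub_zero, LinearMap.mem_ker,
      hl, LinearMap.pow_mulLeft, LinearMap.mulLeft_apply, hx]
    ext v
    simp [hV u hu]
  have h2 : toEnd ℂ L V x ∈ r.genEigenspace 0 N := by
    rw [Module.End.mem_genEigenspace_nat, zero_smul, sub_zero, LinearMap.mem_ker,
      hr, LinearMap.pow_mulRight, LinearMap.mulRight_apply, hx, neg_pow]
    ext v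
    rcases neg_one_pow_eq_or (Module.End ℂ V) N with h | h <;> simp [h, hfn]
  -- Left and right multiplication commute and each kills the rank one operator after `N` steps, so
  -- `ad y` kills it after `N + N` steps.
  have h3 := Module.End.genEigenspace_inf_le_add _ _ 0 0 N N hc ⟨h1, h2⟩
  rw [add_zero, ← Nat.cast_add, Module.End.mem_genEigenspace_nat, zero_smul, sub_zero,
    LinearMap.mem_ker, ← had] at h3
  exact ⟨N + N, hinj (by rw [h3, map_zero])⟩

/-- Let `L` consist of all operators on `V` that commute with an involution `z ∈ L`. Then all
elements of a Cartan subalgebra act diagonally on its weight spaces. -/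
theorem exists_smul_of_mem_genWeightSpace (H : LieSubalgebra ℂ L) [H.IsCartanSubalgebra]
    (hinj : Function.Injective (toEnd ℂ L V)) {z : L}
    (hz2 : ∀ v : V, ⁅z, ⁅z, v⁆⁆ = v)
    (hz : ∀ f : Module.End ℂ V, (∀ v, f ⁅z, v⁆ = ⁅z, f v⁆) ↔ ∃ x, toEnd ℂ L V x = f)
    {χ : H → ℂ} {u : V} (hu : u ∈ genWeightSpace V χ) {t : L} (ht : t ∈ H) :
    ∃ c : ℂ, ⁅t, u⁆ = c • u := by
  have hzc : ∀ x : L, ⁅z, x⁆ = 0 := fun x => hinj (by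
    ext v
    have := (hz (toEnd ℂ L V x)).2 ⟨x, rfl⟩ v
    simp only [toEnd_apply_apply] at this
    simp [← this])
  have hzH : z ∈ H := by
    rw [← LieSubalgebra.IsCartanSubalgebra.self_normalizing (H := H),
      LieSubalgebra.mem_normalizer_iff]
    intro y _
    rw [hzc]
    exact H.zero_mem
  -- An involution is a root of the squarefree polynomial `X² - 1`; hence `z` acts on each
  -- generalized weight space by a scalar.
  have hss : (toEnd ℂ L V z).IsFinitelySemisimple := by
    refine Module.End.IsSemisimple.isFinitelySemisimple
      (Module.End.isSemisimple_of_squarefree_aeval_eq_zero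
      (p := Polynomial.X ^ 2 - Polynomial.C 1) ?_ ?_)
    · exact (Polynomial.separable_X_pow_sub_C (1 : ℂ) (by norm_num) one_ne_zero).squarefree
    · ext v
      simp [sq, hz2]
  have hzw : ∀ χ' : H → ℂ, ∀ v ∈ genWeightSpace V χ', ⁅z, v⁆ = χ' ⟨z, hzH⟩ • v := by
    intro χ' v hv
    have h1 : v ∈ (toEnd ℂ L V z).maxGenEigenspace (χ' ⟨z, hzH⟩) := by
      rw [Module.End.mem_maxGenEigenspace]
      exact (mem_genWeightSpace V χ' v).1 hv ⟨z, hzH⟩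
    rw [hss.maxGenEigenspace_eq_eigenspace, Module.End.mem_eigenspace_iff] at h1
    exact h1
  set W : Submodule ℂ V := ⨆ χ' : H → ℂ, ⨆ _ : χ' ≠ χ, (genWeightSpace V χ').toSubmodule with hW
  have hdisj : Disjoint (genWeightSpace V χ).toSubmodule W :=
    (LieSubmodule.iSupIndep_toSubmodule.2 (iSupIndep_genWeightSpace ℂ H V)) χ
  -- operators with image in the weight space that kill the others
  have hop : ∀ f : Module.Dual ℂ V, W ≤ LinearMap.ker f →
      ∃ x ∈ H, toEnd ℂ L V x = f.smulRight u := by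
    intro f hf
    have hf' : ∀ χ' ≠ χ, ∀ v ∈ genWeightSpace V χ', f v = 0 := fun χ' h v hv =>
      hf (Submodule.mem_iSup_of_mem χ' (Submodule.mem_iSup_of_mem h hv))
    -- The rank one operator maps the `χ`-weight space to itself and kills the others, and `z` is
    -- scalar on each of them, so the operator commutes with `z` and comes from `L`.
    obtain ⟨x, hx⟩ := (hz (f.smulRight u)).1 (by
      intro v
      have hv : v ∈ (⨆ χ' : H → ℂ, (genWeightSpace V χ').toSubmodule) := by
        rw [← LieSubmodule.iSup_toSubmodule, iSup_genWeightSpace_eq_top ℂ H V]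
        trivial
      refine Submodule.iSup_induction _
        (motive := fun v => f.smulRight u ⁅z, v⁆ = ⁅z, f.smulRight u v⁆) hv ?_ (by simp) ?_
      · intro χ' v hv
        by_cases h : χ' = χ
        · subst h
          simp [hzw _ v hv, hzw _ u hu, smul_smul, mul_comm]
        · simp [hzw _ v hv, hf' χ' h v hv]
      · intro v w hv hw
        rw [lie_add, map_add, hv, hw, map_add, lie_add])
    exact ⟨x, mem_cartan_of_smulRight H hinj hu hf' hx, hx⟩
  by_cases hmem : ⁅t, u⁆ ∈ Submodule.span ℂ {u}
  · obtain ⟨c, hc⟩ := Submodule.mem_span_singleton.1 hmem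
    exact ⟨c, hc.symm⟩
  exfalso
  -- Suppose that `u` and `w` are independent. Choose functionals vanishing on the other weight
  -- spaces, with `f u ≠ 0`, `g u = 0` and `g w ≠ 0`. The operators `x = f ⊗ u` and `y = g ⊗ u` lie
  -- in `H`, but `[x, y] = f(u) y` with `y ≠ 0`, which contradicts the nilpotency of `H`.
  set w := ⁅t, u⁆ with hw
  have hwχ : w ∈ genWeightSpace V χ := (genWeightSpace V χ).lie_mem (x := ⟨t, ht⟩) hu
  have hu0 : u ≠ 0 := by
    rintro rfl
    exact hmem (by simp [hw])
  have hw1 : w ∉ W ⊔ Submodule.span ℂ {u} := by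
    intro h
    obtain ⟨a, ha, b, hb, hab⟩ := Submodule.mem_sup.1 h
    obtain ⟨c, rfl⟩ := Submodule.mem_span_singleton.1 hb
    have ha' : a ∈ (genWeightSpace V χ).toSubmodule := by
      rw [← add_sub_cancel_right a (c • u), hab]
      exact Submodule.sub_mem _ hwχ (Submodule.smul_mem _ c hu)
    have ha0 := (Submodule.disjoint_def.1 hdisj) a ha' ha
    exact hmem (by rw [← hab, ha0, zero_add]; exact hb)
  have hu1 : u ∉ W ⊔ Submodule.span ℂ {w} := by
    intro h
    obtain ⟨a, ha, b, hb, hab⟩ := Submodule.mem_sup.1 h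
    obtain ⟨c, rfl⟩ := Submodule.mem_span_singleton.1 hb
    have ha' : a ∈ (genWeightSpace V χ).toSubmodule := by
      rw [← add_sub_cancel_right a (c • w), hab]
      exact Submodule.sub_mem _ hu (Submodule.smul_mem _ c hwχ)
    have ha0 := (Submodule.disjoint_def.1 hdisj) a ha' ha
    rw [ha0, zero_add] at hab
    by_cases hc : c = 0
    · exact hu0 (by rw [← hab, hc, zero_smul])
    · refine hmem (Submodule.mem_span_singleton.2 ⟨c⁻¹, ?_⟩)
      rw [← hab, smul_smul, inv_mul_cancel₀ hc, one_smul]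
  obtain ⟨f, hfu, hf⟩ := Submodule.exists_le_ker_of_notMem hu1
  obtain ⟨g, hgw, hg⟩ := Submodule.exists_le_ker_of_notMem hw1
  have hgu : g u = 0 := hg (Submodule.mem_sup_right (Submodule.mem_span_singleton_self u))
  obtain ⟨x, hxH, hx⟩ := hop f (le_sup_left.trans hf)
  obtain ⟨y, hyH, hy⟩ := hop g (le_sup_left.trans hg)
  have hxy : ⁅x, y⁆ = f u • y := hinj (by
    ext v
    have hx' : ∀ v, ⁅x, v⁆ = f v • u := fun v => by rw [← toEnd_apply_apply ℂ L V, hx]; rfl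
    have hy' : ∀ v, ⁅y, v⁆ = g v • u := fun v => by rw [← toEnd_apply_apply ℂ L V, hy]; rfl
    simp [hx', hy', hgu, smul_smul, mul_comm])
  rw [← LieAlgebra.zeroRootSubalgebra_eq_of_is_cartan ℂ L H,
    LieAlgebra.mem_zeroRootSubalgebra] at hyH
  obtain ⟨k, hk⟩ := hyH ⟨x, hxH⟩
  have hpow : ∀ k : ℕ, (toEnd ℂ H L ⟨x, hxH⟩ ^ k) y = f u ^ k • y := by
    intro k
    induction k with
    | zero => simp
    | succ k ih =>
      rw [pow_succ', Module.End.mul_apply, ih, map_smul, toEnd_apply_apply]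
      change f u ^ k • ⁅x, y⁆ = _
      rw [hxy, smul_smul, pow_succ]
  rw [hpow] at hk
  have hy0 : y = 0 := (smul_eq_zero.1 hk).resolve_left (pow_ne_zero _ hfu)
  apply hgw
  have h : (toEnd ℂ L V y) w = g w • u := by rw [hy]; rfl
  rw [hy0, map_zero, LinearMap.zero_apply] at h
  exact (smul_eq_zero.1 h.symm).resolve_right hu0

end Cartan

/-! ### Even matrices -/

section Even

variable {ι : Type*} [Fintype ι] [DecidableEq ι] (p : ι → ZMod 2)

theorem mem_gl_part {i : ZMod 2} {X : Matrix ι ι ℂ} :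
    X ∈ (gl p).part i ↔ ∀ a b, p a + p b ≠ i → X a b = 0 := Iff.rfl

/-- The diagonal matrix of the signs of the basis vectors. -/
def signMat : Matrix ι ι ℂ := Matrix.diagonal fun a => sgn (p a)

theorem signMat_mul_self : signMat p * signMat p = 1 := by
  simp [signMat, sgn_mul_self]

/-- Describing `𝔤₀` as the commutant of an involution makes it closed under inverses and is the form
in which `exists_smul_of_mem_genWeightSpace` applies. -/
theorem mem_even_iff_commute {X : Matrix ι ι ℂ} :
    X ∈ (gl p).part 0 ↔ X * signMat p = signMat p * X := by
  constructor
  · intro h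
    ext a b
    rw [signMat, mul_diagonal, diagonal_mul]
    by_cases hab : p a = p b
    · rw [hab, mul_comm]
    · rw [h a b fun h => hab (zmod2_add_eq_zero.1 h)]; simp
  · intro h a b hab
    have := congrFun (congrFun h a) b
    rw [signMat, mul_diagonal, diagonal_mul] at this
    by_contra h0
    have e : sgn (p b) = sgn (p a) := mul_left_cancel₀ h0 (by rw [this, mul_comm])
    exact hab (zmod2_add_eq_zero.2 (sgn_injective e).symm)

theorem signMat_mem : signMat p ∈ (gl p).part 0 := (mem_even_iff_commute p).2 rfl

theorem even_mul_mem {X Y : Matrix ι ι ℂ} {i : ZMod 2} (hX : X ∈ (gl p).part 0)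
    (hY : Y ∈ (gl p).part i) : X * Y ∈ (gl p).part i := by
  have h : X * Y ∈ (gl p).part (0 + i) := matGrading_mul_mem p hX hY
  rwa [zero_add] at h

theorem mul_even_mem {X Y : Matrix ι ι ℂ} {i : ZMod 2} (hX : X ∈ (gl p).part i)
    (hY : Y ∈ (gl p).part 0) : X * Y ∈ (gl p).part i := by
  have h : X * Y ∈ (gl p).part (i + 0) := matGrading_mul_mem p hX hY
  rwa [add_zero] at h

theorem even_inv_mem {g : (Matrix ι ι ℂ)ˣ} (hg : (g : Matrix ι ι ℂ) ∈ (gl p).part 0) :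
    (↑g⁻¹ : Matrix ι ι ℂ) ∈ (gl p).part 0 := by
  rw [mem_even_iff_commute] at hg ⊢
  exact (Commute.units_inv_left (show Commute (g : Matrix ι ι ℂ) (signMat p) from hg)).eq

theorem diagonal_mem_even (d : ι → ℂ) : Matrix.diagonal d ∈ (gl p).part 0 := by
  rw [mem_even_iff_commute, signMat, diagonal_mul_diagonal, diagonal_mul_diagonal]
  simp only [mul_comm]

theorem single_mem {a b : ι} {i : ZMod 2} (h : p a + p b = i) (c : ℂ) :
    Matrix.single a b c ∈ (gl p).part i := by
  intro a' b' h'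
  rw [Matrix.single_apply, if_neg]
  rintro ⟨rfl, rfl⟩
  exact h' h

theorem br_of_even {X Y : Matrix ι ι ℂ} (hX : X ∈ (gl p).part 0) :
    (gl p).br X Y = X * Y - Y * X := by
  have h : (gl p).br X Y = X * Y - Y * X +
    (2 : ℂ) • ((matGrading p).oddProj Y * (matGrading p).oddProj X) := rfl
  rw [h, (matGrading p).oddProj_of_even hX]
  simp

theorem conj_mem {g : (Matrix ι ι ℂ)ˣ} (hg : (g : Matrix ι ι ℂ) ∈ (gl p).part 0)
    {X : Matrix ι ι ℂ} {i : ZMod 2} (hX : X ∈ (gl p).part i) :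
    (g : Matrix ι ι ℂ) * X * (↑g⁻¹ : Matrix ι ι ℂ) ∈ (gl p).part i :=
  mul_even_mem p (even_mul_mem p hg hX) (even_inv_mem p hg)

theorem conj_conj_inv (g : (Matrix ι ι ℂ)ˣ) (X : Matrix ι ι ℂ) :
    (g : Matrix ι ι ℂ) * ((↑g⁻¹ : Matrix ι ι ℂ) * X * g) * (↑g⁻¹ : Matrix ι ι ℂ) = X := by
  rw [mul_assoc (↑g⁻¹ : Matrix ι ι ℂ), Units.mul_inv_cancel_left, Units.mul_inv_cancel_right]

theorem conj_inv_conj (g : (Matrix ι ι ℂ)ˣ) (X : Matrix ι ι ℂ) :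
    (↑g⁻¹ : Matrix ι ι ℂ) * ((g : Matrix ι ι ℂ) * X * (↑g⁻¹ : Matrix ι ι ℂ)) * g = X := by
  rw [mul_assoc (g : Matrix ι ι ℂ), Units.inv_mul_cancel_left, Units.inv_mul_cancel_right]

theorem conj_mul (g : (Matrix ι ι ℂ)ˣ) (X Y : Matrix ι ι ℂ) :
    (g : Matrix ι ι ℂ) * (X * Y) * (↑g⁻¹ : Matrix ι ι ℂ) =
      (g * X * (↑g⁻¹ : Matrix ι ι ℂ)) * (g * Y * (↑g⁻¹ : Matrix ι ι ℂ)) := by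
  simp only [mul_assoc, Units.inv_mul_cancel_left]

/-- The `i`-th part of a function space, as a function space. -/
def ofParityEquiv {κ : Type*} (q : κ → ZMod 2) (i : ZMod 2) :
    (Grading.ofParity q).part i ≃ₗ[ℂ] ({a // q a = i} → ℂ) where
  toFun t a := t.1 a
  map_add' _ _ := rfl
  map_smul' _ _ := rfl
  invFun c := ⟨fun a => if h : q a = i then c ⟨a, h⟩ else 0, fun a h => dif_neg h⟩
  left_inv t := by
    ext a
    by_cases h : q a = i
    · simp [h]
    · simp [h, t.2 a h]
  right_inv c := by
    funext a
    simp [a.2]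

theorem finrank_ofParity {κ : Type*} [Fintype κ] (q : κ → ZMod 2) (i : ZMod 2) :
    Module.finrank ℂ ((Grading.ofParity q).part i) = Fintype.card {a // q a = i} := by
  rw [(ofParityEquiv q i).finrank_eq, Module.finrank_fintype_fun_eq_card]

end Even

/-! ### Cartan subalgebras of the even part of `𝔤𝔩` -/

section CartanGl

variable {ι : Type*} [Fintype ι] [DecidableEq ι] (p : ι → ZMod 2)

theorem coe_lie (x y : (gl p).part 0) : ((⁅x, y⁆ : (gl p).part 0) : Matrix ι ι ℂ) =
    (x : Matrix ι ι ℂ) * y - (y : Matrix ι ι ℂ) * x :=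
  br_of_even p x.2

instance evenLieRingModule : LieRingModule ((gl p).part 0) (ι → ℂ) where
  bracket x v := (x : Matrix ι ι ℂ) *ᵥ v
  add_lie x y v := by simp [Matrix.add_mulVec]
  lie_add x v w := by simp [Matrix.mulVec_add]
  leibniz_lie x y v := by
    simp only [coe_lie, Matrix.sub_mulVec, Matrix.mulVec_mulVec]
    abel

theorem even_lie_apply (x : (gl p).part 0) (v : ι → ℂ) : ⁅x, v⁆ = (x : Matrix ι ι ℂ) *ᵥ v := rfl

instance evenLieModule : LieModule ℂ ((gl p).part 0) (ι → ℂ) where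
  smul_lie c x v := by simp [even_lie_apply, Matrix.smul_mulVec]
  lie_smul c x v := by simp [even_lie_apply, Matrix.mulVec_smul]

variable {p}

/-- A Cartan subalgebra is self-normalizing, so it contains its centralizer. -/
theorem mem_cartan_of_commute {H : LieSubalgebra ℂ ((gl p).part 0)} [H.IsCartanSubalgebra]
    {x : (gl p).part 0} (h : ∀ y ∈ H, (x : Matrix ι ι ℂ) * y = (y : Matrix ι ι ℂ) * x) :
    x ∈ H := by
  rw [← LieSubalgebra.IsCartanSubalgebra.self_normalizing (H := H),
    LieSubalgebra.mem_normalizer_iff]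
  intro y hy
  have : ⁅x, y⁆ = 0 := Subtype.ext (by rw [coe_lie, h y hy, sub_self]; rfl)
  rw [this]
  exact H.zero_mem

theorem exists_smul_of_mem_weight (H : LieSubalgebra ℂ ((gl p).part 0)) [H.IsCartanSubalgebra]
    {χ : H → ℂ} {u : ι → ℂ} (hu : u ∈ LieModule.genWeightSpace (ι → ℂ) χ)
    {t : (gl p).part 0} (ht : t ∈ H) : ∃ c : ℂ, (t : Matrix ι ι ℂ) *ᵥ u = c • u := by
  refine exists_smul_of_mem_genWeightSpace H ?_ (z := ⟨signMat p, signMat_mem p⟩) ?_ ?_ hu ht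
  · intro x y hxy
    apply Subtype.ext
    apply Matrix.ext_of_mulVec_single
    intro a
    exact LinearMap.congr_fun hxy (Pi.single a 1)
  · intro v
    simp [even_lie_apply, signMat_mul_self]
  · intro f
    constructor
    · intro hf
      refine ⟨⟨LinearMap.toMatrix' f, ?_⟩, ?_⟩
      · rw [mem_even_iff_commute]
        have h1 : f ∘ₗ Matrix.toLin' (signMat p) = Matrix.toLin' (signMat p) ∘ₗ f :=
          LinearMap.ext hf
        have h2 := congrArg LinearMap.toMatrix' h1
        rwa [LinearMap.toMatrix'_comp, LinearMap.toMatrix'_comp, LinearMap.toMatrix'_toLin'] at h2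
      · exact LinearMap.ext fun v => LinearMap.toMatrix'_mulVec f v
    · rintro ⟨x, rfl⟩ v
      have h := (mem_even_iff_commute p).1 x.2
      simp [even_lie_apply, h]

/-- The parity involution is central in `𝔤₀`, so it belongs to `H` and is scalar on every weight
vector. Weight vectors are therefore homogeneous, and those of parity `i` span the part of parity
`i`. -/
theorem part_le_span_eigenvectors (H : LieSubalgebra ℂ ((gl p).part 0)) [H.IsCartanSubalgebra]
    (i : ZMod 2) : (std p).part i ≤ Submodule.span ℂ {v | v ∈ (std p).part i ∧
      ∀ t ∈ H, ∃ c : ℂ, (t : Matrix ι ι ℂ) *ᵥ v = c • v} := by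
  set S : ZMod 2 → Set (ι → ℂ) := fun i => {v | v ∈ (std p).part i ∧
      ∀ t ∈ H, ∃ c : ℂ, (t : Matrix ι ι ℂ) *ᵥ v = c • v} with hS
  have hle : ∀ i, Submodule.span ℂ (S i) ≤ (std p).part i := fun i =>
    Submodule.span_le.2 fun v hv => hv.1
  have hz : (⟨signMat p, signMat_mem p⟩ : (gl p).part 0) ∈ H :=
    mem_cartan_of_commute fun y _ => ((mem_even_iff_commute p).1 y.2).symm
  have htop : ∀ v : ι → ℂ, v ∈ Submodule.span ℂ (S i) ⊔ Submodule.span ℂ (S (i + 1)) := by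
    intro v
    have hv : v ∈ (⨆ χ' : H → ℂ, (LieModule.genWeightSpace (ι → ℂ) χ').toSubmodule) := by
      rw [← LieSubmodule.iSup_toSubmodule, LieModule.iSup_genWeightSpace_eq_top ℂ H (ι → ℂ)]
      trivial
    refine Submodule.iSup_induction _ (motive := fun v => v ∈ _) hv ?_ (Submodule.zero_mem _)
      fun v w hv hw => Submodule.add_mem _ hv hw
    intro χ v hv
    obtain ⟨c, hc⟩ := exists_smul_of_mem_weight H hv hz
    have hca : ∀ a, sgn (p a) * v a = c * v a := fun a => by
      simpa [signMat, Matrix.mulVec_diagonal] using congrFun hc a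
    by_cases hc1 : c = sgn i
    · refine Submodule.mem_sup_left (Submodule.subset_span
        ⟨fun a ha => ?_, fun t ht => exists_smul_of_mem_weight H hv ht⟩)
      by_contra h0
      exact ha (sgn_injective (by rw [← hc1]; exact mul_right_cancel₀ h0 (hca a)))
    · refine Submodule.mem_sup_right (Submodule.subset_span
        ⟨fun a ha => ?_, fun t ht => exists_smul_of_mem_weight H hv ht⟩)
      by_contra h0
      have h1 := mul_right_cancel₀ h0 (hca a)
      have h2 : p a = i := by
        revert ha
        generalize p a = x
        clear * -
        revert x i
        decide
      exact hc1 (by rw [← h1, h2])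
  intro v hv
  obtain ⟨x, hx, y, hy, rfl⟩ := Submodule.mem_sup.1 (htop v)
  have hy' : y ∈ (std p).part i := by
    have := Submodule.sub_mem _ hv (hle i hx)
    rwa [add_sub_cancel_left] at this
  rw [(std p).eq_zero_of_mem hy' (hle _ hy), add_zero]
  exact hx

/-- Every Cartan subalgebra of the even part of `𝔤𝔩` is conjugate to the diagonal one. -/
theorem exists_conj_cartan (H : LieSubalgebra ℂ ((gl p).part 0)) [H.IsCartanSubalgebra] :
    ∃ g : (Matrix ι ι ℂ)ˣ, (g : Matrix ι ι ℂ) ∈ (gl p).part 0 ∧ ∀ t : (gl p).part 0,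
      t ∈ H ↔ ∀ a b, a ≠ b →
        ((g : Matrix ι ι ℂ) * (t : Matrix ι ι ℂ) * (↑g⁻¹ : Matrix ι ι ℂ)) a b = 0 := by
  -- For each parity, a basis of common eigenvectors is extracted and indexed by the standard basis
  -- vectors of that parity; the counts agree because both are the dimension of the part.
  have hB : ∀ i, ∃ w : {a // p a = i} → (ι → ℂ), (∀ a, w a ∈ (std p).part i ∧
      ∀ t ∈ H, ∃ c : ℂ, (t : Matrix ι ι ℂ) *ᵥ w a = c • w a) ∧
      (std p).part i ≤ Submodule.span ℂ (Set.range w) := by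
    intro i
    obtain ⟨B, hBs, hsp, hli⟩ := exists_linearIndependent ℂ {v | v ∈ (std p).part i ∧
      ∀ t ∈ H, ∃ c : ℂ, (t : Matrix ι ι ℂ) *ᵥ v = c • v}
    have hspan : Submodule.span ℂ B = (std p).part i := by
      rw [hsp]
      exact le_antisymm (Submodule.span_le.2 fun v hv => hv.1) (part_le_span_eigenvectors H i)
    have hfin : Finite B := hli.finite
    have := Fintype.ofFinite B
    have hcard : Fintype.card {a // p a = i} = Fintype.card B := by
      rw [← finrank_ofParity p i, ← Set.toFinset_card, ← finrank_span_set_eq_card hli, hspan]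
      rfl
    refine ⟨fun a => (Fintype.equivOfCardEq hcard a : ι → ℂ),
      fun a => hBs (Fintype.equivOfCardEq hcard a).2, ?_⟩
    have : Set.range (fun a => (Fintype.equivOfCardEq hcard a : ι → ℂ)) = B := by
      rw [← Function.comp_def, EquivLike.range_comp, Subtype.range_coe]
    rw [this, hspan]
  choose w hw hspan using hB
  set u : ι → (ι → ℂ) := fun a => w (p a) ⟨a, rfl⟩ with hu
  have huspan : ⊤ ≤ Submodule.span ℂ (Set.range u) := by
    have h : ∀ i, (std p).part i ≤ Submodule.span ℂ (Set.range u) := fun i => by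
      refine (hspan i).trans (Submodule.span_mono ?_)
      rintro _ ⟨⟨a, rfl⟩, rfl⟩
      exact ⟨a, rfl⟩
    intro v _
    obtain ⟨x, hx, y, hy, rfl⟩ := (std p).exists_add v
    exact Submodule.add_mem _ (h 0 hx) (h 1 hy)
  have hli : LinearIndependent ℂ u :=
    linearIndependent_of_top_le_span_of_card_eq_finrank huspan (by simp)
  have hunit : IsUnit (Matrix.of u)ᵀ := by
    rw [← Matrix.linearIndependent_cols_iff_isUnit]
    exact hli
  obtain ⟨G, hG⟩ := hunit
  -- Column `b` of `G` is an eigenvector of parity `p b`, so the change of basis is even.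
  have hGe : (G : Matrix ι ι ℂ) ∈ (gl p).part 0 := by
    intro a b hab
    rw [hG]
    exact (hw (p b) ⟨b, rfl⟩).1 a fun h => hab (zmod2_add_eq_zero.2 h)
  have hdiag : ∀ t ∈ H, ∀ a b, a ≠ b →
      ((↑G⁻¹ : Matrix ι ι ℂ) * (t : Matrix ι ι ℂ) * (G : Matrix ι ι ℂ)) a b = 0 := by
    intro t ht
    have hc : ∀ b, ∃ c : ℂ, (t : Matrix ι ι ℂ) *ᵥ u b = c • u b := fun b =>
      (hw (p b) ⟨b, rfl⟩).2 t ht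
    choose c hc using hc
    have : (t : Matrix ι ι ℂ) * G = G * Matrix.diagonal c := by
      ext a b
      rw [Matrix.mul_diagonal, hG]
      have := congrFun (hc b) a
      rw [Pi.smul_apply, smul_eq_mul, mul_comm] at this
      exact this
    intro a b hab
    rw [mul_assoc, this, Units.inv_mul_cancel_left, Matrix.diagonal_apply_ne _ hab]
  refine ⟨G⁻¹, even_inv_mem p hGe, fun t => ⟨fun ht => by rw [inv_inv]; exact hdiag t ht, ?_⟩⟩
  rw [inv_inv]
  intro ht
  -- Conversely, a matrix that is diagonal in the eigenbasis commutes with all of `H`.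
  refine mem_cartan_of_commute fun y hy => ?_
  have hd : ∀ Z : Matrix ι ι ℂ, (∀ a b, a ≠ b → Z a b = 0) →
      Z = Matrix.diagonal fun a => Z a a := by
    intro Z hZ
    ext a b
    by_cases h : a = b
    · subst h; simp
    · rw [hZ a b h, Matrix.diagonal_apply_ne _ h]
  have h1 := hd _ ht
  have h2 := hd _ (hdiag y hy)
  have h3 : ((↑G⁻¹ : Matrix ι ι ℂ) * (t : Matrix ι ι ℂ) * (G : Matrix ι ι ℂ)) *
      ((↑G⁻¹ : Matrix ι ι ℂ) * (y : Matrix ι ι ℂ) * (G : Matrix ι ι ℂ)) =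
      ((↑G⁻¹ : Matrix ι ι ℂ) * (y : Matrix ι ι ℂ) * (G : Matrix ι ι ℂ)) *
      ((↑G⁻¹ : Matrix ι ι ℂ) * (t : Matrix ι ι ℂ) * (G : Matrix ι ι ℂ)) := by
    rw [h1, h2, diagonal_mul_diagonal, diagonal_mul_diagonal]
    simp only [mul_comm]
  have h4 := conj_mul G⁻¹ (t : Matrix ι ι ℂ) y
  have h5 := conj_mul G⁻¹ (y : Matrix ι ι ℂ) t
  rw [inv_inv] at h4 h5
  rw [← h4, ← h5] at h3
  have h6 := congrArg (fun Z => (G : Matrix ι ι ℂ) * Z * (↑G⁻¹ : Matrix ι ι ℂ)) h3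
  simpa only [conj_conj_inv] using h6

end CartanGl

/-! ### Borel subalgebras of `𝔤𝔩` -/

section BorelGl

variable {ι : Type*} [Fintype ι] [DecidableEq ι] {p : ι → ZMod 2}

/-- Conjugation by an invertible matrix. -/
def conjMat (g : (Matrix ι ι ℂ)ˣ) : Matrix ι ι ℂ ≃ₗ[ℂ] Matrix ι ι ℂ where
  toFun X := (g : Matrix ι ι ℂ) * X * (↑g⁻¹ : Matrix ι ι ℂ)
  map_add' X Y := by rw [mul_add, add_mul]
  map_smul' c X := by rw [Matrix.mul_smul, Matrix.smul_mul]; rfl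
  invFun X := (↑g⁻¹ : Matrix ι ι ℂ) * X * g
  left_inv X := conj_inv_conj g X
  right_inv X := conj_conj_inv g X

theorem conjMat_mul (g : (Matrix ι ι ℂ)ˣ) (X Y : Matrix ι ι ℂ) :
    conjMat g (X * Y) = conjMat g X * conjMat g Y := conj_mul g X Y

theorem conjMat_mem {g : (Matrix ι ι ℂ)ˣ} (hg : (g : Matrix ι ι ℂ) ∈ (gl p).part 0)
    {X : Matrix ι ι ℂ} {i : ZMod 2} : conjMat g X ∈ (gl p).part i ↔ X ∈ (gl p).part i := by
  refine ⟨fun h => ?_, conj_mem p hg⟩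
  have := conj_mem p (g := g⁻¹) (even_inv_mem p hg) h
  rw [inv_inv] at this
  rwa [← conj_inv_conj g X]

theorem conjMat_symm_mem {g : (Matrix ι ι ℂ)ˣ} (hg : (g : Matrix ι ι ℂ) ∈ (gl p).part 0)
    {X : Matrix ι ι ℂ} {i : ZMod 2} (hX : X ∈ (gl p).part i) :
    (conjMat g).symm X ∈ (gl p).part i := by
  rwa [← conjMat_mem hg, LinearEquiv.apply_symm_apply]

/-! ### Root spaces for a conjugate of the diagonal Cartan subalgebra -/

section Weights

variable {H : LieSubalgebra ℂ ((gl p).part 0)} {g : (Matrix ι ι ℂ)ˣ}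
  {S : Submodule ℂ (Matrix ι ι ℂ)}

/-- After conjugation by `g` the elements of `H` are diagonal, and bracketing with a diagonal matrix
multiplies the entry `(a, b)` by the difference of the diagonal entries at `a` and `b`. -/
theorem mem_weightSpace_iff
    (hH : ∀ t : (gl p).part 0, t ∈ H ↔ ∀ a b, a ≠ b → conjMat g (t : Matrix ι ι ℂ) a b = 0)
    {α : Module.Dual ℂ H} {X : Matrix ι ι ℂ} :
    X ∈ (gl p).weightSpace S H α ↔ X ∈ S ∧ ∀ t : H, ∀ a b,
      (conjMat g ((t : (gl p).part 0) : Matrix ι ι ℂ) a a -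
        conjMat g ((t : (gl p).part 0) : Matrix ι ι ℂ) b b) * conjMat g X a b =
          α t * conjMat g X a b := by
  refine and_congr_right fun _ => forall_congr' fun t => ?_
  set T : Matrix ι ι ℂ := ((t : (gl p).part 0) : Matrix ι ι ℂ) with hT
  have hd : conjMat g T = Matrix.diagonal fun a => conjMat g T a a := by
    ext a b
    by_cases h : a = b
    · subst h; simp
    · rw [(hH t).1 t.2 a b h, Matrix.diagonal_apply_ne _ h]
  rw [br_of_even p (t : (gl p).part 0).2, ← (conjMat g).injective.eq_iff, map_sub, conjMat_mul,
    conjMat_mul, map_smul, ← Matrix.ext_iff]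
  refine forall₂_congr fun a b => ?_
  rw [Matrix.sub_apply, ← hT, hd, Matrix.diagonal_mul, Matrix.mul_diagonal, Matrix.smul_apply,
    smul_eq_mul, Matrix.diagonal_apply_eq, Matrix.diagonal_apply_eq, sub_mul,
    mul_comm (conjMat g X a b)]

/-- The difference of two diagonal entries after conjugation by `g`, as a functional. -/
def rootFunctional (H : LieSubalgebra ℂ ((gl p).part 0)) (g : (Matrix ι ι ℂ)ˣ) (a b : ι) :
    Module.Dual ℂ H where
  toFun t := conjMat g ((t : (gl p).part 0) : Matrix ι ι ℂ) a a -
    conjMat g ((t : (gl p).part 0) : Matrix ι ι ℂ) b b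
  map_add' s t := by simp; ring
  map_smul' c t := by simp; ring

/-- These elements show that the functional of `(a, b)` with `a ≠ b` is nonzero, and that elements
of weight zero are diagonal after conjugation. -/
theorem exists_mem_cartan_apply (hg : (g : Matrix ι ι ℂ) ∈ (gl p).part 0)
    (hH : ∀ t : (gl p).part 0, t ∈ H ↔ ∀ a b, a ≠ b → conjMat g (t : Matrix ι ι ℂ) a b = 0)
    (a : ι) : ∃ t : H, conjMat g ((t : (gl p).part 0) : Matrix ι ι ℂ) =
      Matrix.diagonal (Pi.single a 1) := by
  refine ⟨⟨⟨(conjMat g).symm (Matrix.diagonal (Pi.single a 1)),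
    conjMat_symm_mem hg (diagonal_mem_even p _)⟩, ?_⟩, ?_⟩
  · rw [hH]
    intro b c hbc
    rw [LinearEquiv.apply_symm_apply, Matrix.diagonal_apply_ne _ hbc]
  · exact LinearEquiv.apply_symm_apply _ _

theorem symm_single_mem_weightSpace
    (hH : ∀ t : (gl p).part 0, t ∈ H ↔ ∀ a b, a ≠ b → conjMat g (t : Matrix ι ι ℂ) a b = 0)
    {a b : ι} {c : ℂ} (hS : (conjMat g).symm (Matrix.single a b c) ∈ S) :
    (conjMat g).symm (Matrix.single a b c) ∈
      (gl p).weightSpace S H (rootFunctional H g a b) := by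
  rw [mem_weightSpace_iff hH]
  refine ⟨hS, fun t a' b' => ?_⟩
  rw [LinearEquiv.apply_symm_apply, Matrix.single_apply]
  split_ifs with h
  · obtain ⟨rfl, rfl⟩ := h
    rfl
  · simp

theorem isRoot_rootFunctional (hg : (g : Matrix ι ι ℂ) ∈ (gl p).part 0)
    (hH : ∀ t : (gl p).part 0, t ∈ H ↔ ∀ a b, a ≠ b → conjMat g (t : Matrix ι ι ℂ) a b = 0)
    {a b : ι} (hab : a ≠ b) {c : ℂ} (hc : c ≠ 0)
    (hS : (conjMat g).symm (Matrix.single a b c) ∈ S) :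
    (gl p).IsRoot S H (rootFunctional H g a b) := by
  constructor
  · intro h0
    obtain ⟨t, ht⟩ := exists_mem_cartan_apply hg hH a
    have := LinearMap.congr_fun h0 t
    simp [rootFunctional, ht, hab] at this
  · refine (Submodule.ne_bot_iff _).2 ⟨_, symm_single_mem_weightSpace hH hS, fun h => hc ?_⟩
    rw [LinearEquiv.symm_apply_eq, map_zero] at h
    simpa using congrFun (congrFun h a) b

/-- Conjugated matrix units are weight vectors, and `hS` allows an element of `S` to be cut into
them. So membership in the Borel subalgebra is a condition on the individual entries, whether or not
different pairs give different functionals. -/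
theorem mem_borel_iff (hg : (g : Matrix ι ι ℂ) ∈ (gl p).part 0)
    (hH : ∀ t : (gl p).part 0, t ∈ H ↔ ∀ a b, a ≠ b → conjMat g (t : Matrix ι ι ℂ) a b = 0)
    (hS : ∀ X ∈ S, ∀ a b, (conjMat g).symm (Matrix.single a b (conjMat g X a b)) ∈ S)
    (h : H) {X : Matrix ι ι ℂ} :
    X ∈ (gl p).weightSpace S H 0 ⊔ (⨆ α : Module.Dual ℂ H,
        ⨆ _ : (gl p).IsRoot S H α ∧ 0 < (α h).re, (gl p).weightSpace S H α) ↔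
      X ∈ S ∧ ∀ a b, a ≠ b → conjMat g X a b ≠ 0 → 0 < (rootFunctional H g a b h).re := by
  constructor
  · set T : Submodule ℂ (Matrix ι ι ℂ) :=
      { carrier := {X | X ∈ S ∧ ∀ a b, a ≠ b → ¬ 0 < (rootFunctional H g a b h).re →
          conjMat g X a b = 0}
        zero_mem' := ⟨S.zero_mem, by simp⟩
        add_mem' := fun {X Y} hX hY => ⟨S.add_mem hX.1 hY.1, fun a b hab h => by
          rw [map_add, Matrix.add_apply, hX.2 a b hab h, hY.2 a b hab h, add_zero]⟩
        smul_mem' := fun c X hX => ⟨S.smul_mem c hX.1, fun a b hab h => by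
          rw [map_smul, Matrix.smul_apply, hX.2 a b hab h, smul_zero]⟩ } with hT
    intro hX
    have hle : (gl p).weightSpace S H 0 ⊔ (⨆ α : Module.Dual ℂ H,
        ⨆ _ : (gl p).IsRoot S H α ∧ 0 < (α h).re, (gl p).weightSpace S H α) ≤ T := by
      refine sup_le ?_ (iSup_le fun α => iSup_le fun hα => ?_)
      · intro Y hY
        rw [mem_weightSpace_iff hH] at hY
        refine ⟨hY.1, fun a b hab _ => ?_⟩
        obtain ⟨t, ht⟩ := exists_mem_cartan_apply hg hH a
        simpa [ht, hab, Pi.single_apply, hab.symm] using hY.2 t a b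
      · intro Y hY
        rw [mem_weightSpace_iff hH] at hY
        refine ⟨hY.1, fun a b hab hn => ?_⟩
        by_contra h0
        have e : rootFunctional H g a b h = α h := mul_right_cancel₀ h0 (hY.2 h a b)
        exact hn (by rw [e]; exact hα.2)
    have := hle hX
    refine ⟨this.1, fun a b hab => ?_⟩
    have h2 := this.2 a b hab
    tauto
  · rintro ⟨hXS, hX⟩
    have hsum : X = ∑ a, ∑ b, (conjMat g).symm (Matrix.single a b (conjMat g X a b)) := by
      simp only [← map_sum]
      rw [← Matrix.matrix_eq_sum_single, LinearEquiv.symm_apply_apply]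
    rw [hsum]
    refine Submodule.sum_mem _ fun a _ => Submodule.sum_mem _ fun b _ => ?_
    by_cases hab : a = b
    · subst hab
      refine Submodule.mem_sup_left ?_
      have := symm_single_mem_weightSpace hH (hS X hXS a a)
      convert this using 1
      congr 1
      ext t
      simp [rootFunctional]
    · by_cases h0 : conjMat g X a b = 0
      · rw [h0, Matrix.single_zero, map_zero]
        exact Submodule.zero_mem _
      · refine Submodule.mem_sup_right (Submodule.mem_iSup_of_mem (rootFunctional H g a b)
          (Submodule.mem_iSup_of_mem ⟨?_, hX a b hab h0⟩ ?_))
        · exact isRoot_rootFunctional hg hH hab h0 (hS X hXS a b)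
        · exact symm_single_mem_weightSpace hH (hS X hXS a b)

end Weights

/-- The matrices that are upper triangular for the order in which `a` has position `pos a`. -/
def flagBorel {α : Type*} [LinearOrder α] (pos : ι → α) : Submodule ℂ (Matrix ι ι ℂ) where
  carrier := {X | ∀ a b, pos b < pos a → X a b = 0}
  zero_mem' := fun _ _ _ => rfl
  add_mem' := fun {X Y} hX hY a b h => by simp [hX a b h, hY a b h]
  smul_mem' := fun c X hX a b h => by simp [hX a b h]

theorem mem_flagBorel {α : Type*} [LinearOrder α] {pos : ι → α} {X : Matrix ι ι ℂ} :
    X ∈ flagBorel pos ↔ ∀ a b, pos b < pos a → X a b = 0 := Iff.rfl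

theorem flagBorel_isGraded {α : Type*} [LinearOrder α] (pos : ι → α) :
    (gl p).IsGraded (flagBorel pos) := by
  intro X hX
  refine Submodule.mem_sup.2 ⟨Matrix.of fun a b => if p a + p b = 0 then X a b else 0, ⟨?_, ?_⟩,
    Matrix.of fun a b => if p a + p b = 0 then 0 else X a b, ⟨?_, ?_⟩, ?_⟩
  · intro a b h
    simp [hX a b h]
  · intro a b h
    simp [h]
  · intro a b h
    simp [hX a b h]
  · intro a b h
    rcases zmod2_cases (p a + p b) with h' | h'
    · simp [h']
    · exact absurd h' h
  · ext a b
    by_cases h : p a + p b = 0 <;> simp [h]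

/-- Every Borel subalgebra is conjugate to the upper triangular matrices for some order. -/
theorem exists_conj_flagBorel {b : Submodule ℂ (Matrix ι ι ℂ)} (hb : (gl p).IsBorel b) :
    ∃ r : ι → ℝ, Function.Injective r ∧ Conj p b (flagBorel r) := by
  -- The diagonal entries of the conjugated coweight have real, nonzero differences, so their real
  -- parts are distinct and order the basis.
  obtain ⟨H, hC, h, hroot, rfl⟩ := hb
  obtain ⟨g, hg, hH⟩ := exists_conj_cartan H
  have hreal : ∀ a b, a ≠ b → (rootFunctional H g a b h).im = 0 ∧
      rootFunctional H g a b h ≠ 0 := fun a b hab =>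
    hroot _ (isRoot_rootFunctional hg hH hab one_ne_zero trivial)
  set τ : ι → ℂ := fun a => conjMat g ((h : (gl p).part 0) : Matrix ι ι ℂ) a a with hτ
  have hre : ∀ a b, (rootFunctional H g a b h).re = (τ a).re - (τ b).re := fun a b => by
    simp [rootFunctional, hτ]
  have hinj : Function.Injective fun a => -(τ a).re := by
    intro a b hab
    by_contra hne
    refine (hreal a b hne).2 (Complex.ext ?_ (hreal a b hne).1)
    rw [hre, Complex.zero_re, sub_eq_zero]
    exact neg_injective hab
  -- The sign puts larger eigenvalues further to the left, since the root of `E_ab` is positive when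
  -- the eigenvalue at `a` is the larger one.
  refine ⟨fun a => -(τ a).re, hinj, g, hg, fun X => ?_⟩
  rw [mem_borel_iff (S := ⊤) hg hH (fun _ _ _ _ => trivial) h]
  simp only [Submodule.mem_top, true_and, hre]
  change (∀ a b, a ≠ b → conjMat g X a b ≠ 0 → _) ↔ ∀ a b, _ → conjMat g X a b = 0
  constructor
  · intro hX a b hab
    by_contra h0
    have hne : a ≠ b := by
      rintro rfl
      exact lt_irrefl _ hab
    have := hX a b hne h0
    linarith
  · intro hX a b hab h0
    by_contra hn
    refine h0 (hX a b (lt_of_le_of_ne (by linarith) fun e => hab (hinj ?_)))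
    simp only [e]

/-- The diagonal Cartan subalgebra with coweight `diag(-pos a)` works, as the root of `E_ab` takes
the value `pos b - pos a`. The subspace `S` is kept general so that the Borel subalgebras of `𝔤` and
of `𝔤₀` are obtained together. -/
theorem flagBorel_isBorelIn {pos : ι → ℕ} (hpos : Function.Injective pos)
    {S : Submodule ℂ (Matrix ι ι ℂ)}
    (hS : ∀ X ∈ S, ∀ a b, Matrix.single a b (X a b) ∈ S) :
    (gl p).IsBorelIn S (flagBorel pos ⊓ S) := by
  have h1 : ∀ X : Matrix ι ι ℂ, conjMat 1 X = X := fun X => by simp [conjMat]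
  have h2 : ∀ X : Matrix ι ι ℂ, (conjMat 1).symm X = X := fun X => by
    rw [LinearEquiv.symm_apply_eq, h1]
  set H : LieSubalgebra ℂ ((gl p).part 0) :=
    { carrier := {t | ∀ a b, a ≠ b → (t : Matrix ι ι ℂ) a b = 0}
      zero_mem' := fun _ _ _ => rfl
      add_mem' := fun {s t} hs ht a b h => by simp [hs a b h, ht a b h]
      smul_mem' := fun c t ht a b h => by simp [ht a b h]
      lie_mem' := fun {s t} hs ht a b h => by
        rw [coe_lie, Matrix.sub_apply, Matrix.mul_apply, Matrix.mul_apply,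
          Finset.sum_eq_zero, Finset.sum_eq_zero, sub_zero]
        · intro c _
          by_cases hc : a = c
          · subst hc; rw [hs a b h, mul_zero]
          · rw [ht a c hc, zero_mul]
        · intro c _
          by_cases hc : a = c
          · subst hc; rw [ht a b h, mul_zero]
          · rw [hs a c hc, zero_mul] } with hHdef
  have hmem : ∀ t : (gl p).part 0, t ∈ H ↔ ∀ a b, a ≠ b → (t : Matrix ι ι ℂ) a b = 0 :=
    fun t => Iff.rfl
  have hH : ∀ t : (gl p).part 0, t ∈ H ↔ ∀ a b, a ≠ b → conjMat 1 (t : Matrix ι ι ℂ) a b = 0 :=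
    fun t => by rw [h1]; exact hmem t
  have hg : ((1 : (Matrix ι ι ℂ)ˣ) : Matrix ι ι ℂ) ∈ (gl p).part 0 := by
    rw [Units.val_one, ← Matrix.diagonal_one]
    exact diagonal_mem_even p _
  have hdiag : ∀ t ∈ H, (t : Matrix ι ι ℂ) = Matrix.diagonal fun a => (t : Matrix ι ι ℂ) a a := by
    intro t ht
    ext a b
    by_cases h : a = b
    · subst h; simp
    · rw [(hmem t).1 ht a b h, Matrix.diagonal_apply_ne _ h]
  have hC : H.IsCartanSubalgebra := by
    have habel : IsLieAbelian H := ⟨fun s t => by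
      apply Subtype.ext
      apply Subtype.ext
      change ((⁅(s : (gl p).part 0), (t : (gl p).part 0)⁆ : (gl p).part 0) : Matrix ι ι ℂ) = 0
      rw [coe_lie, hdiag _ s.2, hdiag _ t.2, diagonal_mul_diagonal, diagonal_mul_diagonal,
        sub_eq_zero]
      simp only [mul_comm]⟩
    refine ⟨inferInstance, le_antisymm (fun x hx => ?_) (LieSubalgebra.le_normalizer _)⟩
    rw [LieSubalgebra.mem_normalizer_iff] at hx
    intro a b hab
    -- The entry `(a, b)` of `[x, E_bb]` is `x_ab` for `a ≠ b`, so an element normalizing the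
    -- diagonal matrices is diagonal.
    have := hx ⟨Matrix.diagonal (Pi.single b 1), diagonal_mem_even p _⟩
      (fun c d hcd => Matrix.diagonal_apply_ne _ hcd) a b hab
    rw [coe_lie, Matrix.sub_apply, Matrix.mul_diagonal, Matrix.diagonal_mul] at this
    simpa [hab] using this
  set h : H := ⟨⟨Matrix.diagonal fun a => -(pos a : ℂ), diagonal_mem_even p _⟩,
    fun a b hab => Matrix.diagonal_apply_ne _ hab⟩ with hh
  have hval : ∀ a b, rootFunctional H 1 a b h = ((pos b : ℂ) - pos a) := fun a b => by
    simp [rootFunctional, h1, hh]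
    ring
  refine ⟨H, hC, h, fun α hα => ?_, ?_⟩
  · obtain ⟨X, hX, hX0⟩ := (Submodule.ne_bot_iff _).1 hα.2
    rw [mem_weightSpace_iff hH] at hX
    have : ∃ a b, X a b ≠ 0 := by
      by_contra hn
      push Not at hn
      exact hX0 (Matrix.ext hn)
    obtain ⟨a, b, hab⟩ := this
    have hα' : ∀ t, rootFunctional H 1 a b t = α t := fun t => by
      have := hX.2 t a b
      rw [h1 X] at this
      exact mul_right_cancel₀ hab this
    have hne : a ≠ b := by
      rintro rfl
      refine hα.1 (LinearMap.ext fun t => ?_)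
      rw [← hα']
      simp [rootFunctional]
    rw [← hα', hval]
    refine ⟨by simp, fun h0 => hne (hpos ?_)⟩
    exact_mod_cast (sub_eq_zero.1 h0).symm
  · ext X
    rw [mem_borel_iff hg hH (fun X hX a b => by rw [h2, h1]; exact hS X hX a b) h,
      Submodule.mem_inf, and_comm, mem_flagBorel]
    refine and_congr_right fun _ => ?_
    simp only [hval, h1, Complex.sub_re, Complex.natCast_re, sub_pos, Nat.cast_lt]
    constructor
    · intro hX a b hab h0
      by_contra hn
      exact h0 (hX a b (lt_of_le_of_ne (not_lt.1 hn) fun e => hab (hpos e.symm)))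
    · intro hX a b hab
      by_contra h0
      have hne : a ≠ b := by
        rintro rfl
        exact lt_irrefl _ hab
      exact lt_asymm hab (hX a b hne h0)

theorem flagBorel_isBorel {pos : ι → ℕ} (hpos : Function.Injective pos) :
    (gl p).IsBorel (flagBorel pos) := by
  have := flagBorel_isBorelIn (p := p) hpos (S := ⊤) fun _ _ _ _ => trivial
  rwa [inf_top_eq] at this

theorem flagBorel_isEvenBorel {pos : ι → ℕ} (hpos : Function.Injective pos) :
    (gl p).IsEvenBorel (flagBorel pos ⊓ (gl p).part 0) := by
  refine flagBorel_isBorelIn (p := p) hpos fun X hX a b => ?_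
  by_cases h : p a + p b = 0
  · exact single_mem p h _
  · rw [hX a b h, Matrix.single_zero]
    exact Submodule.zero_mem _

theorem SuperRep.IsSphericalFor.isSpherical {V : Type*} [AddCommGroup V] [Module ℂ V]
    {R : SuperRep (gl p) V} {pos : ι → ℕ} (hpos : Function.Injective pos)
    (h : R.IsSphericalFor (flagBorel pos)) : R.IsSpherical :=
  ⟨_, flagBorel_isBorel hpos, h⟩

theorem SuperRep.IsSphericalFor.isNumericallySpherical_of_flag {V : Type*} [AddCommGroup V]
    [Module ℂ V] {R : SuperRep (gl p) V} {pos : ι → ℕ} (hpos : Function.Injective pos)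
    (h : R.IsSphericalFor (flagBorel pos)) : R.IsNumericallySpherical :=
  h.isNumericallySpherical (flagBorel_isGraded pos) (flagBorel_isBorel hpos)
    (flagBorel_isEvenBorel hpos)

/-- The dimension of the odd part of a Borel subalgebra. -/
theorem finrank_flagBorel_odd {α : Type*} [LinearOrder α] {pos : ι → α}
    (hpos : Function.Injective pos) :
    Module.finrank ℂ (flagBorel pos ⊓ (gl p).part 1 : Submodule ℂ (Matrix ι ι ℂ)) =
      Fintype.card {a // p a = 0} * Fintype.card {a // p a = 1} := by
  have hne : ∀ (a : {a // p a = 0}) (b : {a // p a = 1}), (a : ι) ≠ b := fun a b h => by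
    have := a.2
    rw [h, b.2] at this
    exact one_ne_zero this
  have e : (flagBorel pos ⊓ (gl p).part 1 : Submodule ℂ (Matrix ι ι ℂ)) ≃ₗ[ℂ]
      ({a // p a = 0} × {a // p a = 1} → ℂ) := by
    -- Of the two entries `(a, b)` and `(b, a)` with `a` even and `b` odd, exactly one is allowed in
    -- the Borel subalgebra; their sum reads it off without a case distinction.
    refine LinearEquiv.ofBijective
      { toFun := fun X ab => X.1 ab.1 ab.2 + X.1 ab.2 ab.1
        map_add' := fun X Y => by ext; simp; ring
        map_smul' := fun c X => by ext; simp; ring } ⟨?_, ?_⟩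
    · rw [← LinearMap.ker_eq_bot, LinearMap.ker_eq_bot']
      intro X hX
      apply Subtype.ext
      have key : ∀ a b, p a = 0 → p b = 1 → X.1 a b = 0 ∧ X.1 b a = 0 := by
        intro a b ha hb
        have h : X.1 a b + X.1 b a = 0 := congrFun hX (⟨a, ha⟩, ⟨b, hb⟩)
        rcases lt_trichotomy (pos a) (pos b) with hlt | heq | hlt
        · have h0 := X.2.1 b a hlt
          rw [h0, add_zero] at h
          exact ⟨h, h0⟩
        · exact absurd (hpos heq) (hne ⟨a, ha⟩ ⟨b, hb⟩)
        · have h0 := X.2.1 a b hlt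
          rw [h0, zero_add] at h
          exact ⟨h0, h⟩
      ext a b
      by_cases hab : p a + p b = 1
      · rcases zmod2_cases (p a) with ha | ha
        · exact (key a b ha (by simpa [ha] using hab)).1
        · rcases zmod2_cases (p b) with hb | hb
          · exact (key b a hb ha).2
          · rw [ha, hb] at hab
            exact absurd hab (by decide)
      · exact X.2.2 a b hab
    · intro c
      refine ⟨⟨Matrix.of fun a b => if pos b < pos a then 0 else
        if h : p a = 0 ∧ p b = 1 then c (⟨a, h.1⟩, ⟨b, h.2⟩) else
        if h : p b = 0 ∧ p a = 1 then c (⟨b, h.1⟩, ⟨a, h.2⟩) else 0, ?_, ?_⟩, ?_⟩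
      · intro a b hab
        simp [hab]
      · intro a b hab
        rcases zmod2_cases (p a) with ha | ha <;> rcases zmod2_cases (p b) with hb | hb <;>
          simp [ha, hb] at hab ⊢
      · funext ⟨⟨a, ha⟩, ⟨b, hb⟩⟩
        rcases lt_or_gt_of_ne fun h => hne ⟨a, ha⟩ ⟨b, hb⟩ (hpos h) with h | h
        · simp [ha, hb, h, h.not_gt]
        · simp [ha, hb, h, h.not_gt]
  rw [e.finrank_eq, Module.finrank_fintype_fun_eq_card, Fintype.card_prod]

theorem Conj.finrank_odd_eq {b b' : Submodule ℂ (Matrix ι ι ℂ)} (h : Conj p b b') :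
    Module.finrank ℂ (b ⊓ (gl p).part 1 : Submodule ℂ (Matrix ι ι ℂ)) =
      Module.finrank ℂ (b' ⊓ (gl p).part 1 : Submodule ℂ (Matrix ι ι ℂ)) := by
  obtain ⟨g, hg, h⟩ := h
  have e : (b ⊓ (gl p).part 1 : Submodule ℂ (Matrix ι ι ℂ)) =
      (b' ⊓ (gl p).part 1).comap ((conjMat g : Matrix ι ι ℂ ≃ₗ[ℂ] Matrix ι ι ℂ) :
        Matrix ι ι ℂ →ₗ[ℂ] Matrix ι ι ℂ) := by
    ext X
    exact and_congr (h X) (conjMat_mem hg).symm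
  rw [e]
  exact (LinearEquiv.ofSubmodule' (conjMat g) (b' ⊓ (gl p).part 1)).finrank_eq

/-- The dimension of `𝔟₁` is the same for all Borel subalgebras, so the maximum in numerical
sphericity is simply this product. -/
theorem finrank_borel_odd {b : Submodule ℂ (Matrix ι ι ℂ)} (hb : (gl p).IsBorel b) :
    Module.finrank ℂ (b ⊓ (gl p).part 1 : Submodule ℂ (Matrix ι ι ℂ)) =
      Fintype.card {a // p a = 0} * Fintype.card {a // p a = 1} := by
  obtain ⟨r, hr, hc⟩ := exists_conj_flagBorel hb
  rw [hc.finrank_odd_eq, finrank_flagBorel_odd hr]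

end BorelGl

/-! ### Conjugation and strings -/

section Conjugation

variable {ι : Type*} [Fintype ι] [DecidableEq ι] {p : ι → ZMod 2}

theorem Conj.trans {S T U : Submodule ℂ (Matrix ι ι ℂ)} (h : Conj p S T) (h' : Conj p T U) :
    Conj p S U := by
  obtain ⟨g, hg, h⟩ := h
  obtain ⟨g', hg', h'⟩ := h'
  refine ⟨g' * g, by rw [Units.val_mul]; exact even_mul_mem p hg' hg, fun X => ?_⟩
  rw [h, h', _root_.mul_inv_rev, Units.val_mul, Units.val_mul]
  simp only [mul_assoc]

theorem Conj.symm {S T : Submodule ℂ (Matrix ι ι ℂ)} (h : Conj p S T) : Conj p T S := by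
  obtain ⟨g, hg, h⟩ := h
  refine ⟨g⁻¹, even_inv_mem p hg, fun X => ?_⟩
  rw [h, inv_inv, conj_conj_inv]

theorem conjMat_br {g : (Matrix ι ι ℂ)ˣ} (hg : (g : Matrix ι ι ℂ) ∈ (gl p).part 0)
    {i j : ZMod 2} {X Y : Matrix ι ι ℂ} (hX : X ∈ (gl p).part i) (hY : Y ∈ (gl p).part j) :
    conjMat g ((gl p).br X Y) = (gl p).br (conjMat g X) (conjMat g Y) := by
  have h1 : (gl p).br X Y = _ := matBr_apply p hX hY
  have h2 : (gl p).br (conjMat g X) (conjMat g Y) = _ :=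
    matBr_apply p ((conjMat_mem hg).2 hX) ((conjMat_mem hg).2 hY)
  rw [h1, h2, map_sub, map_smul, conjMat_mul, conjMat_mul]

theorem Conj.iso {S T : (gl p).Sub} (h : Conj p S.carrier T.carrier) : S.toAlg.Iso T.toAlg := by
  obtain ⟨g, hg, h⟩ := h
  have e : S.carrier = T.carrier.comap ((conjMat g : Matrix ι ι ℂ ≃ₗ[ℂ] Matrix ι ι ℂ) :
      Matrix ι ι ℂ →ₗ[ℂ] Matrix ι ι ℂ) := by
    ext X
    exact h X
  refine SuperLieAlg.Iso.of_homogeneous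
    ((LinearEquiv.ofEq _ _ e).trans (LinearEquiv.ofSubmodule' (conjMat g) T.carrier)) ?_ ?_
  · intro i x hx
    exact (conjMat_mem hg).2 hx
  · intro i j x hx y hy
    exact Subtype.ext (conjMat_br hg hx hy)

variable {V : Type*} [AddCommGroup V] [Module ℂ V] {R : SuperRep (gl p) V}

/-- The hypothesis `hR` says that the action integrates to the group of even invertible matrices;
group elements carry spherical vectors to spherical vectors for the conjugate subalgebra. -/
theorem Conj.isSphericalFor_iff (hR : ∀ g : (Matrix ι ι ℂ)ˣ, (g : Matrix ι ι ℂ) ∈ (gl p).part 0 →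
    SuperRep.IsoAlong (conjMat g) R R) {b b' : Submodule ℂ (Matrix ι ι ℂ)} (h : Conj p b b') :
    R.IsSphericalFor b ↔ R.IsSphericalFor b' := by
  have key : ∀ {b b' : Submodule ℂ (Matrix ι ι ℂ)}, Conj p b b' → R.IsSphericalFor b →
      R.IsSphericalFor b' := by
    rintro b b' ⟨g, hg, h⟩
    exact (hR g hg).isSphericalFor fun X hX => (h X).1 hX
  exact ⟨key h, key h.symm⟩

/-- Stabilizers of vectors in the same orbit are conjugate. -/
theorem conj_stabilizer {g : (Matrix ι ι ℂ)ˣ} (hg : (g : Matrix ι ι ℂ) ∈ (gl p).part 0)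
    (e : V ≃ₗ[ℂ] V) (he : ∀ X v, e (R.act X v) = R.act (conjMat g X) (e v)) {v w : V}
    (hv : v ∈ R.part 0) (hw : w ∈ R.part 0) (hvw : e v = w) :
    Conj p (R.stabilizer v hv).carrier (R.stabilizer w hw).carrier := by
  refine ⟨g, hg, fun X => ?_⟩
  change R.act X v = 0 ↔ R.act (conjMat g X) w = 0
  rw [← hvw, ← he, LinearEquiv.map_eq_zero_iff]

end Conjugation

/-! ### Strings represent all conjugacy classes of Borel subalgebras -/

section Strings

variable {m n : ℕ}

theorem EDString.pos_nat_injective (s : EDString m n) :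
    Function.Injective fun a => (s.pos a : ℕ) :=
  Fin.val_injective.comp s.pos.injective

theorem EDString.borel_eq_flagBorel (s : EDString m n) : s.borel = flagBorel s.pos := rfl

theorem par_perm (σ : Equiv.Perm (Fin m)) (τ : Equiv.Perm (Fin n)) (a : Fin m ⊕ Fin n) :
    par m n (Equiv.sumCongr σ τ a) = par m n a := by
  rcases a with a | a <;> rfl

theorem exists_conj_borel {b : Submodule ℂ (Matrix (Fin m ⊕ Fin n) (Fin m ⊕ Fin n) ℂ)}
    (hb : (gl (par m n)).IsBorel b) : ∃ s : EDString m n, Conj (par m n) b s.borel := by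
  obtain ⟨r, hr, hc⟩ := exists_conj_flagBorel hb
  -- A string lists the `ε`'s and the `δ`'s in increasing order of index. Sorting the two blocks
  -- separately achieves this, and such a permutation has an even permutation matrix. Positions are
  -- the ranks of the sorted values.
  set e : Equiv.Perm (Fin m ⊕ Fin n) := Equiv.sumCongr (Tuple.sort fun i => r (Sum.inl i))
    (Tuple.sort fun j => r (Sum.inr j)) with he
  have hre : Function.Injective (r ∘ e) := hr.comp e.injective
  have hcard : (Finset.univ.image (r ∘ e)).card = m + n := by
    rw [Finset.card_image_of_injective _ hre]
    simp
  set E := Finset.orderIsoOfFin (Finset.univ.image (r ∘ e)) hcard with hE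
  have hmem : ∀ a, r (e a) ∈ Finset.univ.image (r ∘ e) := fun a =>
    Finset.mem_image_of_mem (r ∘ e) (Finset.mem_univ a)
  set f : Fin m ⊕ Fin n → Fin (m + n) := fun a => E.symm ⟨r (e a), hmem a⟩ with hf
  have hlt : ∀ a b, f a < f b ↔ r (e a) < r (e b) := fun a b => by
    rw [hf, OrderIso.lt_iff_lt, Subtype.mk_lt_mk]
  have hinj : Function.Injective f := fun a b hab => hre (by
    have := E.symm.injective hab
    simpa using this)
  have hbij : Function.Bijective f :=
    (Fintype.bijective_iff_injective_and_card f).2 ⟨hinj, by simp⟩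
  refine ⟨⟨Equiv.ofBijective f hbij, ?_, ?_⟩, hc.trans ?_⟩
  · have h1 : Monotone fun i => r (e (Sum.inl i)) := Tuple.monotone_sort fun i => r (Sum.inl i)
    have h2 : StrictMono fun i => r (e (Sum.inl i)) :=
      h1.strictMono_of_injective (hre.comp Sum.inl_injective)
    exact fun i j hij => (hlt _ _).2 (h2 hij)
  · have h1 : Monotone fun i => r (e (Sum.inr i)) := Tuple.monotone_sort fun i => r (Sum.inr i)
    have h2 : StrictMono fun i => r (e (Sum.inr i)) :=
      h1.strictMono_of_injective (hre.comp Sum.inr_injective)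
    exact fun i j hij => (hlt _ _).2 (h2 hij)
  · set P : (Matrix (Fin m ⊕ Fin n) (Fin m ⊕ Fin n) ℂ)ˣ :=
      ⟨e.toPEquiv.toMatrix, e.symm.toPEquiv.toMatrix,
        by rw [← PEquiv.toMatrix_trans, ← Equiv.toPEquiv_trans]; simp,
        by rw [← PEquiv.toMatrix_trans, ← Equiv.toPEquiv_trans]; simp⟩ with hP
    refine ⟨P, ?_, fun X => ?_⟩
    · intro a b hab
      simp only [hP, PEquiv.toMatrix_apply]
      rw [if_neg]
      intro h
      have h1 : e a = b := by simpa using h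
      exact hab (zmod2_add_eq_zero.2 (by rw [← h1]; exact (par_perm _ _ a).symm))
    · have h1 : (P : Matrix (Fin m ⊕ Fin n) (Fin m ⊕ Fin n) ℂ) * X *
          (↑P⁻¹ : Matrix (Fin m ⊕ Fin n) (Fin m ⊕ Fin n) ℂ) = X.submatrix e e := by
        change e.toPEquiv.toMatrix * X * e.symm.toPEquiv.toMatrix = _
        rw [PEquiv.toMatrix_toPEquiv_mul, PEquiv.mul_toMatrix_toPEquiv]
        rfl
      rw [h1]
      constructor
      · intro hX a b hab
        exact hX _ _ ((hlt b a).1 hab)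
      · intro hX a b hab
        have := hX (e.symm a) (e.symm b) ((hlt _ _).2 (by simpa using hab))
        simpa using this

theorem sphericalExactly_of_strings {V : Type*} [AddCommGroup V] [Module ℂ V]
    {R : SuperRep (gl (par m n)) V} {C : EDString m n → Prop}
    (hR : ∀ g : (Matrix (Fin m ⊕ Fin n) (Fin m ⊕ Fin n) ℂ)ˣ,
      (g : Matrix (Fin m ⊕ Fin n) (Fin m ⊕ Fin n) ℂ) ∈ (gl (par m n)).part 0 →
      SuperRep.IsoAlong (conjMat g) R R)
    (h : ∀ s : EDString m n, R.IsSphericalFor s.borel ↔ C s) : SphericalExactly R C := by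
  refine ⟨h, fun b hb => ⟨fun hs => ?_, ?_⟩⟩
  · obtain ⟨s, hc⟩ := exists_conj_borel hb
    exact ⟨s, (h s).1 ((Conj.isSphericalFor_iff hR hc).1 hs), hc⟩
  · rintro ⟨s, hs, hc⟩
    exact (Conj.isSphericalFor_iff hR hc).2 ((h s).2 hs)

end Strings

/-! ### The standard representation -/

section Standard

variable {ι : Type*} [Fintype ι] [DecidableEq ι] {p : ι → ZMod 2}

theorem std_act (X : Matrix ι ι ℂ) (v : ι → ℂ) : (std p).act X v = X *ᵥ v := rfl

/-- An invertible matrix as an automorphism of the standard representation. -/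
def mulVecEquiv (g : (Matrix ι ι ℂ)ˣ) : (ι → ℂ) ≃ₗ[ℂ] (ι → ℂ) where
  toFun v := (g : Matrix ι ι ℂ) *ᵥ v
  map_add' := Matrix.mulVec_add _
  map_smul' c v := Matrix.mulVec_smul _ c v
  invFun v := (↑g⁻¹ : Matrix ι ι ℂ) *ᵥ v
  left_inv v := by simp
  right_inv v := by simp

theorem mulVecEquiv_act (g : (Matrix ι ι ℂ)ˣ) (X : Matrix ι ι ℂ) (v : ι → ℂ) :
    mulVecEquiv g ((std p).act X v) = (std p).act (conjMat g X) (mulVecEquiv g v) := by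
  simp only [mulVecEquiv, conjMat, std_act, LinearEquiv.coe_mk, LinearMap.coe_mk, AddHom.coe_mk,
    Matrix.mulVec_mulVec, mul_assoc, Units.inv_mul, mul_one]

theorem std_isoAlong_conj (g : (Matrix ι ι ℂ)ˣ) (hg : (g : Matrix ι ι ℂ) ∈ (gl p).part 0) :
    SuperRep.IsoAlong (conjMat g) (std p) (std p) := by
  refine ⟨mulVecEquiv g, fun i v hv => ?_, mulVecEquiv_act g⟩
  have := (std p).act_mem hg hv
  rwa [zero_add] at this

/-- A basis vector in the last position is spherical. -/
theorem std_exists_spherical {α : Type*} [LinearOrder α] {pos : ι → α} {z : ι}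
    (hz : ∀ a, pos a ≤ pos z) (w : ι → ℂ) :
    ∃ x ∈ flagBorel pos, ∃ c : ℂ, (std p).act x (Pi.single z 1) + c • Pi.single z (1 : ℂ) = w := by
  refine ⟨Matrix.of fun a b => if b = z then w a else 0, ?_, 0, ?_⟩
  · intro a b hab
    rw [Matrix.of_apply, if_neg]
    rintro rfl
    exact absurd (hz a) (not_le.2 hab)
  · ext a
    simp [std_act]

theorem std_part_single {z : ι} {i : ZMod 2} (h : p z = i) :
    (Pi.single z 1 : ι → ℂ) ∈ (std p).part i := by
  intro a ha
  rw [Pi.single_apply, if_neg]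
  rintro rfl
  exact ha h

/-- For upper triangular `X`, the last coordinate of `Xv` is `X_zz v_z`. If `z` is odd, an even `v`
has `v_z = 0` and the last basis vector is never reached. -/
theorem std_isSphericalFor_iff {α : Type*} [LinearOrder α] {pos : ι → α}
    (hpos : Function.Injective pos) {z : ι} (hz : ∀ a, pos a ≤ pos z) :
    (std p).IsSphericalFor (flagBorel pos) ↔ p z = 0 := by
  have : Nonempty ι := ⟨z⟩
  constructor
  · rintro ⟨-, v, hv, hs⟩
    by_contra hp
    obtain ⟨x, hx, c, hw⟩ := hs (Pi.single z 1)
    have h0 : v z = 0 := hv z hp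
    have := congrFun hw z
    rw [Pi.add_apply, Pi.smul_apply, h0, smul_zero, add_zero, Pi.single_eq_same, std_act,
      Matrix.mulVec, dotProduct, Finset.sum_eq_zero] at this
    · exact zero_ne_one this
    · intro b _
      by_cases hb : b = z
      · rw [hb, h0, mul_zero]
      · rw [hx z b (lt_of_le_of_ne (hz b) fun h => hb (hpos h)), zero_mul]
  · intro hp
    exact ⟨inferInstance, _, std_part_single hp, std_exists_spherical hz⟩

theorem std_shift_isSphericalFor {α : Type*} [LinearOrder α] {pos : ι → α} {z : ι}
    (hz : ∀ a, pos a ≤ pos z) (hp : p z = 1) :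
    (std p).shift.IsSphericalFor (flagBorel pos) := by
  have : Nonempty ι := ⟨z⟩
  refine ⟨inferInstance, Pi.single z 1, ?_, std_exists_spherical (p := p) hz⟩
  change _ ∈ (std p).part (0 + 1)
  rw [zero_add]
  exact std_part_single hp

theorem card_par_zero (m n : ℕ) : Fintype.card {a // par m n a = 0} = m := by
  rw [Fintype.card_of_subtype (Finset.univ.map ⟨Sum.inl, Sum.inl_injective⟩)]
  · simp
  · rintro (a | a) <;> simp [par]

theorem card_par_one (m n : ℕ) : Fintype.card {a // par m n a = 1} = n := by
  rw [Fintype.card_of_subtype (Finset.univ.map ⟨Sum.inr, Sum.inr_injective⟩)]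
  · simp
  · rintro (a | a) <;> simp [par]

theorem std_sdim (m n : ℕ) : (std (par m n)).sdim = (m, n) :=
  Prod.ext ((finrank_ofParity (par m n) 0).trans (card_par_zero m n))
    ((finrank_ofParity (par m n) 1).trans (card_par_one m n))

theorem std_sphericalExactly (m n : ℕ) (hm : 1 ≤ m) :
    SphericalExactly (std (par m n)) EDString.EndsInEps := by
  refine sphericalExactly_of_strings std_isoAlong_conj fun s => ?_
  have hz : ∀ a, s.pos a ≤ s.pos (s.pos.symm ⟨m + n - 1, by omega⟩) := fun a => by
    rw [Equiv.apply_symm_apply, Fin.le_def]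
    have := (s.pos a).2
    simp only
    omega
  rw [s.borel_eq_flagBorel, std_isSphericalFor_iff s.pos.injective hz]
  set z := s.pos.symm ⟨m + n - 1, by omega⟩
  constructor
  · intro h
    rcases hzz : z with i | j
    · exact ⟨i, fun a => by rw [← hzz]; exact hz a⟩
    · rw [hzz] at h
      exact absurd h one_ne_zero
  · rintro ⟨i, hi⟩
    have : z = Sum.inl i := s.pos.injective (le_antisymm (hi z) (hz _))
    rw [this]
    rfl

/-- A block diagonal invertible matrix. -/
def blockUnit {κ κ' : Type*} [Fintype κ] [DecidableEq κ] [Fintype κ'] [DecidableEq κ']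
    (A : (Matrix κ κ ℂ)ˣ) (D : (Matrix κ' κ' ℂ)ˣ) : (Matrix (κ ⊕ κ') (κ ⊕ κ') ℂ)ˣ where
  val := Matrix.fromBlocks A 0 0 D
  inv := Matrix.fromBlocks (↑A⁻¹ : Matrix κ κ ℂ) 0 0 (↑D⁻¹ : Matrix κ' κ' ℂ)
  val_inv := by simp [Matrix.fromBlocks_multiply]
  inv_val := by simp [Matrix.fromBlocks_multiply]

theorem blockUnit_mem {m n : ℕ} (A : (Matrix (Fin m) (Fin m) ℂ)ˣ)
    (D : (Matrix (Fin n) (Fin n) ℂ)ˣ) :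
    ((blockUnit A D : (Matrix (Fin m ⊕ Fin n) (Fin m ⊕ Fin n) ℂ)ˣ) :
      Matrix (Fin m ⊕ Fin n) (Fin m ⊕ Fin n) ℂ) ∈ (gl (par m n)).part 0 := by
  intro a b h
  rcases a with a | a <;> rcases b with b | b <;> simp [par, zmod2_one_add_one] at h ⊢ <;> rfl

/-- An isomorphism between the two lines extends to the whole space. This transitivity reduces
stabilizers to that of a basis vector. -/
theorem exists_unit_mulVec_eq {u w : ι → ℂ} (hu : u ≠ 0) (hw : w ≠ 0) :
    ∃ A : (Matrix ι ι ℂ)ˣ, (A : Matrix ι ι ℂ) *ᵥ u = w := by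
  obtain ⟨g, hg⟩ := Submodule.exists_linearEquiv_restrict_eq
    ((LinearEquiv.toSpanNonzeroSingleton ℂ (ι → ℂ) u hu).symm.trans
      (LinearEquiv.toSpanNonzeroSingleton ℂ (ι → ℂ) w hw))
  refine ⟨⟨LinearMap.toMatrix' (g : (ι → ℂ) →ₗ[ℂ] (ι → ℂ)),
    LinearMap.toMatrix' (g.symm : (ι → ℂ) →ₗ[ℂ] (ι → ℂ)), ?_, ?_⟩, ?_⟩
  · rw [← LinearMap.toMatrix'_comp]; simp
  · rw [← LinearMap.toMatrix'_comp]; simp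
  · change LinearMap.toMatrix' (g : (ι → ℂ) →ₗ[ℂ] (ι → ℂ)) *ᵥ u = w
    rw [LinearMap.toMatrix'_mulVec]
    have h := hg ⟨u, Submodule.mem_span_singleton_self u⟩
    have h1 : (LinearEquiv.toSpanNonzeroSingleton ℂ (ι → ℂ) u hu).symm
        ⟨u, Submodule.mem_span_singleton_self u⟩ = 1 := by
      rw [LinearEquiv.symm_apply_eq]
      ext
      simp [LinearEquiv.toSpanNonzeroSingleton]
    rw [LinearEquiv.trans_apply, h1] at h
    rw [LinearEquiv.coe_coe, ← h]
    simp [LinearEquiv.toSpanNonzeroSingleton]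

end Standard

/-! ### The stabilizer of a vector of the standard representation -/

section StdStabilizer

variable {ι κ : Type*} [Fintype ι] [DecidableEq ι] [Fintype κ] [DecidableEq κ]

theorem sum_eq_add_sum_some {M : Type*} [AddCommMonoid M] (E : Option κ ≃ ι) (f : ι → M) :
    ∑ c, f c = f (E none) + ∑ c : κ, f (E (some c)) := by
  rw [← E.sum_comp, Fintype.sum_option]

/-- Restrict a matrix to the rows and columns with indices different from `E none`. -/
def restrictMat (E : Option κ ≃ ι) : Matrix ι ι ℂ →ₗ[ℂ] Matrix κ κ ℂ where
  toFun X := X.submatrix (fun a => E (some a)) (fun a => E (some a))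
  map_add' _ _ := rfl
  map_smul' _ _ := rfl

theorem restrictMat_apply (E : Option κ ≃ ι) (X : Matrix ι ι ℂ) (a b : κ) :
    restrictMat E X a b = X (E (some a)) (E (some b)) := rfl

theorem restrictMat_mem {E : Option κ ≃ ι} {p : ι → ZMod 2} {q : κ → ZMod 2}
    (hq : ∀ b, p (E (some b)) = q b) {i : ZMod 2} {X : Matrix ι ι ℂ} (hX : X ∈ (gl p).part i) :
    restrictMat E X ∈ (gl q).part i := fun a b h => hX _ _ (by rwa [hq, hq])

theorem mem_stabilizer_single {p : ι → ZMod 2} {z : ι} (h : Pi.single z 1 ∈ (std p).part 0)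
    {X : Matrix ι ι ℂ} :
    X ∈ ((std p).stabilizer (Pi.single z 1) h).carrier ↔ ∀ a, X a z = 0 := by
  change (std p).act X _ = 0 ↔ _
  rw [std_act, Matrix.mulVec_single_one]
  exact funext_iff

theorem dualStd_act_apply {p : ι → ZMod 2} (X : Matrix ι ι ℂ) (φ : ι → ℂ) (b : ι) :
    (dualStd p).act X φ b = ∑ a, -(sgn ((p a + p b) * p a) * X a b) * φ a := rfl

/-- A matrix killing `e_z` has zero column at `z`; what remains is a square block on the other
indices and the row of `z`. The row of a product is the row of the first factor times the block of
the second, which is how the dual representation enters. -/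
theorem stabilizer_single_iso (E : Option κ ≃ ι) {p : ι → ZMod 2} {q : κ → ZMod 2}
    (hq : ∀ b, p (E (some b)) = q b) (hz : p (E none) = 0)
    (h : Pi.single (E none) 1 ∈ (std p).part 0) :
    ((std p).stabilizer (Pi.single (E none) 1) h).toAlg.Iso (dualStd q).semidirect := by
  set S := (std p).stabilizer (Pi.single (E none) 1) h with hS
  have hmem : ∀ X : S.carrier, ∀ a, (X : Matrix ι ι ℂ) a (E none) = 0 := fun X =>
    (mem_stabilizer_single h).1 X.2
  let f : S.carrier →ₗ[ℂ] Matrix κ κ ℂ × (κ → ℂ) :=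
    { toFun := fun X => (restrictMat E X, fun b => (X : Matrix ι ι ℂ) (E none) (E (some b)))
      map_add' := fun X Y => rfl
      map_smul' := fun c X => rfl }
  have hf1 : ∀ X a b, (f X).1 a b = (X : Matrix ι ι ℂ) (E (some a)) (E (some b)) :=
    fun _ _ _ => rfl
  have hf2 : ∀ X b, (f X).2 b = (X : Matrix ι ι ℂ) (E none) (E (some b)) := fun _ _ => rfl
  have hf : Function.Bijective f := by
    constructor
    · rw [← LinearMap.ker_eq_bot, LinearMap.ker_eq_bot']
      intro X hX
      apply Subtype.ext
      ext a b
      obtain ⟨a, rfl⟩ := E.surjective a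
      obtain ⟨b, rfl⟩ := E.surjective b
      rcases b with _ | b
      · exact hmem X _
      · rcases a with _ | a
        · exact congrFun (congrArg Prod.snd hX) b
        · exact congrFun (congrFun (congrArg Prod.fst hX) a) b
    · rintro ⟨Z, φ⟩
      refine ⟨⟨Matrix.of fun a b => (E.symm b).elim 0 fun b' =>
        (E.symm a).elim (φ b') fun a' => Z a' b', (mem_stabilizer_single h).2 fun a => by simp⟩, ?_⟩
      refine Prod.ext ?_ ?_
      · ext a b
        rw [hf1]
        simp
      · funext b
        rw [hf2]
        simp
  have hpart : ∀ i, ∀ X ∈ S.toAlg.part i, f X ∈ (dualStd q).semidirect.part i := by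
    intro i X hX
    have hX' : (X : Matrix ι ι ℂ) ∈ (gl p).part i := hX
    refine ⟨restrictMat_mem hq hX', fun b hb => hX' _ _ ?_⟩
    rwa [hz, zero_add, hq]
  refine SuperLieAlg.Iso.of_homogeneous (LinearEquiv.ofBijective f hf) hpart ?_
  intro i j X hX Y hY
  have hX' : (X : Matrix ι ι ℂ) ∈ (gl p).part i := hX
  have hY' : (Y : Matrix ι ι ℂ) ∈ (gl p).part j := hY
  have hbr : ((S.toAlg.br X Y : S.carrier) : Matrix ι ι ℂ) = _ := matBr_apply p hX' hY'
  refine Eq.trans ?_ ((dualStd q).semidirectBr_apply (hpart i X hX) (hpart j Y hY)).symm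
  have hbr2 : (gl q).br (restrictMat E X) (restrictMat E Y) = _ :=
    matBr_apply q (restrictMat_mem hq hX') (restrictMat_mem hq hY')
  refine Prod.ext ?_ ?_
  · refine Eq.trans ?_ hbr2.symm
    ext a b
    change ((S.toAlg.br X Y : S.carrier) : Matrix ι ι ℂ) (E (some a)) (E (some b)) = _
    rw [hbr]
    simp only [Matrix.sub_apply, Matrix.smul_apply, Matrix.mul_apply, sum_eq_add_sum_some E,
      hmem, zero_mul, zero_add, restrictMat_apply]
  · funext b
    change ((S.toAlg.br X Y : S.carrier) : Matrix ι ι ℂ) (E none) (E (some b)) = _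
    rw [hbr]
    simp only [Matrix.sub_apply, Matrix.smul_apply, Matrix.mul_apply, sum_eq_add_sum_some E,
      hmem, zero_mul, zero_add, hf1, hf2, Pi.sub_apply, Pi.smul_apply,
      dualStd_act_apply, smul_eq_mul, Finset.mul_sum]
    -- The sums are matched crosswise: the term with the row of `Y` times `X` is the dual action of
    -- `X` on the row of `Y`. In each summand only entries of the right parity survive, and for
    -- these the signs agree.
    rw [sub_eq_add_neg, add_comm, ← Finset.sum_neg_distrib, sub_eq_add_neg,
      ← Finset.sum_neg_distrib]
    congr 1
    · refine Finset.sum_congr rfl fun c _ => ?_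
      by_cases h1 : q c = j
      · by_cases h2 : q c + q b = i
        · rw [h2, h1]; ring
        · rw [hX' _ _ (by rwa [hq, hq])]; ring
      · rw [hY' (E none) (E (some c)) (by rwa [hz, zero_add, hq])]; ring
    · refine Finset.sum_congr rfl fun c _ => ?_
      by_cases h1 : q c = i
      · by_cases h2 : q c + q b = j
        · rw [h2, h1, mul_comm j i]
          linear_combination (-(X : Matrix ι ι ℂ) (E none) (E (some c)) *
            (Y : Matrix ι ι ℂ) (E (some c)) (E (some b))) * sgn_mul_self (i * j)
        · rw [hY' _ _ (by rwa [hq, hq])]; ring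
      · rw [hX' (E none) (E (some c)) (by rwa [hz, zero_add, hq])]; ring

/-- The first even basis vector of `ℂ^{m+1|n}` together with the basis of `ℂ^{m|n}`. -/
def optionEquivInl (m n : ℕ) : Option (Fin m ⊕ Fin n) ≃ Fin (m + 1) ⊕ Fin n where
  toFun := fun x => x.elim (Sum.inl 0) (Sum.map Fin.succ id)
  invFun := Sum.elim (Fin.cases none fun i => some (Sum.inl i)) fun j => some (Sum.inr j)
  left_inv x := by rcases x with _ | (i | j) <;> simp
  right_inv x := by
    rcases x with i | j
    · refine Fin.cases ?_ (fun i => ?_) i <;> simp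
    · simp

/-- The first odd basis vector of `ℂ^{m|n+1}` together with the basis of `ℂ^{m|n}`. -/
def optionEquivInr (m n : ℕ) : Option (Fin m ⊕ Fin n) ≃ Fin m ⊕ Fin (n + 1) where
  toFun := fun x => x.elim (Sum.inr 0) (Sum.map id Fin.succ)
  invFun := Sum.elim (fun i => some (Sum.inl i)) (Fin.cases none fun j => some (Sum.inr j))
  left_inv x := by rcases x with _ | (i | j) <;> simp
  right_inv x := by
    rcases x with i | j
    · simp
    · refine Fin.cases ?_ (fun i => ?_) j <;> simp

theorem std_stabilizer_iso (m n : ℕ) (hm : 1 ≤ m) {v : Fin m ⊕ Fin n → ℂ} (h0 : v ≠ 0)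
    (hv : v ∈ (std (par m n)).part 0) :
    ((std (par m n)).stabilizer v hv).toAlg.Iso (dualStd (par (m - 1) n)).semidirect := by
  obtain ⟨k, rfl⟩ := Nat.exists_eq_add_of_le' hm
  change SuperLieAlg.Iso _ (dualStd (par k n)).semidirect
  have hvr : ∀ j, v (Sum.inr j) = 0 := fun j => hv _ (by simp [par])
  have hu : (fun i => v (Sum.inl i)) ≠ 0 := fun h => h0 (by
    funext a
    rcases a with i | j
    · exact congrFun h i
    · exact hvr j)
  -- An even vector lives in the even block, so a matrix of that block alone moves it to the first
  -- basis vector.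
  obtain ⟨A, hA⟩ := exists_unit_mulVec_eq hu (w := Pi.single 0 1) (by simp)
  set g := blockUnit A (1 : (Matrix (Fin n) (Fin n) ℂ)ˣ) with hg
  have hgv : mulVecEquiv g v = Pi.single (Sum.inl 0) 1 := by
    have h1 : v = Sum.elim (fun i => v (Sum.inl i)) 0 := by
      funext a
      rcases a with i | j
      · rfl
      · exact hvr j
    change (Matrix.fromBlocks (A : Matrix (Fin (k + 1)) (Fin (k + 1)) ℂ) 0 0
      ((1 : (Matrix (Fin n) (Fin n) ℂ)ˣ) : Matrix (Fin n) (Fin n) ℂ)) *ᵥ v = _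
    rw [h1, Matrix.fromBlocks_mulVec]
    have h2 : (Sum.elim (fun i => v (Sum.inl i)) (0 : Fin n → ℂ)) ∘ Sum.inl =
      fun i => v (Sum.inl i) := rfl
    rw [h2, hA]
    funext a
    rcases a with i | j
    · simp [Pi.single_apply]
    · simp
  have hw : (Pi.single (Sum.inl 0) 1 : Fin (k + 1) ⊕ Fin n → ℂ) ∈ (std (par (k + 1) n)).part 0 :=
    std_part_single rfl
  have hc := conj_stabilizer (blockUnit_mem A 1) (mulVecEquiv g) (mulVecEquiv_act g) hv hw hgv
  refine hc.iso.trans (stabilizer_single_iso (optionEquivInl k n) ?_ rfl hw)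
  rintro (i | j) <;> rfl

end StdStabilizer

/-! ### Degree two: the matrix model -/

section DegreeTwo

variable {ι : Type*} [Fintype ι] [DecidableEq ι]

/-- The representation on the tensors on which the transpositions act by `η`. -/
def superPow (p : ι → ZMod 2) (η : ℂ) (d : ℕ) : SuperRep (gl p) (superSym p η d) :=
  (tensor p d).restrictSpace _ (superSym_isGraded p η d) (superSym_stable p η d)

theorem superPow_act_apply (p : ι → ZMod 2) (η : ℂ) (d : ℕ) (X : Matrix ι ι ℂ)
    (t : superSym p η d) (f : Fin d → ι) :
    ((superPow p η d).act X t : (Fin d → ι) → ℂ) f = ∑ k, slotAct p k X t f := by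
  change (tensor p d).act X t f = _
  simp [tensor]

theorem mem_superPow_part {p : ι → ZMod 2} {η : ℂ} {d : ℕ} {i : ZMod 2} {t : superSym p η d} :
    t ∈ (superPow p η d).part i ↔
      ∀ f : Fin d → ι, ∑ k, p (f k) ≠ i → (t : (Fin d → ι) → ℂ) f = 0 := Iff.rfl

/-- The action of the transposition on a matrix, times `η`. -/
def superFlip (p : ι → ZMod 2) (η : ℂ) : Matrix ι ι ℂ →ₗ[ℂ] Matrix ι ι ℂ where
  toFun Y := Matrix.of fun a b => η * (sgn (p a * p b) * Y b a)
  map_add' X Y := by ext; simp; ring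
  map_smul' c X := by ext; simp; ring

theorem superFlip_apply (p : ι → ZMod 2) (η : ℂ) (Y : Matrix ι ι ℂ) (a b : ι) :
    superFlip p η Y a b = η * (sgn (p a * p b) * Y b a) := rfl

/-- The matrices fixed by `superFlip`. -/
def symMat (p : ι → ZMod 2) (η : ℂ) : Submodule ℂ (Matrix ι ι ℂ) where
  carrier := {W | superFlip p η W = W}
  zero_mem' := map_zero _
  add_mem' := fun {X Y} hX hY => by
    change superFlip p η (X + Y) = X + Y
    rw [map_add]
    exact congrArg₂ (· + ·) hX hY
  smul_mem' := fun c X hX => by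
    change superFlip p η (c • X) = c • X
    rw [map_smul]
    exact congrArg (c • ·) hX

theorem mem_symMat {p : ι → ZMod 2} {η : ℂ} {W : Matrix ι ι ℂ} :
    W ∈ symMat p η ↔ superFlip p η W = W := Iff.rfl

theorem mem_symMat' {p : ι → ZMod 2} {η : ℂ} {W : Matrix ι ι ℂ} :
    W ∈ symMat p η ↔ ∀ a b, W b a = η * (sgn (p a * p b) * W a b) := by
  rw [mem_symMat, ← Matrix.ext_iff]
  refine ⟨fun h a b => ?_, fun h a b => ?_⟩
  · rw [← h b a, superFlip_apply, mul_comm (p a)]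
  · rw [superFlip_apply, h b a, mul_comm (p a)]

theorem add_superFlip_mem {p : ι → ZMod 2} {η : ℂ} (hη : η * η = 1) (Y : Matrix ι ι ℂ) :
    Y + superFlip p η Y ∈ symMat p η := by
  rw [mem_symMat']
  intro c d
  have h2 := sgn_mul_self (p c * p d)
  simp only [Matrix.add_apply, superFlip_apply, mul_comm (p d)]
  linear_combination (-Y d c) * (η * η * h2 + hη)

/-- A tensor of degree two as a matrix. -/
def tensorEquiv (p : ι → ZMod 2) (η : ℂ) : superSym p η 2 ≃ₗ[ℂ] symMat p η where
  toFun t := ⟨Matrix.of fun a b => (t : (Fin 2 → ι) → ℂ) ![a, b], mem_symMat'.2 fun a b => by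
    have h := t.2 0 1 rfl ![a, b]
    have e : ![a, b] ∘ Equiv.swap (0 : Fin 2) 1 = ![b, a] := by
      funext k
      fin_cases k <;> simp
    rw [e] at h
    simpa using h⟩
  map_add' _ _ := rfl
  map_smul' _ _ := rfl
  invFun W := ⟨fun f => (W : Matrix ι ι ℂ) (f 0) (f 1), fun k l h f => by
    have hk : k = 0 := by omega
    have hl : l = 1 := by omega
    subst hk hl
    simpa using mem_symMat'.1 W.2 (f 0) (f 1)⟩
  left_inv t := by
    ext f
    have e : ![f 0, f 1] = f := by
      funext k
      fin_cases k <;> rfl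
    simp [e]
  right_inv W := by
    ext a b
    simp

theorem tensorEquiv_apply {p : ι → ZMod 2} {η : ℂ} (t : superSym p η 2) (a b : ι) :
    (tensorEquiv p η t : Matrix ι ι ℂ) a b = (t : (Fin 2 → ι) → ℂ) ![a, b] := rfl

/-- Acting on the first factor is left multiplication. Acting on the second factor is its image
under the transposition, because the tensor is itself an eigenvector of the transposition. -/
theorem tensorEquiv_act {p : ι → ZMod 2} {η : ℂ} (X : Matrix ι ι ℂ) (t : superSym p η 2) :
    (tensorEquiv p η ((superPow p η 2).act X t) : Matrix ι ι ℂ) =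
      X * tensorEquiv p η t + superFlip p η (X * tensorEquiv p η t) := by
  ext a b
  rw [tensorEquiv_apply, superPow_act_apply, Fin.sum_univ_two, Matrix.add_apply, superFlip_apply,
    Matrix.mul_apply, Matrix.mul_apply, Finset.mul_sum, Finset.mul_sum, slotAct_apply,
    slotAct_apply]
  have h0 : preParity p 0 ![a, b] = 0 := by simp [preParity]
  have h1 : preParity p 1 ![a, b] = p a := by
    have := preParity_succ p (d := 2) (k := 0) (l := 1) rfl ![a, b]
    rw [this, h0]
    simp
  have hu0 : ∀ c, Function.update ![a, b] 0 c = ![c, b] := fun c => by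
    funext k
    fin_cases k <;> simp
  have hu1 : ∀ c, Function.update ![a, b] 1 c = ![a, c] := fun c => by
    funext k
    fin_cases k <;> simp
  refine congrArg₂ (· + ·) (Finset.sum_congr rfl fun c _ => ?_)
    (Finset.sum_congr rfl fun c _ => ?_)
  · rw [h0, hu0, mul_zero, sgn_zero, one_mul, tensorEquiv_apply]
    rfl
  · have h2 := mem_symMat'.1 (tensorEquiv p η t).2 c a
    rw [tensorEquiv_apply, tensorEquiv_apply] at h2
    rw [h1, hu1, tensorEquiv_apply, h2]
    have e : sgn ((p b + p c) * p a) * sgn (p c * p a) = sgn (p a * p b) := by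
      rw [← sgn_add]
      congr 1
      generalize p a = x, p b = y, p c = z
      revert x y z
      decide
    have hb : (![a, b] : Fin 2 → ι) 1 = b := rfl
    rw [hb]
    linear_combination (X b c * η * (t : (Fin 2 → ι) → ℂ) ![c, a]) * e

theorem tensorEquiv_mem_part {p : ι → ZMod 2} {η : ℂ} {i : ZMod 2} {t : superSym p η 2} :
    (tensorEquiv p η t : Matrix ι ι ℂ) ∈ (gl p).part i ↔ t ∈ (superPow p η 2).part i := by
  rw [mem_gl_part, mem_superPow_part]
  constructor
  · intro h f hf
    have e : ![f 0, f 1] = f := by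
      funext k
      fin_cases k <;> rfl
    rw [← e]
    exact h _ _ (by rwa [Fin.sum_univ_two] at hf)
  · intro h a b hab
    exact h ![a, b] (by rwa [Fin.sum_univ_two])

/-- The orbit of `M` under the upper triangular matrices is everything. -/
def MatSpherical {α : Type*} [LinearOrder α] (p : ι → ZMod 2) (η : ℂ) (pos : ι → α)
    (M : Matrix ι ι ℂ) : Prop :=
  ∀ W ∈ symMat p η, ∃ X ∈ flagBorel pos, X * M + superFlip p η (X * M) = W

/-- The identity matrix lies in the Borel subalgebra and acts by `2` in degree two, so the scalar
`c` is absorbed as `c / 2` times the identity. -/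
theorem matSpherical_iff {α : Type*} [LinearOrder α] {p : ι → ZMod 2} {η : ℂ} {pos : ι → α}
    {v : superSym p η 2} :
    (∀ w : superSym p η 2, ∃ x ∈ flagBorel pos, ∃ c : ℂ,
      (superPow p η 2).act x v + c • v = w) ↔ MatSpherical p η pos (tensorEquiv p η v) := by
  constructor
  · intro h W hW
    obtain ⟨x, hx, c, e⟩ := h ((tensorEquiv p η).symm ⟨W, hW⟩)
    have h1 : (1 : Matrix ι ι ℂ) ∈ flagBorel pos := fun a b hab =>
      Matrix.one_apply_ne (fun h => by subst h; exact lt_irrefl _ hab)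
    refine ⟨x + (c / 2) • 1, Submodule.add_mem _ hx (Submodule.smul_mem _ _ h1), ?_⟩
    have e2 := congrArg (fun t => (tensorEquiv p η t : Matrix ι ι ℂ)) e
    simp only [map_add, map_smul, LinearEquiv.apply_symm_apply, Submodule.coe_add,
      Submodule.coe_smul, tensorEquiv_act] at e2
    rw [← e2, add_mul, map_add, smul_mul_assoc, one_mul, map_smul,
      mem_symMat.1 (tensorEquiv p η v).2]
    module
  · intro h w
    obtain ⟨X, hX, e⟩ := h _ (tensorEquiv p η w).2
    refine ⟨X, hX, 0, ?_⟩
    apply (tensorEquiv p η).injective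
    apply Subtype.ext
    rw [zero_smul, add_zero, tensorEquiv_act, e]

theorem nontrivial_superSym_two [Nontrivial ι] {p : ι → ZMod 2} {η : ℂ} (hη : η * η = 1) :
    Nontrivial (superSym p η 2) := by
  obtain ⟨a, b, hab⟩ := exists_pair_ne ι
  set W : Matrix ι ι ℂ := Matrix.single a b 1 + superFlip p η (Matrix.single a b 1) with hW
  have hWm : W ∈ symMat p η := add_superFlip_mem hη _
  have hW0 : W a b = 1 := by simp [hW, superFlip_apply, hab]
  refine ⟨(tensorEquiv p η).symm ⟨W, hWm⟩, 0, fun h => ?_⟩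
  rw [LinearEquiv.symm_apply_eq, map_zero] at h
  have h2 : W a b = 0 := congrFun (congrFun (congrArg Subtype.val h) a) b
  exact one_ne_zero (hW0.symm.trans h2)

/-- The element of degree two attached to a matching `κ` of the basis vectors. -/
def matchMat {α : Type*} [LinearOrder α] (p : ι → ZMod 2) (η : ℂ) (pos : ι → α) (κ : ι → ι)
    (i : ZMod 2) : Matrix ι ι ℂ :=
  open Classical in
  -- The last condition removes diagonal entries that symmetry forces to vanish. Entries are `1` on
  -- one side of the diagonal, and the other side is determined by the symmetry.
  Matrix.of fun c d => if d = κ c ∧ p c + p d = i ∧ (c = d → η * sgn (p c) = 1) then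
    (if pos c ≤ pos d then 1 else η * sgn (p c * p d)) else 0

theorem zmod2_mul_self (a : ZMod 2) : a * a = a := by
  revert a; decide

theorem matchMat_mem {α : Type*} [LinearOrder α] {p : ι → ZMod 2} {η : ℂ} (hη : η * η = 1)
    {pos : ι → α} (hpos : Function.Injective pos) {κ : ι → ι} (hκ : ∀ a, κ (κ a) = a)
    (i : ZMod 2) : matchMat p η pos κ i ∈ symMat p η := by
  rw [mem_symMat']
  intro a b
  simp only [matchMat, Matrix.of_apply]
  by_cases h : b = κ a ∧ p a + p b = i ∧ (a = b → η * sgn (p a) = 1)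
  · have h' : a = κ b ∧ p b + p a = i ∧ (b = a → η * sgn (p b) = 1) :=
      ⟨by rw [h.1, hκ], by rw [add_comm]; exact h.2.1, fun e => by rw [e]; exact h.2.2 e.symm⟩
    rw [if_pos h, if_pos h']
    rcases lt_trichotomy (pos a) (pos b) with hlt | heq | hlt
    · rw [if_pos hlt.le, if_neg hlt.not_ge, mul_one, mul_comm (p a)]
    · have e := hpos heq
      subst e
      rw [if_pos le_rfl, mul_one, zmod2_mul_self, h.2.2 rfl]
    · rw [if_pos hlt.le, if_neg hlt.not_ge]
      linear_combination (-(η * η)) * sgn_mul_self (p a * p b) - hη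
  · have h' : ¬ (a = κ b ∧ p b + p a = i ∧ (b = a → η * sgn (p b) = 1)) := fun h' =>
      h ⟨by rw [h'.1, hκ], by rw [add_comm]; exact h'.2.1, fun e => by rw [e]; exact h'.2.2 e.symm⟩
    rw [if_neg h, if_neg h']
    simp

theorem matchMat_mem_part {α : Type*} [LinearOrder α] (p : ι → ZMod 2) (η : ℂ)
    (pos : ι → α) (κ : ι → ι) (i : ZMod 2) : matchMat p η pos κ i ∈ (gl p).part i := by
  intro a b h
  simp only [matchMat, Matrix.of_apply]
  exact if_neg fun h' => h h'.2.1

/-- Any symmetric `W` is `Y + Y^flip` with `Y` its upper half, so it suffices to solve `XM = Y`.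
Column `d` of `M` has its only possible entry in row `κ d`, which gives `X` by division. The
hypothesis `h` says that wherever `Y` can be nonzero, this entry is nonzero and the resulting `X` is
upper triangular. -/
theorem matchMat_spherical {α : Type*} [LinearOrder α] {p : ι → ZMod 2} {η : ℂ} (hη : η * η = 1)
    {pos : ι → α} (hpos : Function.Injective pos) {κ : ι → ι} (hκ : ∀ a, κ (κ a) = a)
    {i : ZMod 2} (h : ∀ a b, pos a ≤ pos b → (a = b → η * sgn (p a) = 1) →
      pos a ≤ pos (κ b) ∧ p b + p (κ b) = i ∧ (κ b = b → η * sgn (p b) = 1)) :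
    MatSpherical p η pos (matchMat p η pos κ i) := by
  intro W hW
  set M := matchMat p η pos κ i with hM
  have hη0 : η ≠ 0 := by
    rintro rfl
    simp at hη
  have hdiag : ∀ a, W a a ≠ 0 → η * sgn (p a) = 1 := by
    intro a ha
    have := mem_symMat'.1 hW a a
    rw [zmod2_mul_self] at this
    exact mul_right_cancel₀ ha (by rw [one_mul, mul_assoc]; exact this.symm)
  -- The diagonal is halved because it is counted twice in `Y + Y^flip`.
  set Y : Matrix ι ι ℂ := Matrix.of fun a b => if a = b then W a b / 2 else
    if pos a < pos b then W a b else 0 with hY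
  have hY0 : ∀ a b, Y a b ≠ 0 → pos a ≤ pos b ∧ (a = b → η * sgn (p a) = 1) := by
    intro a b hab
    simp only [hY, Matrix.of_apply] at hab
    split_ifs at hab with h1 h2
    · subst h1
      exact ⟨le_rfl, fun _ => hdiag a fun h0 => hab (by rw [h0, zero_div])⟩
    · exact ⟨h2.le, fun e => absurd e h1⟩
    · exact absurd rfl hab
  have hYW : Y + superFlip p η Y = W := by
    ext a b
    rw [Matrix.add_apply, superFlip_apply]
    simp only [hY, Matrix.of_apply]
    have hs := mem_symMat'.1 hW a b
    rcases lt_trichotomy (pos a) (pos b) with hlt | heq | hlt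
    · have hne : a ≠ b := by rintro rfl; exact lt_irrefl _ hlt
      rw [if_neg hne, if_neg hne.symm, if_pos hlt, if_neg hlt.not_gt]
      ring
    · have e := hpos heq
      subst e
      rw [if_pos rfl]
      linear_combination (-1 / 2 : ℂ) * hs
    · have hne : a ≠ b := by rintro rfl; exact lt_irrefl _ hlt
      rw [if_neg hne, if_neg hne.symm, if_pos hlt, if_neg hlt.not_gt, hs]
      linear_combination (η * η * W a b) * sgn_mul_self (p a * p b) + W a b * hη
  refine ⟨Matrix.of fun a c => Y a (κ c) * (M c (κ c))⁻¹, ?_, ?_⟩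
  · intro a c hac
    rw [Matrix.of_apply]
    by_contra h0
    have h1 := hY0 a (κ c) (left_ne_zero_of_mul h0)
    have h2 := (h a (κ c) h1.1 h1.2).1
    rw [hκ] at h2
    exact absurd h2 (not_le.2 hac)
  · have hXM : (Matrix.of fun a c => Y a (κ c) * (M c (κ c))⁻¹) * M = Y := by
      ext a d
      rw [Matrix.mul_apply, Finset.sum_eq_single (κ d)]
      · rw [Matrix.of_apply, hκ]
        by_cases hYad : Y a d = 0
        · rw [hYad]; ring
        · have h1 := hY0 a d hYad
          have h2 := h a d h1.1 h1.2
          have hne : M (κ d) d ≠ 0 := by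
            simp only [hM, matchMat, Matrix.of_apply]
            rw [if_pos ⟨(hκ d).symm, by rw [add_comm]; exact h2.2.1,
              fun e => by rw [e]; exact h2.2.2 e⟩]
            split_ifs
            · exact one_ne_zero
            · exact mul_ne_zero hη0 (sgn_ne_zero _)
          rw [inv_mul_cancel_right₀ hne]
      · intro c _ hc
        have : M c d = 0 := by
          simp only [hM, matchMat, Matrix.of_apply]
          exact if_neg fun h' => hc (by rw [h'.1, hκ])
        rw [this, mul_zero]
      · simp
    rw [hXM, hYW]

theorem exists_spherical_of_matching {α : Type*} [LinearOrder α] {p : ι → ZMod 2} {η : ℂ}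
    (hη : η * η = 1) {pos : ι → α} (hpos : Function.Injective pos) {κ : ι → ι}
    (hκ : ∀ a, κ (κ a) = a) {i : ZMod 2}
    (h : ∀ a b, pos a ≤ pos b → (a = b → η * sgn (p a) = 1) →
      pos a ≤ pos (κ b) ∧ p b + p (κ b) = i ∧ (κ b = b → η * sgn (p b) = 1)) :
    ∃ v ∈ (superPow p η 2).part i, ∀ w : superSym p η 2, ∃ x ∈ flagBorel pos, ∃ c : ℂ,
      (superPow p η 2).act x v + c • v = w := by
  refine ⟨(tensorEquiv p η).symm ⟨_, matchMat_mem hη hpos hκ i⟩, ?_, ?_⟩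
  · rw [← tensorEquiv_mem_part, LinearEquiv.apply_symm_apply]
    exact matchMat_mem_part p η pos κ i
  · rw [matSpherical_iff, LinearEquiv.apply_symm_apply]
    exact matchMat_spherical hη hpos hκ h

/-! ### The group of even invertible matrices in degree two -/

/-- An even `g` links only indices of equal parity, so the sign of the transposition passes through
the congruence. -/
theorem superFlip_congr {p : ι → ZMod 2} {η : ℂ} {g : Matrix ι ι ℂ} (hg : g ∈ (gl p).part 0)
    (Y : Matrix ι ι ℂ) : superFlip p η (g * Y * gᵀ) = g * superFlip p η Y * gᵀ := by
  ext a b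
  simp only [superFlip_apply, Matrix.mul_apply, Matrix.transpose_apply, Finset.sum_mul,
    Finset.mul_sum]
  rw [Finset.sum_comm]
  refine Finset.sum_congr rfl fun c _ => Finset.sum_congr rfl fun d _ => ?_
  by_cases h1 : p a = p d
  · by_cases h2 : p b = p c
    · rw [h1, h2]; ring
    · rw [hg b c fun h => h2 (zmod2_add_eq_zero.1 h)]; ring
  · rw [hg a d fun h => h1 (zmod2_add_eq_zero.1 h)]; ring

theorem congr_mem_symMat {p : ι → ZMod 2} {η : ℂ} {g : Matrix ι ι ℂ} (hg : g ∈ (gl p).part 0)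
    {W : Matrix ι ι ℂ} (hW : W ∈ symMat p η) : g * W * gᵀ ∈ symMat p η := by
  rw [mem_symMat, superFlip_congr hg, mem_symMat.1 hW]

/-- The action of an even invertible matrix in degree two, in the matrix model. -/
def congrMat {p : ι → ZMod 2} (η : ℂ) (g : (Matrix ι ι ℂ)ˣ)
    (hg : (g : Matrix ι ι ℂ) ∈ (gl p).part 0) : symMat p η ≃ₗ[ℂ] symMat p η where
  toFun W := ⟨g * W * (g : Matrix ι ι ℂ)ᵀ, congr_mem_symMat hg W.2⟩
  map_add' W Z := by ext1; simp [mul_add, add_mul]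
  map_smul' c W := by ext1; simp
  invFun W := ⟨(↑g⁻¹ : Matrix ι ι ℂ) * W * (↑g⁻¹ : Matrix ι ι ℂ)ᵀ,
    congr_mem_symMat (even_inv_mem p hg) W.2⟩
  left_inv W := by
    ext1
    have h : (g : Matrix ι ι ℂ)ᵀ * (↑g⁻¹ : Matrix ι ι ℂ)ᵀ = 1 := by
      rw [← Matrix.transpose_mul, Units.inv_mul, Matrix.transpose_one]
    simp only [mul_assoc, h, mul_one, Units.inv_mul_cancel_left]
  right_inv W := by
    ext1
    have h : (↑g⁻¹ : Matrix ι ι ℂ)ᵀ * (g : Matrix ι ι ℂ)ᵀ = 1 := by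
      rw [← Matrix.transpose_mul, Units.mul_inv, Matrix.transpose_one]
    simp only [mul_assoc, h, mul_one, Units.mul_inv_cancel_left]

/-- The action of an even invertible matrix in degree two. -/
def congrEquiv {p : ι → ZMod 2} (η : ℂ) (g : (Matrix ι ι ℂ)ˣ)
    (hg : (g : Matrix ι ι ℂ) ∈ (gl p).part 0) : superSym p η 2 ≃ₗ[ℂ] superSym p η 2 :=
  (tensorEquiv p η).trans ((congrMat η g hg).trans (tensorEquiv p η).symm)

theorem tensorEquiv_congrEquiv {p : ι → ZMod 2} (η : ℂ) (g : (Matrix ι ι ℂ)ˣ)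
    (hg : (g : Matrix ι ι ℂ) ∈ (gl p).part 0) (t : superSym p η 2) :
    (tensorEquiv p η (congrEquiv η g hg t) : Matrix ι ι ℂ) =
      g * tensorEquiv p η t * (g : Matrix ι ι ℂ)ᵀ := by
  rw [congrEquiv, LinearEquiv.trans_apply, LinearEquiv.trans_apply, LinearEquiv.apply_symm_apply]
  rfl

theorem congrEquiv_act {p : ι → ZMod 2} {η : ℂ} (g : (Matrix ι ι ℂ)ˣ)
    (hg : (g : Matrix ι ι ℂ) ∈ (gl p).part 0) (X : Matrix ι ι ℂ) (t : superSym p η 2) :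
    congrEquiv η g hg ((superPow p η 2).act X t) =
      (superPow p η 2).act (conjMat g X) (congrEquiv η g hg t) := by
  apply (tensorEquiv p η).injective
  apply Subtype.ext
  have h : conjMat g X * (g * tensorEquiv p η t * (g : Matrix ι ι ℂ)ᵀ) =
      g * (X * tensorEquiv p η t) * (g : Matrix ι ι ℂ)ᵀ := by
    change (g : Matrix ι ι ℂ) * X * (↑g⁻¹ : Matrix ι ι ℂ) * _ = _
    simp only [mul_assoc, Units.inv_mul_cancel_left]
  rw [tensorEquiv_congrEquiv, tensorEquiv_act, tensorEquiv_act, tensorEquiv_congrEquiv, h,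
    superFlip_congr hg, mul_add, add_mul]

theorem congrEquiv_mem_part {p : ι → ZMod 2} {η : ℂ} (g : (Matrix ι ι ℂ)ˣ)
    (hg : (g : Matrix ι ι ℂ) ∈ (gl p).part 0) {i : ZMod 2} {t : superSym p η 2}
    (ht : t ∈ (superPow p η 2).part i) : congrEquiv η g hg t ∈ (superPow p η 2).part i := by
  rw [← tensorEquiv_mem_part] at ht ⊢
  rw [tensorEquiv_congrEquiv]
  refine mul_even_mem p (even_mul_mem p hg ht) fun a b h => hg b a (by rwa [add_comm])

theorem superPow_two_isoAlong_conj {p : ι → ZMod 2} (η : ℂ) (g : (Matrix ι ι ℂ)ˣ)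
    (hg : (g : Matrix ι ι ℂ) ∈ (gl p).part 0) :
    SuperRep.IsoAlong (conjMat g) (superPow p η 2) (superPow p η 2) :=
  ⟨congrEquiv η g hg, fun _ _ => congrEquiv_mem_part g hg, congrEquiv_act g hg⟩

end DegreeTwo

/-! ### Comparison of the modules -/

section Comparison

variable {ι : Type*} [Fintype ι] [DecidableEq ι]

theorem superPow_one_isoAlong (p : ι → ZMod 2) (η : ℂ) :
    SuperRep.IsoAlong id (superPow p η 1) (std p) := by
  have hc : ∀ f : Fin 1 → ι, (fun _ => f 0) = f := fun f => by
    funext k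
    rw [Subsingleton.elim k 0]
  refine ⟨
    { toFun := fun t a => (t : (Fin 1 → ι) → ℂ) fun _ => a
      map_add' := fun _ _ => rfl
      map_smul' := fun _ _ => rfl
      invFun := fun v => ⟨fun f => v (f 0), fun k l h f => by omega⟩
      left_inv := fun t => by ext f; simp [hc]
      right_inv := fun v => rfl }, ?_, ?_⟩
  · intro i v hv a ha
    exact hv (fun _ => a) (by simpa using ha)
  · intro X t
    funext a
    change ((superPow p η 1).act X t : (Fin 1 → ι) → ℂ) (fun _ => a) = _
    rw [superPow_act_apply]
    simp only [Fin.sum_univ_one, slotAct_apply, id]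
    refine Finset.sum_congr rfl fun c _ => ?_
    have h0 : preParity p 0 (fun _ : Fin 1 => a) = 0 := by simp [preParity]
    have hu : Function.update (fun _ : Fin 1 => a) 0 c = fun _ => c := by
      funext k
      rw [Subsingleton.elim k 0, Function.update_self]
    rw [h0, hu, mul_zero, sgn_zero, one_mul]
    rfl

variable {κ : Type*} [Fintype κ] [DecidableEq κ]

theorem std_shift_isoAlong {p : ι → ZMod 2} {q : κ → ZMod 2} (σ : κ ≃ ι)
    (hσ : ∀ a, p (σ a) = q a + 1) :
    SuperRep.IsoAlong (fun X => X.submatrix σ σ) (std p).shift (std q) := by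
  refine ⟨LinearEquiv.funCongrLeft ℂ ℂ σ, ?_, ?_⟩
  · intro i v hv a ha
    refine hv (σ a) ?_
    rw [hσ]
    exact fun h => ha (add_right_cancel h)
  · intro X v
    funext a
    change (X *ᵥ v) (σ a) = (X.submatrix σ σ *ᵥ (v ∘ σ)) a
    rw [Matrix.submatrix_mulVec_equiv]
    simp [Function.comp_assoc]

/-- Since `(x + 1)(y + 1) = xy + x + y + 1`, changing all parities multiplies the sign of the
transposition by `-(-1)^(x+y)`. Right multiplication by the sign matrix absorbs `(-1)^(x+y)` and
commutes with the left action; the remaining `-1` exchanges symmetric and exterior squares. -/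
theorem superPow_two_isoAlong_swap {p : ι → ZMod 2} {q : κ → ZMod 2} (σ : κ ≃ ι)
    (hσ : ∀ a, p (σ a) = q a + 1) {η η' : ℂ} (hη : η' = -η) :
    SuperRep.IsoAlong (fun X => X.submatrix σ σ) (superPow p η 2) (superPow q η' 2) := by
  have hflip : ∀ Y : Matrix ι ι ℂ, superFlip q η' ((Y * signMat p).submatrix σ σ) =
      (superFlip p η Y * signMat p).submatrix σ σ := by
    intro Y
    ext a b
    simp only [superFlip_apply, Matrix.submatrix_apply, signMat, Matrix.mul_diagonal, hη, hσ]
    have e : -(sgn (q a * q b) * sgn (q a + 1)) =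
        sgn ((q a + 1) * (q b + 1)) * sgn (q b + 1) := by
      rw [← sgn_add, ← sgn_add, ← neg_one_mul, ← sgn_one, ← sgn_add]
      congr 1
      generalize q a = x, q b = y
      revert x y
      decide
    linear_combination η * Y (σ b) (σ a) * e
  have hback : ∀ W : Matrix κ κ ℂ,
      ((W.submatrix σ.symm σ.symm * signMat p) * signMat p).submatrix σ σ = W := fun W => by
    rw [mul_assoc, signMat_mul_self, mul_one]
    simp
  have hback' : ∀ W : Matrix ι ι ℂ,
      ((W * signMat p).submatrix σ σ).submatrix σ.symm σ.symm * signMat p = W := fun W => by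
    simp [mul_assoc, signMat_mul_self]
  let E : symMat p η ≃ₗ[ℂ] symMat q η' :=
    { toFun := fun W => ⟨((W : Matrix ι ι ℂ) * signMat p).submatrix σ σ, by
        rw [mem_symMat, hflip, mem_symMat.1 W.2]⟩
      map_add' := fun W Z => by ext1; simp [add_mul]; rfl
      map_smul' := fun c W => by ext1; simp; rfl
      invFun := fun W => ⟨(W : Matrix κ κ ℂ).submatrix σ.symm σ.symm * signMat p, by
        rw [mem_symMat]
        have h := hflip ((W : Matrix κ κ ℂ).submatrix σ.symm σ.symm * signMat p)
        rw [hback, mem_symMat.1 W.2] at h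
        have h2 := congrArg (fun Z => Z.submatrix σ.symm σ.symm * signMat p) h
        simp only [hback'] at h2
        exact h2.symm⟩
      left_inv := fun W => Subtype.ext (hback' W)
      right_inv := fun W => Subtype.ext (hback W) }
  have hE : ∀ W : symMat p η, (E W : Matrix κ κ ℂ) =
      ((W : Matrix ι ι ℂ) * signMat p).submatrix σ σ := fun _ => rfl
  refine ⟨(tensorEquiv p η).trans (E.trans (tensorEquiv q η').symm), ?_, ?_⟩
  · intro i v hv
    rw [← tensorEquiv_mem_part] at hv ⊢
    rw [LinearEquiv.trans_apply, LinearEquiv.trans_apply, LinearEquiv.apply_symm_apply, hE]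
    intro a b hab
    refine mul_even_mem p hv (signMat_mem p) _ _ ?_
    rw [hσ, hσ, add_add_add_comm, zmod2_one_add_one, add_zero]
    exact hab
  · intro X t
    apply (tensorEquiv q η').injective
    apply Subtype.ext
    rw [tensorEquiv_act, LinearEquiv.trans_apply, LinearEquiv.trans_apply,
      LinearEquiv.apply_symm_apply, LinearEquiv.trans_apply, LinearEquiv.trans_apply,
      LinearEquiv.apply_symm_apply, hE, hE, tensorEquiv_act, Matrix.submatrix_mul_equiv, ← mul_assoc,
      hflip, add_mul, Matrix.submatrix_add]
    rfl

end Comparison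

section

/-! ### Spherical modules of degree two -/

section Matching

variable {ι : Type*} [Fintype ι] [DecidableEq ι]

theorem superPow_isSphericalFor_of_matching [Nontrivial ι] {p : ι → ZMod 2} {η : ℂ}
    (hη : η * η = 1) {pos : ι → ℕ} (hpos : Function.Injective pos) {κ : ι → ι}
    (hκ : ∀ a, κ (κ a) = a)
    (h : ∀ a b, pos a ≤ pos b → (a = b → η * sgn (p a) = 1) →
      pos a ≤ pos (κ b) ∧ p b + p (κ b) = 0 ∧ (κ b = b → η * sgn (p b) = 1)) :
    (superPow p η 2).IsSphericalFor (flagBorel pos) := by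
  obtain ⟨v, hv, hw⟩ := exists_spherical_of_matching hη hpos hκ h
  exact ⟨nontrivial_superSym_two hη, v, hv, hw⟩

theorem superPow_shift_isSphericalFor_of_matching [Nontrivial ι] {p : ι → ZMod 2} {η : ℂ}
    (hη : η * η = 1) {pos : ι → ℕ} (hpos : Function.Injective pos) {κ : ι → ι}
    (hκ : ∀ a, κ (κ a) = a)
    (h : ∀ a b, pos a ≤ pos b → (a = b → η * sgn (p a) = 1) →
      pos a ≤ pos (κ b) ∧ p b + p (κ b) = 1 ∧ (κ b = b → η * sgn (p b) = 1)) :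
    (superPow p η 2).shift.IsSphericalFor (flagBorel pos) := by
  obtain ⟨v, hv, hw⟩ := exists_spherical_of_matching hη hpos hκ h
  refine ⟨nontrivial_superSym_two hη, v, ?_, hw⟩
  change v ∈ (superPow p η 2).part (0 + 1)
  rwa [zero_add]

end Matching

instance nontrivial_sum {m n : ℕ} [NeZero m] [NeZero n] : Nontrivial (Fin m ⊕ Fin n) :=
  ⟨⟨Sum.inl 0, Sum.inr 0, Sum.inl_ne_inr⟩⟩

/-- The pairing of `n` elements from the end. -/
def pairFromEnd (n : ℕ) (j : Fin n) : Fin n :=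
  -- For odd `n` the first element has no partner; truncated subtraction leaves it fixed.
  if h : (n - j) % 2 = 1 then ⟨j - 1, by omega⟩ else ⟨j + 1, by omega⟩

theorem pairFromEnd_val (n : ℕ) (j : Fin n) :
    (pairFromEnd n j : ℕ) = if (n - j) % 2 = 1 then (j : ℕ) - 1 else j + 1 := by
  rw [pairFromEnd]
  split_ifs <;> rfl

theorem pairFromEnd_pairFromEnd (n : ℕ) (j : Fin n) : pairFromEnd n (pairFromEnd n j) = j := by
  ext
  have hj := j.2
  rw [pairFromEnd_val, pairFromEnd_val]
  split_ifs <;> omega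

theorem card_subtype_lt_of_strictMono {n x : ℕ} {f : Fin n → ℕ} (hf : StrictMono f) {k : Fin n}
    (h1 : x < f k) (h2 : ∀ j, j < k → f j ≤ x) : Nat.card {j : Fin n // x < f j} = n - k := by
  rw [Nat.card_eq_fintype_card, Fintype.card_subtype]
  have : (Finset.univ.filter fun j => x < f j) = Finset.Ici k := by
    ext j
    simp only [Finset.mem_filter, Finset.mem_univ, true_and, Finset.mem_Ici]
    refine ⟨fun h => ?_, fun h => h1.trans_le (hf.monotone h)⟩
    by_contra h'
    exact absurd h (not_lt.2 (h2 j (not_le.1 h')))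
  rw [this, Fin.card_Ici]

variable {m n : ℕ}

/-- Each `ε` is matched with itself, and the `δ`'s are paired consecutively from the right. Evenness
says that no `ε` stands between two partners. If `n` is odd, it also says that no `ε` precedes the
unpaired first `δ`, so no entry of a symmetric matrix has to be solved for there. -/
theorem symPow_two_isSphericalFor [NeZero m] [NeZero n] {pos : Fin m ⊕ Fin n → ℕ}
    (hpos : Function.Injective pos) (hδ : StrictMono fun j => pos (Sum.inr j))
    (h : ∀ i, Even (Nat.card {j : Fin n // pos (Sum.inl i) < pos (Sum.inr j)})) :
    (symPow (par m n) 2).IsSphericalFor (flagBorel pos) := by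
  have hκ : ∀ a : Fin m ⊕ Fin n, Sum.map id (pairFromEnd n) (Sum.map id (pairFromEnd n) a) = a := by
    rintro (i | j)
    · rfl
    · simp [pairFromEnd_pairFromEnd]
  refine superPow_isSphericalFor_of_matching (mul_one 1) hpos hκ ?_
  rintro a (i | j) hab hne
  · refine ⟨hab, by simp [par], fun _ => by simp [par, sgn_zero]⟩
  · have hle : pos a ≤ pos (Sum.inr (pairFromEnd n j)) ∧ pairFromEnd n j ≠ j := by
      have hv := pairFromEnd_val n j
      have hj := j.2
      by_cases hodd : (n - j) % 2 = 1
      · rw [if_pos hodd] at hv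
        rcases a with i | k
        · have hlt : pos (Sum.inl i) < pos (Sum.inr j) :=
            lt_of_le_of_ne hab fun e => Sum.inl_ne_inr (hpos e)
          -- If `j` were the first `δ` to the right of this `ε`, there would be `n - j` of them, an
          -- odd number.
          have hpre : ¬ ∀ j', j' < j → pos (Sum.inr j') ≤ pos (Sum.inl i) := fun h2 => by
            have := h i
            rw [card_subtype_lt_of_strictMono hδ hlt h2, Nat.even_iff] at this
            omega
          push Not at hpre
          obtain ⟨j', hj', hlt'⟩ := hpre
          rw [Fin.lt_def] at hj'
          refine ⟨hlt'.le.trans (hδ.monotone ?_), fun e => ?_⟩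
          · rw [Fin.le_def, hv]; omega
          · rw [e] at hv; omega
        · have hkj : k ≤ j := hδ.le_iff_le.1 hab
          have hk : k ≠ j := fun e => by
            have := hne (by rw [e])
            rw [one_mul, sgn_eq_one] at this
            exact absurd this (by simp [par])
          have hlt := lt_of_le_of_ne hkj hk
          rw [Fin.lt_def] at hlt
          refine ⟨hδ.monotone ?_, fun e => ?_⟩
          · rw [Fin.le_def, hv]; omega
          · rw [e] at hv; omega
      · rw [if_neg hodd] at hv
        refine ⟨hab.trans (hδ.monotone ?_), fun e => ?_⟩
        · rw [Fin.le_def, hv]; omega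
        · rw [e] at hv; omega
    refine ⟨hle.1, by simp [par, zmod2_one_add_one], fun e => absurd ?_ hle.2⟩
    simpa using e

/-- Each `ε` is matched with the `δ` next to it. Moving from a `δ` to its partner lowers the
position by one, which could only hurt at the diagonal, where odd indices give no entry. -/
theorem symPow_two_shift_isSphericalFor_eq [NeZero n] {pos : Fin n ⊕ Fin n → ℕ}
    (h : ∀ i : Fin n, pos (Sum.inl i) = 2 * i ∧ pos (Sum.inr i) = 2 * i + 1) :
    (symPow (par n n) 2).shift.IsSphericalFor (flagBorel pos) := by
  have hpos : Function.Injective pos := by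
    rintro (i | i) (j | j) e <;> simp only [h] at e
    · congr 1; ext; omega
    · omega
    · omega
    · congr 1; ext; omega
  refine superPow_shift_isSphericalFor_of_matching (mul_one 1) hpos Sum.swap_swap ?_
  rintro (i | i) (j | j) hab hne <;> simp only [h] at hab
  all_goals
    refine ⟨?_, by simp [par], fun e => by simp at e⟩
    simp only [Sum.swap_inl, Sum.swap_inr, h]
  · omega
  · omega
  · omega
  · have : i ≠ j := fun e => by
      have := hne (by rw [e])
      rw [one_mul, sgn_eq_one] at this
      exact absurd this (by simp [par])
    have : (i : ℕ) ≠ j := fun e => this (Fin.ext e)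
    omega

/-- The matching of the basis of `ℂ^{n|n+1}` which leaves the first odd vector fixed. -/
def matchSucc (n : ℕ) : Fin n ⊕ Fin (n + 1) → Fin n ⊕ Fin (n + 1) :=
  Sum.elim (fun i => Sum.inr i.succ) (Fin.cases (Sum.inr 0) fun i => Sum.inl i)

/-- The initial `δ` stays unmatched, so its row and column in the matrix vanish. Nothing precedes
it, and its own diagonal entry is zero by symmetry, so no entry is lost. -/
theorem symPow_two_shift_isSphericalFor_succ [NeZero n] {pos : Fin n ⊕ Fin (n + 1) → ℕ}
    (h1 : ∀ i : Fin n, pos (Sum.inl i) = 2 * i + 1)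
    (h2 : ∀ j : Fin (n + 1), pos (Sum.inr j) = 2 * j) :
    (symPow (par n (n + 1)) 2).shift.IsSphericalFor (flagBorel pos) := by
  have hpos : Function.Injective pos := by
    rintro (i | i) (j | j) e <;> simp only [h1, h2] at e
    · congr 1; ext; omega
    · omega
    · omega
    · congr 1; ext; omega
  have hκ : ∀ a, matchSucc n (matchSucc n a) = a := by
    rintro (i | j)
    · simp [matchSucc]
    · refine Fin.cases ?_ (fun i => ?_) j <;> simp [matchSucc]
  have hdiag : ∀ i j : Fin (n + 1), (Sum.inr i = (Sum.inr j : Fin n ⊕ Fin (n + 1)) →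
      1 * sgn (par n (n + 1) (Sum.inr i)) = 1) → i ≠ j := fun i j hne e => by
    have := hne (by rw [e])
    rw [one_mul, sgn_eq_one] at this
    exact absurd this (by simp [par])
  refine superPow_shift_isSphericalFor_of_matching (mul_one 1) hpos hκ ?_
  rintro a (j | j) hab hne
  · refine ⟨?_, by simp [par, matchSucc], fun e => by simp [matchSucc] at e⟩
    refine hab.trans ?_
    change _ ≤ pos (Sum.inr j.succ)
    rw [h1, h2, Fin.val_succ]
    omega
  · have hlt : pos a < pos (Sum.inr j) := by
      refine lt_of_le_of_ne hab fun e => ?_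
      have := hpos e
      subst this
      exact hdiag j j hne rfl
    induction j using Fin.cases with
    | zero => rw [h2] at hlt; simp at hlt
    | succ i =>
      refine ⟨?_, by simp [par, matchSucc], fun e => by simp [matchSucc] at e⟩
      change _ ≤ pos (Sum.inl i)
      rw [h2, Fin.val_succ] at hlt
      rw [h1]
      omega

theorem flagBorel_comp_mem {ι κ : Type*} [Fintype ι] [DecidableEq ι] [Fintype κ] [DecidableEq κ]
    (σ : κ ≃ ι) {pos : ι → ℕ} (X : Matrix ι ι ℂ) (hX : X ∈ flagBorel pos) :
    X.submatrix σ σ ∈ flagBorel (pos ∘ σ) := fun a b h => hX (σ a) (σ b) h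

theorem par_swap (m n : ℕ) (a : Fin m ⊕ Fin n) :
    par n m (Equiv.sumComm _ _ a) = par m n a + 1 := by
  rcases a with a | a <;> simp [par, zmod2_one_add_one]

theorem symPow_two_isoAlong_extPow_two (m n : ℕ) :
    SuperRep.IsoAlong (fun X => X.submatrix (Equiv.sumComm _ _) (Equiv.sumComm _ _))
      (symPow (par n m) 2) (extPow (par m n) 2) :=
  superPow_two_isoAlong_swap (Equiv.sumComm _ _) (par_swap m n) rfl

theorem extPow_two_isoAlong_symPow_two (m n : ℕ) :
    SuperRep.IsoAlong (fun X => X.submatrix (Equiv.sumComm _ _) (Equiv.sumComm _ _))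
      (extPow (par m n) 2) (symPow (par n m) 2) :=
  superPow_two_isoAlong_swap (Equiv.sumComm _ _) (par_swap n m) (by simp)

/-- In the string `δ⋯δε⋯ε` no `δ` follows any `ε`, so the evenness condition is trivial. -/
theorem exists_symPow_two_isSphericalFor [NeZero m] [NeZero n] :
    ∃ pos : Fin m ⊕ Fin n → ℕ, Function.Injective pos ∧
      (symPow (par m n) 2).IsSphericalFor (flagBorel pos) := by
  have hpos : Function.Injective
      (Sum.elim (fun i => n + i) (fun j => j) : Fin m ⊕ Fin n → ℕ) := by
    rintro (i | i) (j | j) e <;> simp only [Sum.elim_inl, Sum.elim_inr] at e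
    · congr 1; ext; omega
    · omega
    · omega
    · congr 1; ext; omega
  refine ⟨_, hpos, symPow_two_isSphericalFor hpos (fun i j h => h) fun i => ?_⟩
  have : IsEmpty {j : Fin n // Sum.elim (fun i : Fin m => n + (i : ℕ)) (fun j : Fin n => (j : ℕ))
      (Sum.inl i) < Sum.elim (fun i : Fin m => n + (i : ℕ)) (fun j : Fin n => (j : ℕ))
      (Sum.inr j)} := ⟨fun ⟨j, hj⟩ => by
    simp only [Sum.elim_inl, Sum.elim_inr] at hj
    omega⟩
  rw [Nat.card_of_isEmpty]
  exact Even.zero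

theorem exists_extPow_two_isSphericalFor [NeZero m] [NeZero n] :
    ∃ pos : Fin m ⊕ Fin n → ℕ, Function.Injective pos ∧
      (extPow (par m n) 2).IsSphericalFor (flagBorel pos) := by
  obtain ⟨pos, hpos, h⟩ := exists_symPow_two_isSphericalFor (m := n) (n := m)
  exact ⟨pos ∘ Equiv.sumComm _ _, hpos.comp (Equiv.injective _),
    (symPow_two_isoAlong_extPow_two m n).isSphericalFor (flagBorel_comp_mem _) h⟩

theorem exists_symPow_two_shift_isSphericalFor_eq [NeZero n] :
    ∃ pos : Fin n ⊕ Fin n → ℕ, Function.Injective pos ∧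
      (symPow (par n n) 2).shift.IsSphericalFor (flagBorel pos) := by
  have hpos : Function.Injective
      (Sum.elim (fun i => 2 * i) (fun j => 2 * j + 1) : Fin n ⊕ Fin n → ℕ) := by
    rintro (i | i) (j | j) e <;> simp only [Sum.elim_inl, Sum.elim_inr] at e
    · congr 1; ext; omega
    · omega
    · omega
    · congr 1; ext; omega
  exact ⟨_, hpos, symPow_two_shift_isSphericalFor_eq fun i => ⟨rfl, rfl⟩⟩

theorem exists_extPow_two_shift_isSphericalFor [NeZero n] :
    ∃ pos : Fin n ⊕ Fin n → ℕ, Function.Injective pos ∧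
      (extPow (par n n) 2).shift.IsSphericalFor (flagBorel pos) := by
  obtain ⟨pos, hpos, h⟩ := exists_symPow_two_shift_isSphericalFor_eq (n := n)
  exact ⟨pos ∘ Equiv.sumComm _ _, hpos.comp (Equiv.injective _),
    (symPow_two_isoAlong_extPow_two n n).shift.isSphericalFor (flagBorel_comp_mem _) h⟩

theorem exists_symPow_two_shift_isSphericalFor_succ [NeZero n] :
    ∃ pos : Fin n ⊕ Fin (n + 1) → ℕ, Function.Injective pos ∧
      (symPow (par n (n + 1)) 2).shift.IsSphericalFor (flagBorel pos) := by
  have hpos : Function.Injective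
      (Sum.elim (fun i => 2 * i + 1) (fun j => 2 * j) : Fin n ⊕ Fin (n + 1) → ℕ) := by
    rintro (i | i) (j | j) e <;> simp only [Sum.elim_inl, Sum.elim_inr] at e
    · congr 1; ext; omega
    · omega
    · omega
    · congr 1; ext; omega
  exact ⟨_, hpos, symPow_two_shift_isSphericalFor_succ (fun i => rfl) fun j => rfl⟩

theorem EDString.borel_eq_flagBorel_nat (s : EDString m n) :
    s.borel = flagBorel fun a => (s.pos a : ℕ) := rfl

theorem EDString.symPow_two_isSphericalFor [NeZero m] [NeZero n] (s : EDString m n)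
    (h : s.EvenDeltas) : (symPow (par m n) 2).IsSphericalFor s.borel := by
  rw [s.borel_eq_flagBorel_nat]
  exact SuperSph.symPow_two_isSphericalFor s.pos_nat_injective s.strictMono_delta h

end

section

/-! ### Dimensions of the homogeneous parts of the super symmetric powers -/

section Dimension

variable {ι : Type*} [Fintype ι] [DecidableEq ι]

/-- The contribution of a pair of indices to the sign of a rearrangement. -/
def inversionParity (p : ι → ZMod 2) (e : ZMod 2) (a b : ι) : ZMod 2 :=
  if Fintype.equivFin ι b < Fintype.equivFin ι a then e + p a * p b else 0

/-- The exponent of the sign of a rearrangement. -/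
def inversionSum (p : ι → ZMod 2) (e : ZMod 2) {d : ℕ} (f : Fin d → ι) : ZMod 2 :=
  ∑ x, ∑ y, if x < y then inversionParity p e (f x) (f y) else 0

/-- Exchanging neighbouring positions reverses the order of that one pair only. The identity
compares, for each ordered pair of positions, how often it is counted on the two sides. -/
theorem inversionSum_swap (p : ι → ZMod 2) (e : ZMod 2) {d : ℕ} {k l : Fin d}
    (h : (k : ℕ) + 1 = l) (f : Fin d → ι) :
    inversionSum p e (f ∘ Equiv.swap k l) + inversionParity p e (f k) (f l) =
      inversionSum p e f + inversionParity p e (f l) (f k) := by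
  have h1 : inversionSum p e (f ∘ Equiv.swap k l) = ∑ x, ∑ y,
      if Equiv.swap k l x < Equiv.swap k l y then inversionParity p e (f x) (f y) else 0 := by
    rw [inversionSum, ← Equiv.sum_comp (Equiv.swap k l)]
    refine Finset.sum_congr rfl fun x _ => ?_
    rw [← Equiv.sum_comp (Equiv.swap k l)]
    simp
  have h2 : ∀ u v : Fin d, inversionParity p e (f u) (f v) = ∑ x, ∑ y,
      if x = u ∧ y = v then inversionParity p e (f x) (f y) else 0 := fun u v => by
    rw [Finset.sum_eq_single u, Finset.sum_eq_single v]
    · simp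
    · intro y _ hy; rw [if_neg fun h => hy h.2]
    · simp
    · intro x _ hx
      exact Finset.sum_eq_zero fun y _ => if_neg fun h => hx h.1
    · simp
  rw [h1, h2 k l, h2 l k, inversionSum, ← Finset.sum_add_distrib, ← Finset.sum_add_distrib]
  refine Finset.sum_congr rfl fun x _ => ?_
  rw [← Finset.sum_add_distrib, ← Finset.sum_add_distrib]
  refine Finset.sum_congr rfl fun y _ => ?_
  have key : (if Equiv.swap k l x < Equiv.swap k l y then (1 : ℕ) else 0) +
      (if x = k ∧ y = l then 1 else 0) = (if x < y then 1 else 0) +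
        if x = l ∧ y = k then 1 else 0 := by
    simp only [Equiv.swap_apply_def, Fin.lt_def, Fin.ext_iff]
    split_ifs <;> omega
  generalize inversionParity p e (f x) (f y) = z
  have e1 : ∀ (P : Prop) [Decidable P], (if P then z else 0) = (if P then (1 : ℕ) else 0) • z :=
    fun P _ => by split_ifs <;> simp
  rw [e1, e1 (x = k ∧ y = l), e1 (x < y), e1 (x = l ∧ y = k), ← add_smul, ← add_smul, key]

theorem inversionParity_add {p : ι → ZMod 2} {e : ZMod 2} {a b : ι} (h : a ≠ b) :
    inversionParity p e a b + inversionParity p e b a = e + p a * p b := by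
  have h' : Fintype.equivFin ι a ≠ Fintype.equivFin ι b :=
    fun e => h ((Fintype.equivFin ι).injective e)
  rw [inversionParity, inversionParity]
  rcases lt_or_gt_of_ne h' with h2 | h2
  · rw [if_pos h2, if_neg h2.not_gt, zero_add, mul_comm]
  · rw [if_pos h2, if_neg h2.not_gt, add_zero]

/-- Multisets of `d` indices, among which `k ∈ K` distinct ones of parity `e + 1`. -/
def MonomialIndex (p : ι → ZMod 2) (e : ZMod 2) (d : ℕ) (K : Finset ℕ) : Type _ :=
  Σ k : K, Sym {a // p a = e} (d - k) ×
    {B // B ∈ Finset.powersetCard k (Finset.univ : Finset {a // p a = e + 1})}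

instance (p : ι → ZMod 2) (e : ZMod 2) (d : ℕ) (K : Finset ℕ) :
    Fintype (MonomialIndex p e d K) := by
  unfold MonomialIndex
  infer_instance

theorem card_monomialIndex (p : ι → ZMod 2) (e : ZMod 2) (d : ℕ) (K : Finset ℕ) :
    Fintype.card (MonomialIndex p e d K) =
      ∑ k ∈ K, Nat.multichoose (Fintype.card {a // p a = e}) (d - k) *
        Nat.choose (Fintype.card {a // p a = e + 1}) k := by
  unfold MonomialIndex
  rw [Fintype.card_sigma, ← Finset.sum_coe_sort K]
  refine Finset.sum_congr rfl fun k _ => ?_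
  rw [Fintype.card_prod, Sym.card_sym_eq_multichoose, Fintype.card_coe, Finset.card_powersetCard,
    Finset.card_univ]

variable {p : ι → ZMod 2} {e : ZMod 2} {d : ℕ} {K : Finset ℕ}

/-- The underlying multiset of a monomial. -/
def MonomialIndex.toMultiset (x : MonomialIndex p e d K) : Multiset ι :=
  (x.2.1 : Multiset {a // p a = e}).map Subtype.val + x.2.2.1.val.map Subtype.val

namespace MonomialIndex

theorem filter_ne (x : MonomialIndex p e d K) :
    x.toMultiset.filter (fun a => p a = e + 1) = x.2.2.1.val.map Subtype.val := by
  rw [toMultiset, Multiset.filter_add, Multiset.filter_eq_nil.2, zero_add,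
    Multiset.filter_eq_self.2]
  · intro a ha
    obtain ⟨b, -, rfl⟩ := Multiset.mem_map.1 ha
    exact b.2
  · intro a ha h
    obtain ⟨b, -, rfl⟩ := Multiset.mem_map.1 ha
    rw [b.2] at h
    exact absurd h (by generalize e = x; revert x; decide)

theorem filter_eq (x : MonomialIndex p e d K) :
    x.toMultiset.filter (fun a => p a = e) =
      (x.2.1 : Multiset {a // p a = e}).map Subtype.val := by
  rw [toMultiset, Multiset.filter_add, Multiset.filter_eq_self.2, Multiset.filter_eq_nil.2,
    add_zero]
  · intro a ha h
    obtain ⟨b, -, rfl⟩ := Multiset.mem_map.1 ha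
    rw [b.2] at h
    exact absurd h (by generalize e = x; revert x; decide)
  · intro a ha
    obtain ⟨b, -, rfl⟩ := Multiset.mem_map.1 ha
    exact b.2

theorem card_snd (x : MonomialIndex p e d K) : x.2.2.1.card = x.1 :=
  (Finset.mem_powersetCard.1 x.2.2.2).2

/-- Filtering the multiset by parity recovers both components of the index. -/
theorem toMultiset_injective :
    Function.Injective (toMultiset : MonomialIndex p e d K → Multiset ι) := by
  intro x y h
  have h1 := x.filter_ne
  rw [h, y.filter_ne] at h1
  have h2 := x.filter_eq
  rw [h, y.filter_eq] at h2
  have h3 := Finset.val_injective (Multiset.map_injective Subtype.val_injective h1)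
  have h4 := Multiset.map_injective Subtype.val_injective h2
  have h5 : x.1 = y.1 := Subtype.ext (by rw [← x.card_snd, ← y.card_snd, h3])
  obtain ⟨k, A, B⟩ := x
  obtain ⟨k', A', B'⟩ := y
  obtain rfl : k = k' := h5
  obtain rfl : A = A' := Sym.coe_injective h4.symm
  obtain rfl : B = B' := Subtype.ext h3.symm
  rfl

theorem exists_map_eq (hK : ∀ k ∈ K, k ≤ d) (x : MonomialIndex p e d K) :
    ∃ f : Fin d → ι, (Finset.univ : Finset (Fin d)).val.map f = x.toMultiset := by
  have hc : x.toMultiset.toList.length = d := by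
    have h := hK x.1 x.1.2
    have h2 := x.card_snd
    have h3 : Multiset.card (x.2.1 : Multiset {a // p a = e}) = d - x.1 := x.2.1.2
    rw [Multiset.length_toList, toMultiset, Multiset.card_add, Multiset.card_map,
      Multiset.card_map, h3, Finset.card_val, h2]
    omega
  refine ⟨fun k => x.toMultiset.toList.get (Fin.cast hc.symm k), ?_⟩
  rw [Fin.univ_val_map]
  conv_rhs => rw [← Multiset.coe_toList x.toMultiset]
  congr 1
  apply List.ext_get
  · simp [hc]
  · intro k h1 h2
    simp

theorem sum_parity (x : MonomialIndex p e d K) :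
    (x.toMultiset.map p).sum = ((d - x.1 : ℕ) : ZMod 2) * e + ((x.1 : ℕ) : ZMod 2) * (e + 1) := by
  have h3 : Multiset.card (x.2.1 : Multiset {a // p a = e}) = d - x.1 := x.2.1.2
  rw [toMultiset, Multiset.map_add, Multiset.sum_add, Multiset.map_map, Multiset.map_map]
  congr 1
  · rw [Multiset.map_congr rfl (g := fun _ => e) fun a _ => a.2, Multiset.map_const',
      Multiset.sum_replicate, h3, nsmul_eq_mul]
  · rw [Multiset.map_congr rfl (g := fun _ => e + 1) fun a _ => a.2, Multiset.map_const',
      Multiset.sum_replicate, Finset.card_val, x.card_snd, nsmul_eq_mul]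

/-- Indices of parity `e + 1` occur at most once in a monomial. So a repeated index has parity `e`,
which is exactly when the transposition of two equal factors is compatible with the eigenvalue `sgn
e`. -/
theorem eq_of_map_eq {x : MonomialIndex p e d K} {f : Fin d → ι}
    (h : (Finset.univ : Finset (Fin d)).val.map f = x.toMultiset) {k l : Fin d}
    (hkl : k ≠ l) (hf : f k = f l) : p (f k) = e := by
  by_contra hne
  have h0 : p (f k) = e + 1 := by
    revert hne
    generalize p (f k) = y, e = x
    revert y x
    decide
  have h1 := x.filter_ne
  rw [← h, Multiset.filter_map] at h1
  have h2 : (Multiset.map f (Multiset.filter ((fun a => p a = e + 1) ∘ f)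
      (Finset.univ : Finset (Fin d)).val)).Nodup := by
    rw [h1]
    exact Multiset.Nodup.map Subtype.val_injective x.2.2.1.nodup
  refine hkl (Multiset.inj_on_of_nodup_map h2 k ?_ l ?_ hf)
  · simpa using h0
  · simpa [← hf] using h0

end MonomialIndex

theorem map_comp_swap (f : Fin d → ι) (k l : Fin d) :
    (Finset.univ : Finset (Fin d)).val.map (f ∘ Equiv.swap k l) =
      (Finset.univ : Finset (Fin d)).val.map f := by
  rw [← Multiset.map_map, Multiset.map_univ_val_equiv]

/-- The tensor with given coefficients at the monomials. -/
def monomialTensor (p : ι → ZMod 2) (e : ZMod 2) (d : ℕ) (K : Finset ℕ) :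
    (MonomialIndex p e d K → ℂ) →ₗ[ℂ] superSym p (sgn e) d where
  -- Up to the sign of the rearrangement, the coefficient depends only on the multiset of indices;
  -- multisets outside the chosen family get `0`.
  toFun c := ⟨fun f => sgn (inversionSum p e f) *
      Function.extend MonomialIndex.toMultiset c 0 ((Finset.univ : Finset (Fin d)).val.map f), by
    intro k l hkl f
    have hne : k ≠ l := fun h => by rw [h] at hkl; omega
    simp only [map_comp_swap]
    by_cases hx : ∃ x : MonomialIndex p e d K,
        x.toMultiset = (Finset.univ : Finset (Fin d)).val.map f
    · obtain ⟨x, hx⟩ := hx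
      have hs := inversionSum_swap p e hkl f
      -- For equal indices the swap changes nothing and its sign is `+1`. For different indices
      -- exactly one of the two orders is an inversion, so the exponent changes by `e + p a * p b`.
      by_cases hf : f k = f l
      · have h1 := x.eq_of_map_eq hx.symm hne hf
        rw [hf] at hs h1
        rw [add_right_cancel hs, hf, h1, zmod2_mul_self, ← mul_assoc, sgn_mul_self, one_mul]
      · have h1 := inversionParity_add (p := p) (e := e) hf
        have h2 : inversionSum p e (f ∘ Equiv.swap k l) =
            e + p (f k) * p (f l) + inversionSum p e f := by
          have h3 := zmod2_add_self (inversionParity p e (f k) (f l))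
          linear_combination hs + h1 - h3
        rw [h2, sgn_add, sgn_add]
        ring
    · rw [Function.extend_apply' _ _ _ hx]
      simp⟩
  map_add' c c' := by
    ext f
    have := Function.extend_add (MonomialIndex.toMultiset : MonomialIndex p e d K → _) c c' 0 0
    rw [add_zero] at this
    simp [this, mul_add]
  map_smul' z c := by
    ext f
    have := Function.extend_smul z (MonomialIndex.toMultiset : MonomialIndex p e d K → _) c 0
    rw [smul_zero] at this
    simp [this]
    ring

theorem monomialTensor_apply (c : MonomialIndex p e d K → ℂ) (f : Fin d → ι) :
    (monomialTensor p e d K c : (Fin d → ι) → ℂ) f = sgn (inversionSum p e f) *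
      Function.extend MonomialIndex.toMultiset c 0 ((Finset.univ : Finset (Fin d)).val.map f) := rfl

theorem monomialTensor_mem {i : ZMod 2}
    (hK : ∀ k ∈ K, ((d - k : ℕ) : ZMod 2) * e + (k : ZMod 2) * (e + 1) = i)
    (c : MonomialIndex p e d K → ℂ) : monomialTensor p e d K c ∈ (superPow p (sgn e) d).part i := by
  rw [mem_superPow_part]
  intro f hf
  rw [monomialTensor_apply, Function.extend_apply', Pi.zero_apply, mul_zero]
  rintro ⟨x, hx⟩
  apply hf
  rw [← hK x.1 x.1.2, ← x.sum_parity, hx, Multiset.map_map]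
  rfl

theorem monomialTensor_injective (hK : ∀ k ∈ K, k ≤ d) :
    Function.Injective (monomialTensor p e d K) := by
  rw [injective_iff_map_eq_zero]
  intro c hc
  funext x
  obtain ⟨f, hf⟩ := x.exists_map_eq hK
  have h := monomialTensor_apply c f
  rw [hc, hf, MonomialIndex.toMultiset_injective.extend_apply] at h
  exact (mul_eq_zero.1 h.symm).resolve_left (sgn_ne_zero _)

/-- A lower bound suffices for excluding modules, so `K` may list only some of the possible numbers
`k` of factors of parity `e + 1`. The condition on `K` says that such monomials have total parity
`i`. -/
theorem le_finrank_superPow_part (p : ι → ZMod 2) (e : ZMod 2) {η : ℂ} (hη : η = sgn e) (d : ℕ)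
    (i : ZMod 2) (K : Finset ℕ)
    (hK : ∀ k ∈ K, k ≤ d ∧ ((d - k : ℕ) : ZMod 2) * e + (k : ZMod 2) * (e + 1) = i) :
    ∑ k ∈ K, Nat.multichoose (Fintype.card {a // p a = e}) (d - k) *
        Nat.choose (Fintype.card {a // p a = e + 1}) k ≤
      Module.finrank ℂ ((superPow p η d).part i) := by
  subst hη
  rw [← card_monomialIndex, ← Module.finrank_fintype_fun_eq_card ℂ]
  refine LinearMap.finrank_le_finrank_of_injective
    (f := (monomialTensor p e d K).codRestrict _ (monomialTensor_mem fun k hk => (hK k hk).2)) ?_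
  exact fun c c' h => monomialTensor_injective (fun k hk => (hK k hk).1) (congrArg Subtype.val h)

end Dimension

end

section

/-! ### Restriction to the final segments of a string -/

section Segment

variable {ι : Type*} [Fintype ι] [DecidableEq ι] {α : Type*} [LinearOrder α]

theorem superFlip_submatrix {κ : Type*} [Fintype κ] [DecidableEq κ] (p : ι → ZMod 2) (η : ℂ)
    (Y : Matrix ι ι ℂ) (g : κ → ι) :
    superFlip (fun a => p (g a)) η (Y.submatrix g g) = (superFlip p η Y).submatrix g g := rfl

/-- A row of `X` in the final segment has no entries in earlier columns, so the sum over the middle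
index stays in the segment. -/
theorem mul_submatrix_segment {pos : ι → α} {r : α} {X M : Matrix ι ι ℂ}
    (hX : X ∈ flagBorel pos) :
    (X * M).submatrix (Subtype.val : {x // r ≤ pos x} → ι) Subtype.val =
      X.submatrix (Subtype.val : {x // r ≤ pos x} → ι) (Subtype.val : {x // r ≤ pos x} → ι) *
        M.submatrix Subtype.val Subtype.val := by
  ext a b
  simp only [Matrix.submatrix_apply, Matrix.mul_apply]
  rw [← Fintype.sum_subtype_add_sum_subtype (fun x => r ≤ pos x), add_eq_left]
  refine Finset.sum_eq_zero fun c _ => ?_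
  rw [hX a.1 c.1 ((not_le.1 c.2).trans_le a.2), zero_mul]

/-- A target on the segment is extended by zero, solved for on the whole string, and the solution is
cut down to the segment. -/
theorem MatSpherical.segment {p : ι → ZMod 2} {η : ℂ} {pos : ι → α} {M : Matrix ι ι ℂ}
    (h : MatSpherical p η pos M) (r : α) :
    MatSpherical (fun a : {x // r ≤ pos x} => p a) η (fun a => pos a)
      (M.submatrix Subtype.val Subtype.val) := by
  intro W hW
  set W' : Matrix ι ι ℂ := Matrix.of fun a b =>
    if h : r ≤ pos a ∧ r ≤ pos b then W ⟨a, h.1⟩ ⟨b, h.2⟩ else 0 with hW'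
  have hm : W' ∈ symMat p η := by
    rw [mem_symMat'] at hW ⊢
    intro a b
    simp only [hW', Matrix.of_apply]
    by_cases hab : r ≤ pos a ∧ r ≤ pos b
    · rw [dif_pos hab, dif_pos hab.symm]
      exact hW ⟨a, hab.1⟩ ⟨b, hab.2⟩
    · rw [dif_neg hab, dif_neg fun h => hab h.symm]
      simp
  have hsub : W'.submatrix Subtype.val Subtype.val = W := by
    ext a b
    simp only [hW', Matrix.submatrix_apply, Matrix.of_apply]
    exact dif_pos ⟨a.2, b.2⟩
  obtain ⟨X, hX, e⟩ := h W' hm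
  refine ⟨X.submatrix Subtype.val Subtype.val, fun a b hab => hX a b hab, ?_⟩
  rw [← mul_submatrix_segment hX, superFlip_submatrix, ← hsub, ← e]
  rfl

theorem exists_segment {p : ι → ZMod 2} {η : ℂ} {pos : ι → α} {i : ZMod 2} {v : superSym p η 2}
    (hv : v ∈ (superPow p η 2).part i)
    (hs : ∀ w : superSym p η 2, ∃ x ∈ flagBorel pos, ∃ c : ℂ,
      (superPow p η 2).act x v + c • v = w) (r : α) :
    ∃ u : superSym (fun a : {x // r ≤ pos x} => p a) η 2,
      (tensorEquiv _ η u : Matrix {x // r ≤ pos x} {x // r ≤ pos x} ℂ) =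
        (tensorEquiv p η v : Matrix ι ι ℂ).submatrix Subtype.val Subtype.val ∧
      u ∈ (superPow (fun a : {x // r ≤ pos x} => p a) η 2).part i ∧
      ∀ w, ∃ x ∈ flagBorel (fun a : {x // r ≤ pos x} => pos a), ∃ c : ℂ,
        (superPow (fun a : {x // r ≤ pos x} => p a) η 2).act x u + c • u = w := by
  have hmem : (tensorEquiv p η v : Matrix ι ι ℂ).submatrix Subtype.val Subtype.val ∈
      symMat (fun a : {x // r ≤ pos x} => p a) η :=
    mem_symMat'.2 fun a b => mem_symMat'.1 (tensorEquiv p η v).2 a b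
  refine ⟨(tensorEquiv _ η).symm ⟨_, hmem⟩, ?_, ?_, ?_⟩
  · rw [LinearEquiv.apply_symm_apply]
  · rw [← tensorEquiv_mem_part, LinearEquiv.apply_symm_apply]
    exact fun a b hab => tensorEquiv_mem_part.2 hv a.1 b.1 hab
  · rw [matSpherical_iff, LinearEquiv.apply_symm_apply]
    exact (matSpherical_iff.1 hs).segment r

theorem finrank_superSym_part_zero (p : ι → ZMod 2) :
    Nat.multichoose (Fintype.card {a // p a = 0}) 2 + Nat.choose (Fintype.card {a // p a = 1}) 2 ≤
      Module.finrank ℂ ((superPow p 1 2).part 0) := by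
  have h := le_finrank_superPow_part p 0 sgn_zero.symm 2 0 {0, 2} (by decide)
  simpa using h

theorem finrank_superSym_part_one (p : ι → ZMod 2) :
    Fintype.card {a // p a = 0} * Fintype.card {a // p a = 1} ≤
      Module.finrank ℂ ((superPow p 1 2).part 1) := by
  have h := le_finrank_superPow_part p 0 sgn_zero.symm 2 1 {1} (by decide)
  simpa using h

/-- Doubling turns the hypothesis into `(l - k)² ≤ l - k`, which holds for integers only if `l - k`
is `0` or `1`. -/
theorem le_of_multichoose_le {k l : ℕ} (h : Nat.multichoose k 2 + Nat.choose l 2 ≤ k * l) :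
    k ≤ l ∧ l ≤ k + 1 := by
  have h1 : 2 * Nat.multichoose k 2 = k * (k + 1) := by
    rw [Nat.multichoose_eq, Nat.choose_two_right]
    have := Nat.even_mul_pred_self (k + 1)
    have e : k + 2 - 1 = k + 1 := rfl
    rw [e, Nat.mul_div_cancel' this.two_dvd, Nat.add_sub_cancel, mul_comm]
  have h2 : 2 * Nat.choose l 2 + l = l * l := by
    rw [Nat.choose_two_right, Nat.mul_div_cancel' (Nat.even_mul_pred_self l).two_dvd]
    rcases l with _ | l
    · rfl
    · simp only [Nat.add_sub_cancel]; ring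
  constructor
  · by_contra hlt
    push Not at hlt
    nlinarith
  · by_contra hlt
    push Not at hlt
    nlinarith

/-- After the parity shift, the odd part of the module is the even part of `S²`; on every final
segment its dimension is at most the product of the two numbers of letters. -/
theorem segment_shift_card {p : ι → ZMod 2} {pos : ι → α} (hpos : Function.Injective pos)
    (h : (superPow p 1 2).shift.IsSphericalFor (flagBorel pos)) (r : α) :
    Fintype.card {a : {x // r ≤ pos x} // p a = 0} ≤
        Fintype.card {a : {x // r ≤ pos x} // p a = 1} ∧
      Fintype.card {a : {x // r ≤ pos x} // p a = 1} ≤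
        Fintype.card {a : {x // r ≤ pos x} // p a = 0} + 1 := by
  obtain ⟨-, v, hv, hs⟩ := h
  have hv' : v ∈ (superPow p 1 2).part 1 := by
    rw [← zero_add (1 : ZMod 2)]
    exact hv
  obtain ⟨u, -, hu, hw⟩ := exists_segment hv' hs r
  have hsph : (superPow (fun a : {x // r ≤ pos x} => p a) 1 2).shift.IsSphericalVector
      (flagBorel fun a : {x // r ≤ pos x} => pos a) u := by
    refine ⟨?_, hw⟩
    change u ∈ (superPow _ 1 2).part (0 + 1)
    rwa [zero_add]
  have h1 := hsph.finrank_odd_le (flagBorel_isGraded _)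
  rw [finrank_flagBorel_odd (pos := fun a : {x // r ≤ pos x} => pos a)
    (hpos.comp Subtype.val_injective)] at h1
  refine le_of_multichoose_le (le_trans (finrank_superSym_part_zero _) ?_)
  exact h1

theorem det_eq_zero_of_skew_odd {κ : Type*} [Fintype κ] [DecidableEq κ] {D : Matrix κ κ ℂ}
    (h : Dᵀ = -D) (hodd : Odd (Fintype.card κ)) : D.det = 0 := by
  have h1 := Matrix.det_transpose D
  rw [h, Matrix.det_neg, hodd.neg_one_pow, neg_one_mul] at h1
  exact self_eq_neg.1 h1.symm

/-- If the number of `δ`'s were odd, the skew `δ`-`δ` block of `M` would have a left null vector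
`u`. The matrix with `u` in row `z` and zeros elsewhere is odd, upper triangular because `z` comes
first, and annihilates `M` because `M` is even. But `𝔟₁ → V₁` is injective here, both dimensions
being equal. -/
theorem even_card_of_first {p : ι → ZMod 2} {pos : ι → α} (hpos : Function.Injective pos)
    {v : superSym p 1 2} (hsph : (superPow p 1 2).IsSphericalVector (flagBorel pos) v) {z : ι}
    (hz : p z = 0) (hfirst : ∀ x, pos z ≤ pos x) : Even (Fintype.card {x // p x = 1}) := by
  by_contra hodd
  rw [Nat.not_even_iff_odd] at hodd
  obtain ⟨M, hM⟩ : ∃ M : Matrix ι ι ℂ, M = tensorEquiv p 1 v := ⟨_, rfl⟩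
  have hMp : M ∈ (gl p).part 0 := hM ▸ tensorEquiv_mem_part.2 hsph.1
  have hMs : ∀ a b, M b a = 1 * (sgn (p a * p b) * M a b) :=
    hM ▸ mem_symMat'.1 (tensorEquiv p 1 v).2
  obtain ⟨u, hu0, hu⟩ := Matrix.exists_vecMul_eq_zero_iff.2 (det_eq_zero_of_skew_odd
    (D := M.submatrix (Subtype.val : {x // p x = 1} → ι) Subtype.val) (by
      ext a b
      rw [Matrix.transpose_apply, Matrix.neg_apply, Matrix.submatrix_apply, Matrix.submatrix_apply,
        hMs, a.2, b.2, mul_one, sgn_one]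
      ring) hodd)
  set X : Matrix ι ι ℂ := Matrix.of fun a c => if h : a = z ∧ p c = 1 then u ⟨c, h.2⟩ else 0 with hX
  have hXz : ∀ c : {x // p x = 1}, X z c = u c := fun c =>
    dif_pos (⟨rfl, c.2⟩ : z = z ∧ p c = 1)
  have hX0 : ∀ a c, ¬ (a = z ∧ p c = 1) → X a c = 0 := fun a c h => by
    simp only [hX, Matrix.of_apply]
    exact dif_neg h
  have hXM : X * M = 0 := by
    ext a b
    rw [Matrix.mul_apply, Matrix.zero_apply, ← Fintype.sum_subtype_add_sum_subtype
      (fun x => p x = 1), Finset.sum_eq_zero (s := (Finset.univ : Finset {x // ¬ p x = 1}))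
      fun c _ => by rw [hX0 a c fun h => c.2 h.2, zero_mul], add_zero]
    by_cases ha : a = z
    · subst ha
      rcases zmod2_cases (p b) with hb | hb
      · refine Finset.sum_eq_zero fun c _ => ?_
        rw [hMp c b (by rw [c.2, hb]; decide), mul_zero]
      · have h := congrFun hu ⟨b, hb⟩
        simp only [hXz]
        exact h
    · exact Finset.sum_eq_zero fun c _ => by rw [hX0 a c fun h => ha h.1, zero_mul]
  have hXmem : X ∈ flagBorel pos ⊓ (gl p).part 1 := by
    refine ⟨fun a c hac => hX0 a c ?_, fun a c hac => hX0 a c ?_⟩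
    · rintro ⟨rfl, -⟩
      exact absurd hac (not_lt.2 (hfirst c))
    · rintro ⟨rfl, h1⟩
      exact hac (by rw [hz, h1, zero_add])
  have hXv : (superPow p 1 2).act X v = 0 := by
    apply (tensorEquiv p 1).injective
    apply Subtype.ext
    rw [tensorEquiv_act, ← hM, hXM]
    simp
  have h0 := hsph.eq_zero_of_odd (flagBorel_isGraded _)
    ((finrank_flagBorel_odd hpos).trans_le (finrank_superSym_part_one p)) hXmem hXv
  apply hu0
  funext c
  rw [← hXz, h0]
  rfl

theorem segment_even_card {p : ι → ZMod 2} {pos : ι → α} (hpos : Function.Injective pos)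
    (h : (superPow p 1 2).IsSphericalFor (flagBorel pos)) {z : ι} (hz : p z = 0) :
    Even (Fintype.card {a : {x // pos z ≤ pos x} // p a = 1}) := by
  obtain ⟨-, v, hv, hs⟩ := h
  obtain ⟨u, -, hu, hw⟩ := exists_segment hv hs (pos z)
  exact even_card_of_first (pos := fun a : {x // pos z ≤ pos x} => pos a)
    (p := fun a : {x // pos z ≤ pos x} => p a)
    (hpos.comp Subtype.val_injective) ⟨hu, hw⟩ (z := ⟨z, le_rfl⟩) hz fun x => x.2

end Segment

/-! ### The strings of the spherical modules of degree two -/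

variable {m n : ℕ}

/-- The even basis vectors in a final segment. -/
def segmentEvenEquiv (m n : ℕ) (P : Fin m ⊕ Fin n → Prop) :
    {a : {x // P x} // par m n a = 0} ≃ {i : Fin m // P (Sum.inl i)} where
  toFun a := match a with
    | ⟨⟨Sum.inl i, h⟩, _⟩ => ⟨i, h⟩
    | ⟨⟨Sum.inr _, _⟩, h⟩ => absurd h (by simp [par])
  invFun i := ⟨⟨Sum.inl i.1, i.2⟩, rfl⟩
  left_inv a := match a with
    | ⟨⟨Sum.inl i, h⟩, _⟩ => rfl
    | ⟨⟨Sum.inr _, _⟩, h⟩ => absurd h (by simp [par])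
  right_inv _ := rfl

/-- The odd basis vectors in a final segment. -/
def segmentOddEquiv (m n : ℕ) (P : Fin m ⊕ Fin n → Prop) :
    {a : {x // P x} // par m n a = 1} ≃ {j : Fin n // P (Sum.inr j)} where
  toFun a := match a with
    | ⟨⟨Sum.inr i, h⟩, _⟩ => ⟨i, h⟩
    | ⟨⟨Sum.inl _, _⟩, h⟩ => absurd h (by simp [par])
  invFun i := ⟨⟨Sum.inr i.1, i.2⟩, rfl⟩
  left_inv a := match a with
    | ⟨⟨Sum.inr i, h⟩, _⟩ => rfl
    | ⟨⟨Sum.inl _, _⟩, h⟩ => absurd h (by simp [par])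
  right_inv _ := rfl

theorem EDString.symPow_two_isSphericalFor_iff [NeZero m] [NeZero n] (s : EDString m n) :
    (symPow (par m n) 2).IsSphericalFor s.borel ↔ s.EvenDeltas := by
  refine ⟨fun h i => ?_, s.symPow_two_isSphericalFor⟩
  have h1 := segment_even_card (pos := s.pos) s.pos.injective h (z := Sum.inl i) rfl
  rw [Fintype.card_congr (segmentOddEquiv m n fun x => s.pos (Sum.inl i) ≤ s.pos x)] at h1
  rw [Nat.card_eq_fintype_card]
  have e : ∀ j, s.pos (Sum.inl i) < s.pos (Sum.inr j) ↔ s.pos (Sum.inl i) ≤ s.pos (Sum.inr j) :=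
    fun j => ⟨le_of_lt, fun h => lt_of_le_of_ne h fun e => Sum.inl_ne_inr (s.pos.injective e)⟩
  rw [Fintype.card_congr (Equiv.subtypeEquivRight e)]
  exact h1

theorem EDString.segment_shift_card (s : EDString m n)
    (h : (symPow (par m n) 2).shift.IsSphericalFor s.borel) (r : ℕ) :
    Fintype.card {i : Fin m // r ≤ (s.pos (Sum.inl i) : ℕ)} ≤
        Fintype.card {j : Fin n // r ≤ (s.pos (Sum.inr j) : ℕ)} ∧
      Fintype.card {j : Fin n // r ≤ (s.pos (Sum.inr j) : ℕ)} ≤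
        Fintype.card {i : Fin m // r ≤ (s.pos (Sum.inl i) : ℕ)} + 1 := by
  have h1 := SuperSph.segment_shift_card (pos := fun a => (s.pos a : ℕ)) s.pos_nat_injective h r
  rw [Fintype.card_congr (segmentOddEquiv m n fun x => r ≤ (s.pos x : ℕ)),
    Fintype.card_congr (segmentEvenEquiv m n fun x => r ≤ (s.pos x : ℕ))] at h1
  exact h1

theorem card_subtype_le_of_strictMono {n : ℕ} {f : Fin n → ℕ} (hf : StrictMono f) (k : Fin n) :
    Fintype.card {i : Fin n // f k ≤ f i} = n - k := by
  simp only [hf.le_iff_le]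
  rw [Fintype.card_subtype, ← Fin.card_Ici]
  congr 1
  ext i
  simp

theorem card_subtype_succ_le_of_strictMono {n : ℕ} {f : Fin n → ℕ} (hf : StrictMono f)
    (k : Fin n) : Fintype.card {i : Fin n // f k + 1 ≤ f i} = n - 1 - k := by
  simp only [Nat.succ_le_iff, hf.lt_iff_lt]
  rw [Fintype.card_subtype, ← Fin.card_Ioi]
  congr 1
  ext i
  simp

theorem card_fin_le (N r : ℕ) : Fintype.card {x : Fin N // r ≤ (x : ℕ)} = N - r := by
  by_cases hr : r < N
  · rw [Fintype.card_subtype]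
    have := Fin.card_Ici (⟨r, hr⟩ : Fin N)
    rw [← this]
    congr 1
    ext x
    simp [Fin.le_def]
  · rw [Fintype.card_eq_zero_iff.2 ⟨fun x => hr (x.2.trans_lt x.1.2)⟩]
    omega

theorem EDString.card_segment (s : EDString m n) (r : ℕ) :
    Fintype.card {i : Fin m // r ≤ (s.pos (Sum.inl i) : ℕ)} +
      Fintype.card {j : Fin n // r ≤ (s.pos (Sum.inr j) : ℕ)} = m + n - r := by
  rw [← card_fin_le, ← Fintype.card_sum]
  refine Fintype.card_congr ((Equiv.subtypeSum (p := fun a => r ≤ (s.pos a : ℕ))).symm.trans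
    (s.pos.subtypeEquiv fun _ => Iff.rfl))

/-- In every final segment the number of `δ`'s equals or exceeds by one the number of `ε`'s, so the
length determines both. Comparing the segment that starts at a letter with the one just after it
determines the letter's position: read from the right, the string is `δεδε⋯`. -/
theorem EDString.pos_of_symPow_two_shift (s : EDString m n)
    (h : (symPow (par m n) 2).shift.IsSphericalFor s.borel) :
    (∀ i, (s.pos (Sum.inl i) : ℕ) + 2 * (m - i) = m + n) ∧
      ∀ j, (s.pos (Sum.inr j) : ℕ) + 2 * (n - j) = m + n + 1 := by
  have hε : StrictMono fun i => (s.pos (Sum.inl i) : ℕ) := s.strictMono_eps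
  have hδ : StrictMono fun j => (s.pos (Sum.inr j) : ℕ) := s.strictMono_delta
  constructor
  · intro i
    have h1 := s.segment_shift_card h (s.pos (Sum.inl i))
    have h2 := s.segment_shift_card h (s.pos (Sum.inl i) + 1)
    have h3 := s.card_segment (s.pos (Sum.inl i))
    have h4 := s.card_segment (s.pos (Sum.inl i) + 1)
    have h5 := card_subtype_le_of_strictMono hε i
    have h6 := card_subtype_succ_le_of_strictMono hε i
    have h7 := (s.pos (Sum.inl i)).2
    have h8 := i.2
    omega
  · intro i
    have h1 := s.segment_shift_card h (s.pos (Sum.inr i))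
    have h2 := s.segment_shift_card h (s.pos (Sum.inr i) + 1)
    have h3 := s.card_segment (s.pos (Sum.inr i))
    have h4 := s.card_segment (s.pos (Sum.inr i) + 1)
    have h5 := card_subtype_le_of_strictMono hδ i
    have h6 := card_subtype_succ_le_of_strictMono hδ i
    have h7 := (s.pos (Sum.inr i)).2
    have h8 := i.2
    omega

theorem EDString.symPow_two_shift_isSphericalFor_iff_isEpsDelta [NeZero n] (s : EDString n n) :
    (symPow (par n n) 2).shift.IsSphericalFor s.borel ↔ s.IsEpsDelta := by
  constructor
  · intro h i
    obtain ⟨h1, h2⟩ := s.pos_of_symPow_two_shift h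
    have := h1 i
    have := h2 i
    omega
  · intro h
    rw [s.borel_eq_flagBorel_nat]
    exact symPow_two_shift_isSphericalFor_eq h

theorem EDString.symPow_two_shift_isSphericalFor_iff_isDeltaEpsDelta [NeZero n]
    (s : EDString n (n + 1)) :
    (symPow (par n (n + 1)) 2).shift.IsSphericalFor s.borel ↔ s.IsDeltaEpsDelta := by
  constructor
  · intro h
    obtain ⟨h1, h2⟩ := s.pos_of_symPow_two_shift h
    refine ⟨fun i => ?_, fun j => ?_⟩
    · have := h1 i
      omega
    · have := h2 j
      omega
  · intro h
    rw [s.borel_eq_flagBorel_nat]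
    exact symPow_two_shift_isSphericalFor_succ h.1 h.2

theorem symPow_two_sphericalExactly [NeZero m] [NeZero n] :
    SphericalExactly (symPow (par m n) 2) EDString.EvenDeltas :=
  sphericalExactly_of_strings (superPow_two_isoAlong_conj 1)
    EDString.symPow_two_isSphericalFor_iff

theorem symPow_two_shift_sphericalExactly_eq [NeZero n] :
    SphericalExactly (symPow (par n n) 2).shift EDString.IsEpsDelta :=
  sphericalExactly_of_strings (fun g hg => (superPow_two_isoAlong_conj 1 g hg).shift)
    EDString.symPow_two_shift_isSphericalFor_iff_isEpsDelta

theorem symPow_two_shift_sphericalExactly_succ [NeZero n] :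
    SphericalExactly (symPow (par n (n + 1)) 2).shift EDString.IsDeltaEpsDelta :=
  sphericalExactly_of_strings (fun g hg => (superPow_two_isoAlong_conj 1 g hg).shift)
    EDString.symPow_two_shift_isSphericalFor_iff_isDeltaEpsDelta

end

section

/-! ### Numerical sphericity -/

theorem multichoose_mono_right {n : ℕ} (hn : 1 ≤ n) : Monotone (Nat.multichoose n) := by
  refine monotone_nat_of_le_succ fun k => ?_
  obtain ⟨n, rfl⟩ := Nat.exists_eq_add_of_le' hn
  rw [Nat.multichoose_succ_succ]
  exact Nat.le_add_left _ _

theorem two_mul_multichoose_two (n : ℕ) : 2 * Nat.multichoose n 2 = n * (n + 1) := by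
  induction n with
  | zero => simp
  | succ n ih =>
    rw [Nat.multichoose_succ_succ, mul_add, ih, Nat.multichoose_one_right]
    ring

theorem six_mul_multichoose_three (n : ℕ) :
    6 * Nat.multichoose n 3 = n * (n + 1) * (n + 2) := by
  induction n with
  | zero => simp
  | succ n ih =>
    have := two_mul_multichoose_two (n + 1)
    rw [Nat.multichoose_succ_succ, mul_add, ih]
    linarith

theorem multichoose_four (n : ℕ) :
    24 * Nat.multichoose n 4 = n * (n + 1) * (n + 2) * (n + 3) := by
  induction n with
  | zero => simp
  | succ n ih =>
    have := six_mul_multichoose_three (n + 1)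
    rw [Nat.multichoose_succ_succ, mul_add, ih]
    linarith

theorem two_mul_choose_two (n : ℕ) : 2 * Nat.choose n 2 + n = n * n := by
  induction n with
  | zero => simp
  | succ n ih =>
    rw [Nat.choose_succ_succ' n 1, Nat.choose_one_right]
    linarith

theorem lt_multichoose_two {n : ℕ} (hn : 2 ≤ n) : n < Nat.multichoose n 2 := by
  have := two_mul_multichoose_two n
  nlinarith

variable {m n d : ℕ}

theorem le_finrank_symPow_part (m n d : ℕ) (i : ZMod 2) (K : Finset ℕ)
    (hK : ∀ k ∈ K, k ≤ d ∧ (k : ZMod 2) = i) :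
    ∑ k ∈ K, Nat.multichoose m (d - k) * Nat.choose n k ≤
      Module.finrank ℂ ((symPow (par m n) d).part i) := by
  have h := le_finrank_superPow_part (par m n) 0 sgn_zero.symm d i K fun k hk =>
    ⟨(hK k hk).1, by rw [mul_zero, zero_add, zero_add, mul_one, (hK k hk).2]⟩
  rw [card_par_zero, zero_add, card_par_one] at h
  exact h

/-- In an exterior power the odd vectors may repeat and the even ones may not, so `k` counts even
factors and the parity is that of `d - k`. -/
theorem le_finrank_extPow_part (m n d : ℕ) (i : ZMod 2) (K : Finset ℕ)
    (hK : ∀ k ∈ K, k ≤ d ∧ ((d - k : ℕ) : ZMod 2) = i) :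
    ∑ k ∈ K, Nat.multichoose n (d - k) * Nat.choose m k ≤
      Module.finrank ℂ ((extPow (par m n) d).part i) := by
  have h := le_finrank_superPow_part (par m n) 1 sgn_one.symm d i K fun k hk =>
    ⟨(hK k hk).1, by rw [zmod2_one_add_one, mul_zero, add_zero, mul_one, (hK k hk).2]⟩
  rw [card_par_one, zmod2_one_add_one, card_par_zero] at h
  exact h

theorem SuperRep.IsNumericallySpherical.finrank_le {V : Type*} [AddCommGroup V] [Module ℂ V]
    {R : SuperRep (gl (par m n)) V} (h : R.IsNumericallySpherical) :
    Module.finrank ℂ (R.part 1) ≤ m * n := by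
  obtain ⟨-, b, hb, hle⟩ := h
  rwa [finrank_borel_odd hb, card_par_zero, card_par_one] at hle

theorem SuperRep.IsNumericallySpherical.finrank_shift_le {V : Type*} [AddCommGroup V] [Module ℂ V]
    {R : SuperRep (gl (par m n)) V} (h : R.shift.IsNumericallySpherical) :
    Module.finrank ℂ (R.part 0) ≤ m * n := by
  rw [← zmod2_one_add_one]
  exact h.finrank_le

/-- Monomials with one odd factor already number more than `mn` when `m ≥ 2`. For `m = 1` they
number exactly `n`, and those with three odd factors, which exist since `n ≥ 3`, exceed the bound.
-/
theorem symPow_not_numericallySpherical (hm : 1 ≤ m) (hmn : m ≤ n)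
    (h2 : 2 ≤ m ∨ 3 ≤ n) (hd : 3 ≤ d) : ¬ (symPow (par m n) d).IsNumericallySpherical := by
  intro h
  have h1 := h.finrank_le
  by_cases hm2 : 2 ≤ m
  · have h3 := le_finrank_symPow_part m n d 1 {1} (by simp; omega)
    rw [Finset.sum_singleton, Nat.choose_one_right] at h3
    have h4 := (lt_multichoose_two hm2).trans_le
      (multichoose_mono_right hm (show 2 ≤ d - 1 by omega))
    have h5 := Nat.mul_lt_mul_of_pos_right h4 (show 0 < n by omega)
    omega
  · obtain rfl : m = 1 := by omega
    have h3 := le_finrank_symPow_part 1 n d 1 {1, 3} (by simp; exact ⟨by omega, hd, by decide⟩)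
    rw [Finset.sum_pair (by decide), Nat.choose_one_right, Nat.multichoose_one,
      Nat.multichoose_one] at h3
    have h4 := Nat.choose_pos (show 3 ≤ n by omega)
    omega

/-- Monomials with no or two odd factors are counted. For `n ≥ 3` one has `n ≤ n.choose 2`, so those
with two odd factors reach `mn` and the others exceed it; the remaining case `m = n = 2` is
numerical. -/
theorem symPow_shift_not_numericallySpherical (hm : 1 ≤ m) (hmn : m ≤ n)
    (h2 : 2 ≤ m ∨ 3 ≤ n) (hd : 3 ≤ d) :
    ¬ (symPow (par m n) d).shift.IsNumericallySpherical := by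
  intro h
  have h1 := h.finrank_shift_le
  have h3 := le_finrank_symPow_part m n d 0 {0, 2} (by simp; exact ⟨by omega, by decide⟩)
  rw [Finset.sum_pair (by decide), Nat.choose_zero_right, mul_one, Nat.sub_zero] at h3
  have h4 := multichoose_mono_right hm (show 3 ≤ d by omega)
  have h5 := multichoose_mono_right hm (show 1 ≤ d - 2 by omega)
  rw [Nat.multichoose_one_right] at h5
  have h6 := six_mul_multichoose_three m
  have h7 := Nat.mul_le_mul_right (n.choose 2) h5
  have h8 := two_mul_choose_two n
  by_cases hn : 3 ≤ n
  · have : n ≤ n.choose 2 := by nlinarith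
    have := Nat.mul_le_mul_left m this
    have : 0 < m * (m + 1) * (m + 2) := by positivity
    omega
  · obtain rfl : n = 2 := by omega
    obtain rfl : m = 2 := by omega
    norm_num at *
    omega

/-- The parity of `d` decides which monomials are odd: for even `d` those with one even factor
suffice. For odd `d` those without even factors suffice if `n ≥ 3`; for `m = n = 2` they may number
only `4 = mn`, and those with two even factors are needed as well. -/
theorem extPow_not_numericallySpherical (hm : 1 ≤ m) (hmn : m ≤ n)
    (h2 : 2 ≤ m ∨ 3 ≤ n) (hd : 3 ≤ d) : ¬ (extPow (par m n) d).IsNumericallySpherical := by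
  intro h
  have h1 := h.finrank_le
  have hn1 : 1 ≤ n := hm.trans hmn
  have hn2 : 2 ≤ n := by omega
  have h6 := six_mul_multichoose_three n
  rcases Nat.even_or_odd d with hev | hodd
  · have hodd : Odd (d - 1) := Nat.Even.sub_odd (by omega) hev odd_one
    have h3 := le_finrank_extPow_part m n d 1 {1} (by
      simp only [Finset.mem_singleton, forall_eq]
      exact ⟨by omega, ZMod.natCast_eq_one_iff_odd.2 hodd⟩)
    rw [Finset.sum_singleton, Nat.choose_one_right] at h3
    have h4 := (lt_multichoose_two hn2).trans_le
      (multichoose_mono_right hn1 (show 2 ≤ d - 1 by omega))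
    have h5 := Nat.mul_lt_mul_of_pos_right h4 (show 0 < m by omega)
    rw [mul_comm n m] at h5
    omega
  · have hodd2 : Odd (d - 2) := Nat.Odd.sub_even (by omega) hodd even_two
    have h3 := le_finrank_extPow_part m n d 1 {0, 2} (by
      simp only [Finset.mem_insert, Finset.mem_singleton, forall_eq_or_imp, forall_eq]
      exact ⟨⟨by omega, ZMod.natCast_eq_one_iff_odd.2 hodd⟩, by omega,
        ZMod.natCast_eq_one_iff_odd.2 hodd2⟩)
    rw [Finset.sum_pair (by decide), Nat.choose_zero_right, mul_one, Nat.sub_zero] at h3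
    have h4 := multichoose_mono_right hn1 (show 3 ≤ d by omega)
    by_cases hn : 3 ≤ n
    · have : n * n < Nat.multichoose n 3 := by nlinarith
      have := Nat.mul_le_mul_right n hmn
      omega
    · obtain rfl : n = 2 := by omega
      obtain rfl : m = 2 := by omega
      have h5 := multichoose_mono_right hm (show 1 ≤ d - 2 by omega)
      norm_num at *
      omega

/-- For even `d`, hence `d ≥ 4`, the monomials in odd vectors alone exceed `n² ≥ mn`. For odd `d`
the monomials with one even factor exceed `mn`. -/
theorem extPow_shift_not_numericallySpherical (hm : 1 ≤ m) (hmn : m ≤ n)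
    (h2 : 2 ≤ m ∨ 3 ≤ n) (hd : 3 ≤ d) :
    ¬ (extPow (par m n) d).shift.IsNumericallySpherical := by
  intro h
  have h1 := h.finrank_shift_le
  have hn1 : 1 ≤ n := hm.trans hmn
  have hn2 : 2 ≤ n := by omega
  rcases Nat.even_or_odd d with hev | hodd
  · have h3 := le_finrank_extPow_part m n d 0 {0} (by
      simp only [Finset.mem_singleton, forall_eq]
      exact ⟨by omega, ZMod.natCast_eq_zero_iff_even.2 hev⟩)
    rw [Finset.sum_singleton, Nat.choose_zero_right, mul_one, Nat.sub_zero] at h3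
    have hd4 : 4 ≤ d := by
      obtain ⟨k, rfl⟩ := hev
      omega
    have h4 := multichoose_mono_right hn1 hd4
    have h6 := multichoose_four n
    have h7 := Nat.mul_le_mul_right n hmn
    have h8 : 24 * (n * n) < n * (n + 1) * (n + 2) * (n + 3) := by
      have h9 : 24 * n < (n + 1) * (n + 2) * (n + 3) := by nlinarith [mul_self_nonneg (n : ℤ)]
      have := Nat.mul_lt_mul_of_pos_left h9 (show 0 < n by omega)
      linarith
    omega
  · have hev : Even (d - 1) := Nat.Odd.sub_odd hodd odd_one
    have h3 := le_finrank_extPow_part m n d 0 {1} (by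
      simp only [Finset.mem_singleton, forall_eq]
      exact ⟨by omega, ZMod.natCast_eq_zero_iff_even.2 hev⟩)
    rw [Finset.sum_singleton, Nat.choose_one_right] at h3
    have h4 := (lt_multichoose_two hn2).trans_le
      (multichoose_mono_right hn1 (show 2 ≤ d - 1 by omega))
    have h5 := Nat.mul_lt_mul_of_pos_right h4 (show 0 < m by omega)
    rw [mul_comm n m] at h5
    omega

theorem symPow_two_shift_of_numericallySpherical (hmn : m ≤ n)
    (h : (symPow (par m n) 2).shift.IsNumericallySpherical) : n = m ∨ n = m + 1 := by
  have h1 := h.finrank_shift_le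
  have h3 := le_finrank_symPow_part m n 2 0 {0, 2} (by decide)
  rw [Finset.sum_pair (by decide)] at h3
  simp only [Nat.choose_zero_right, mul_one, Nat.sub_zero, Nat.sub_self,
    Nat.multichoose_zero_right, one_mul] at h3
  have := le_of_multichoose_le (h3.trans h1)
  omega

/-- The inequality is that of the symmetric square with `m` and `n` exchanged, so it gives `n ≤ m`.
-/
theorem extPow_two_shift_of_numericallySpherical (hmn : m ≤ n)
    (h : (extPow (par m n) 2).shift.IsNumericallySpherical) : n = m := by
  have h1 := h.finrank_shift_le
  have h3 := le_finrank_extPow_part m n 2 0 {0, 2} (by decide)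
  rw [Finset.sum_pair (by decide)] at h3
  simp only [Nat.choose_zero_right, mul_one, Nat.sub_zero, Nat.sub_self,
    Nat.multichoose_zero_right, one_mul] at h3
  rw [mul_comm] at h1
  have := le_of_multichoose_le (h3.trans h1)
  omega

/-! ### Degree one -/

theorem exists_std_isSphericalFor [NeZero m] : ∃ pos : Fin m ⊕ Fin n → ℕ,
    Function.Injective pos ∧ (std (par m n)).IsSphericalFor (flagBorel pos) := by
  have hpos : Function.Injective
      -- The even vectors come last and in reversed order, so that the vector with index `0` is in
      -- the last position.
      (Sum.elim (fun i => n + (m - i)) (fun j => j) : Fin m ⊕ Fin n → ℕ) := by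
    rintro (i | i) (j | j) e <;> simp only [Sum.elim_inl, Sum.elim_inr] at e
    · congr 1; ext; omega
    · omega
    · omega
    · congr 1; ext; omega
  refine ⟨_, hpos, (std_isSphericalFor_iff hpos (z := Sum.inl 0) ?_).2 rfl⟩
  rintro (i | i) <;> simp only [Sum.elim_inl, Sum.elim_inr, Fin.val_zero] <;> omega

theorem exists_std_shift_isSphericalFor [NeZero n] : ∃ pos : Fin m ⊕ Fin n → ℕ,
    Function.Injective pos ∧ (std (par m n)).shift.IsSphericalFor (flagBorel pos) := by
  have hpos : Function.Injective
      (Sum.elim (fun i => i) (fun j => m + (n - j)) : Fin m ⊕ Fin n → ℕ) := by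
    rintro (i | i) (j | j) e <;> simp only [Sum.elim_inl, Sum.elim_inr] at e
    · congr 1; ext; omega
    · omega
    · omega
    · congr 1; ext; omega
  refine ⟨_, hpos, std_shift_isSphericalFor (z := Sum.inr 0) ?_ rfl⟩
  rintro (i | i) <;> simp only [Sum.elim_inl, Sum.elim_inr, Fin.val_zero] <;> omega

theorem isoAlong_std_superPow_one (p : Fin m ⊕ Fin n → ZMod 2) (η : ℂ) :
    SuperRep.IsoAlong id (std p) (superPow p η 1) :=
  (superPow_one_isoAlong p η).symm fun _ => rfl

theorem superPow_one_isSpherical [NeZero m] (η : ℂ) :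
    (superPow (par m n) η 1).IsSpherical ∧ (superPow (par m n) η 1).IsNumericallySpherical := by
  obtain ⟨pos, hpos, h⟩ := exists_std_isSphericalFor (m := m) (n := n)
  have h' := (isoAlong_std_superPow_one (par m n) η).isSphericalFor (fun _ h => h) h
  exact ⟨h'.isSpherical hpos, h'.isNumericallySpherical_of_flag hpos⟩

theorem superPow_one_shift_isSpherical [NeZero n] (η : ℂ) :
    (superPow (par m n) η 1).shift.IsSpherical ∧
      (superPow (par m n) η 1).shift.IsNumericallySpherical := by
  obtain ⟨pos, hpos, h⟩ := exists_std_shift_isSphericalFor (m := m) (n := n)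
  have h' := (isoAlong_std_superPow_one (par m n) η).shift.isSphericalFor (fun _ h => h) h
  exact ⟨h'.isSpherical hpos, h'.isNumericallySpherical_of_flag hpos⟩

/-- The case distinction shared by the four families: `P` stands for spherical, `Q` for numerically
spherical, and `C` for the condition on `m` and `n` in degree two. -/
theorem and_of_cases {P Q : Prop} {d : ℕ} {C : Prop} (hd : 1 ≤ d) (h1 : d = 1 → P ∧ Q)
    (h2 : d = 2 → C → P ∧ Q) (h2' : d = 2 → Q → C) (h3 : 3 ≤ d → ¬ Q) :
    (Q ↔ d = 1 ∨ (d = 2 ∧ C)) ∧ (Q → P) := by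
  rcases lt_trichotomy d 2 with h | rfl | h
  · obtain rfl : d = 1 := by omega
    have := h1 rfl
    tauto
  · have := h2 rfl
    have := h2' rfl
    simp
    tauto
  · have := h3 h
    have e1 : d ≠ 1 := by omega
    have e2 : d ≠ 2 := by omega
    tauto

theorem classification (hm : 1 ≤ m) (hmn : m ≤ n) (h2 : 2 ≤ m ∨ 3 ≤ n) (hd : 1 ≤ d) :
    ((symPow (par m n) d).IsNumericallySpherical ↔ d = 1 ∨ d = 2) ∧
    ((extPow (par m n) d).IsNumericallySpherical ↔ d = 1 ∨ d = 2) ∧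
    ((symPow (par m n) d).shift.IsNumericallySpherical ↔
      d = 1 ∨ (d = 2 ∧ (n = m ∨ n = m + 1))) ∧
    ((extPow (par m n) d).shift.IsNumericallySpherical ↔ d = 1 ∨ (d = 2 ∧ n = m)) ∧
    ((symPow (par m n) d).IsNumericallySpherical → (symPow (par m n) d).IsSpherical) ∧
    ((extPow (par m n) d).IsNumericallySpherical → (extPow (par m n) d).IsSpherical) ∧
    ((symPow (par m n) d).shift.IsNumericallySpherical →
      (symPow (par m n) d).shift.IsSpherical) ∧
    ((extPow (par m n) d).shift.IsNumericallySpherical →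
      (extPow (par m n) d).shift.IsSpherical) := by
  have : NeZero m := ⟨by omega⟩
  have : NeZero n := ⟨by omega⟩
  have hS := and_of_cases (P := (symPow (par m n) d).IsSpherical)
    (Q := (symPow (par m n) d).IsNumericallySpherical) (C := True) hd
    (fun h => h ▸ superPow_one_isSpherical 1)
    (fun h _ => by
      subst h
      obtain ⟨pos, hpos, h⟩ := exists_symPow_two_isSphericalFor (m := m) (n := n)
      exact ⟨h.isSpherical hpos, h.isNumericallySpherical_of_flag hpos⟩)
    (fun _ _ => trivial) (symPow_not_numericallySpherical hm hmn h2)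
  have hE := and_of_cases (P := (extPow (par m n) d).IsSpherical)
    (Q := (extPow (par m n) d).IsNumericallySpherical) (C := True) hd
    (fun h => h ▸ superPow_one_isSpherical (-1))
    (fun h _ => by
      subst h
      obtain ⟨pos, hpos, h⟩ := exists_extPow_two_isSphericalFor (m := m) (n := n)
      exact ⟨h.isSpherical hpos, h.isNumericallySpherical_of_flag hpos⟩)
    (fun _ _ => trivial) (extPow_not_numericallySpherical hm hmn h2)
  have hS' := and_of_cases (P := (symPow (par m n) d).shift.IsSpherical)
    (Q := (symPow (par m n) d).shift.IsNumericallySpherical) (C := n = m ∨ n = m + 1) hd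
    (fun h => h ▸ superPow_one_shift_isSpherical 1)
    (fun h hC => by
      subst h
      rcases hC with rfl | rfl
      · obtain ⟨pos, hpos, h⟩ := exists_symPow_two_shift_isSphericalFor_eq (n := n)
        exact ⟨h.isSpherical hpos, h.isNumericallySpherical_of_flag hpos⟩
      · obtain ⟨pos, hpos, h⟩ := exists_symPow_two_shift_isSphericalFor_succ (n := m)
        exact ⟨h.isSpherical hpos, h.isNumericallySpherical_of_flag hpos⟩)
    (fun h => h ▸ symPow_two_shift_of_numericallySpherical hmn)
    (symPow_shift_not_numericallySpherical hm hmn h2)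
  have hE' := and_of_cases (P := (extPow (par m n) d).shift.IsSpherical)
    (Q := (extPow (par m n) d).shift.IsNumericallySpherical) (C := n = m) hd
    (fun h => h ▸ superPow_one_shift_isSpherical (-1))
    (fun h hC => by
      subst h hC
      obtain ⟨pos, hpos, h⟩ := exists_extPow_two_shift_isSphericalFor (n := n)
      exact ⟨h.isSpherical hpos, h.isNumericallySpherical_of_flag hpos⟩)
    (fun h => h ▸ extPow_two_shift_of_numericallySpherical hmn)
    (extPow_shift_not_numericallySpherical hm hmn h2)
  simp only [and_true] at hS hE
  exact ⟨hS.1, hE.1, hS'.1, hE'.1, hS.2, hE.2, hS'.2, hE'.2⟩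

end

section

/-! ### Superdimensions in degree two -/

variable {m n : ℕ}

theorem card_sigma_fin (n : ℕ) : Fintype.card (Σ i : Fin n, Fin i) = n * (n - 1) / 2 := by
  rw [Fintype.card_sigma]
  simp only [Fintype.card_fin]
  rw [Fin.sum_univ_eq_sum_range (fun i => i), Finset.sum_range_id]

theorem card_sigma_fin_succ (n : ℕ) :
    Fintype.card (Σ i : Fin n, Fin (i + 1)) = n * (n + 1) / 2 := by
  rw [Fintype.card_sigma]
  simp only [Fintype.card_fin]
  have h := Finset.sum_range_succ' (fun i => i) n
  rw [Finset.sum_range_id, Nat.add_sub_cancel, add_zero] at h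
  rw [Fin.sum_univ_eq_sum_range (fun i => i + 1), ← h, mul_comm]

theorem tensorEquiv_eq_zero {p : Fin m ⊕ Fin n → ZMod 2} {t : superSym p 1 2}
    (h : ∀ a b, (tensorEquiv p 1 t : Matrix (Fin m ⊕ Fin n) (Fin m ⊕ Fin n) ℂ) a b = 0) : t = 0 := by
  apply (tensorEquiv p 1).injective
  apply Subtype.ext
  rw [map_zero]
  ext a b
  exact h a b

theorem finrank_symPow_two_part_one (m n : ℕ) :
    Module.finrank ℂ ((symPow (par m n) 2).part 1) = m * n := by
  apply le_antisymm
  · let f : (symPow (par m n) 2).part 1 →ₗ[ℂ] (Fin m × Fin n → ℂ) :=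
      { toFun := fun t x => (tensorEquiv (par m n) 1 t.1 : Matrix (Fin m ⊕ Fin n) (Fin m ⊕ Fin n) ℂ) (Sum.inl x.1) (Sum.inr x.2)
        map_add' := fun _ _ => rfl
        map_smul' := fun _ _ => rfl }
    have hf : Function.Injective f := by
      rw [injective_iff_map_eq_zero]
      intro t ht
      have h0 : ∀ i j, (tensorEquiv (par m n) 1 t.1 : Matrix (Fin m ⊕ Fin n) (Fin m ⊕ Fin n) ℂ) (Sum.inl i) (Sum.inr j) = 0 :=
        fun i j => congrFun ht (i, j)
      have hp := tensorEquiv_mem_part.2 t.2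
      have hs := mem_symMat'.1 (tensorEquiv (par m n) 1 t.1).2
      refine Subtype.ext (tensorEquiv_eq_zero ?_)
      rintro (a | a) (b | b)
      · exact hp _ _ (by simp [par])
      · exact h0 a b
      · rw [hs (Sum.inl b) (Sum.inr a), h0]
        simp
      · exact hp _ _ (by simp [par, zmod2_one_add_one])
    have := LinearMap.finrank_le_finrank_of_injective hf
    rwa [Module.finrank_fintype_fun_eq_card, Fintype.card_prod, Fintype.card_fin,
      Fintype.card_fin] at this
  · have := le_finrank_symPow_part m n 2 1 {1} (by decide)
    simpa using this

/-- Monomials bound the dimension from below. From above, an even element is determined by the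
strict lower triangle of its skew `δ`-`δ` block and the full lower triangle of its symmetric `ε`-`ε`
block. -/
theorem finrank_symPow_two_part_zero (m n : ℕ) :
    Module.finrank ℂ ((symPow (par m n) 2).part 0) = n * (n - 1) / 2 + m * (m + 1) / 2 := by
  apply le_antisymm
  · let f : (symPow (par m n) 2).part 0 →ₗ[ℂ]
        ((Σ i : Fin n, Fin i) ⊕ (Σ i : Fin m, Fin (i + 1)) → ℂ) :=
      { toFun := fun t x => x.elim
          (fun y => (tensorEquiv (par m n) 1 t.1 : Matrix (Fin m ⊕ Fin n) (Fin m ⊕ Fin n) ℂ) (Sum.inr y.1)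
            (Sum.inr ⟨y.2, y.2.2.trans y.1.2⟩))
          (fun y => (tensorEquiv (par m n) 1 t.1 : Matrix (Fin m ⊕ Fin n) (Fin m ⊕ Fin n) ℂ) (Sum.inl y.1)
            (Sum.inl ⟨y.2, by omega⟩))
        map_add' := fun _ _ => by ext (x | x) <;> rfl
        map_smul' := fun _ _ => by ext (x | x) <;> rfl }
    have hf : Function.Injective f := by
      rw [injective_iff_map_eq_zero]
      intro t ht
      have hp := tensorEquiv_mem_part.2 t.2
      have hs := mem_symMat'.1 (tensorEquiv (par m n) 1 t.1).2
      have hl : ∀ i j : Fin m, j ≤ i →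
          (tensorEquiv (par m n) 1 t.1 : Matrix (Fin m ⊕ Fin n) (Fin m ⊕ Fin n) ℂ) (Sum.inl i) (Sum.inl j) = 0 :=
        fun i j hij => congrFun ht (Sum.inr ⟨i, ⟨j, Nat.lt_succ_of_le hij⟩⟩)
      have hr : ∀ i j : Fin n, j < i →
          (tensorEquiv (par m n) 1 t.1 : Matrix (Fin m ⊕ Fin n) (Fin m ⊕ Fin n) ℂ) (Sum.inr i) (Sum.inr j) = 0 :=
        fun i j hij => congrFun ht (Sum.inl ⟨i, ⟨j, hij⟩⟩)
      refine Subtype.ext (tensorEquiv_eq_zero ?_)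
      rintro (a | a) (b | b)
      · rcases le_total b a with h | h
        · exact hl a b h
        · rw [hs (Sum.inl b) (Sum.inl a), hl b a h]
          simp
      · exact hp _ _ (by simp [par])
      · exact hp _ _ (by simp [par])
      · rcases lt_trichotomy b a with h | rfl | h
        · exact hr a b h
        · have h := hs (Sum.inr b) (Sum.inr b)
          simp only [par, Sum.elim_inr, mul_one, one_mul, sgn_one, neg_mul] at h
          exact self_eq_neg.1 h
        · rw [hs (Sum.inr b) (Sum.inr a), hr b a h]
          simp
    have := LinearMap.finrank_le_finrank_of_injective hf
    rwa [Module.finrank_fintype_fun_eq_card, Fintype.card_sum, card_sigma_fin,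
      card_sigma_fin_succ] at this
  · have h := le_finrank_symPow_part m n 2 0 {0, 2} (by decide)
    have h1 := two_mul_multichoose_two m
    have h2 := Nat.choose_two_right n
    rw [Finset.sum_pair (by decide)] at h
    simp only [Nat.choose_zero_right, mul_one, Nat.sub_zero, Nat.sub_self,
      Nat.multichoose_zero_right, one_mul] at h
    omega

theorem symPow_two_sdim (m n : ℕ) :
    (symPow (par m n) 2).sdim = (n * (n - 1) / 2 + m * (m + 1) / 2, m * n) :=
  Prod.ext (finrank_symPow_two_part_zero m n) (finrank_symPow_two_part_one m n)

theorem symPow_two_shift_sdim (m n : ℕ) :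
    (symPow (par m n) 2).shift.sdim = (m * n, n * (n - 1) / 2 + m * (m + 1) / 2) := by
  refine Prod.ext ?_ ?_
  · change Module.finrank ℂ ((symPow (par m n) 2).part (0 + 1)) = _
    rw [zero_add, finrank_symPow_two_part_one]
  · change Module.finrank ℂ ((symPow (par m n) 2).part (1 + 1)) = _
    rw [zmod2_one_add_one, finrank_symPow_two_part_zero]

theorem symPow_two_shift_sdim_eq (n : ℕ) : (symPow (par n n) 2).shift.sdim = (n ^ 2, n ^ 2) := by
  have h1 : n * (n - 1) / 2 + n * (n + 1) / 2 = n ^ 2 := by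
    have h2 := two_mul_multichoose_two n
    have h3 := two_mul_choose_two n
    rw [← Nat.choose_two_right]
    have : n * (n + 1) = n * n + n := by ring
    rw [pow_two]
    omega
  rw [symPow_two_shift_sdim, h1, pow_two]

theorem symPow_two_shift_sdim_succ (n : ℕ) :
    (symPow (par n (n + 1)) 2).shift.sdim = (n * (n + 1), n * (n + 1)) := by
  have h1 : (n + 1) * (n + 1 - 1) / 2 + n * (n + 1) / 2 = n * (n + 1) := by
    have h2 := two_mul_multichoose_two n
    rw [Nat.add_sub_cancel, mul_comm (n + 1)]
    omega
  rw [symPow_two_shift_sdim, h1]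

end

section

/-! ### Stabilizers in degree two -/

section Stabilizer

variable {ι : Type*} [Fintype ι] [DecidableEq ι]

theorem act_eq_zero_iff {p : ι → ZMod 2} {η : ℂ} {X : Matrix ι ι ℂ} {v : superSym p η 2} :
    (superPow p η 2).act X v = 0 ↔
      X * (tensorEquiv p η v : Matrix ι ι ℂ) +
        superFlip p η (X * (tensorEquiv p η v : Matrix ι ι ℂ)) = 0 := by
  rw [← tensorEquiv_act, ← (tensorEquiv p η).map_eq_zero_iff, ← Submodule.coe_eq_zero]

/-- As `M` is even and supersymmetric, both terms of the invariance condition become entries of the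
one product `XM`. The sign `s` is left free since it depends on the parity of `φ`. -/
theorem inducedForm_invariance {p : ι → ZMod 2} {v : superSym p 1 2}
    (hv : v ∈ (superPow p 1 2).part 0) (X : Matrix ι ι ℂ) (s : ℂ) (φ ψ : ι → ℂ) :
    inducedForm p v.1 ((dualStd p).act X φ) ψ + s * inducedForm p v.1 φ ((dualStd p).act X ψ) =
      -∑ a, ∑ b, φ a * ψ b *
        (sgn (p b) * sgn ((p a + p b) * p a) * (X * (tensorEquiv p 1 v : Matrix ι ι ℂ)) a b +
          s * (sgn ((p a + p b) * p b) * (X * (tensorEquiv p 1 v : Matrix ι ι ℂ)) b a)) := by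
  obtain ⟨M, hM⟩ : ∃ M : Matrix ι ι ℂ, M = tensorEquiv p 1 v := ⟨_, rfl⟩
  have hMp : M ∈ (gl p).part 0 := hM ▸ tensorEquiv_mem_part.2 hv
  have hMs : ∀ a b, M b a = 1 * (sgn (p a * p b) * M a b) :=
    hM ▸ mem_symMat'.1 (tensorEquiv p 1 v).2
  have hMv : ∀ a b, v.1 ![a, b] = M a b := fun a b => by rw [hM, tensorEquiv_apply]
  rw [← hM]
  simp only [inducedForm, hMv, dualStd_act_apply, Matrix.mul_apply, mul_add, Finset.mul_sum,
    Finset.sum_mul, Finset.sum_add_distrib, neg_add, ← Finset.sum_neg_distrib]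
  congr 1
  · rw [Finset.sum_comm]
    refine (Finset.sum_congr rfl fun b _ => Finset.sum_comm).trans ?_
    rw [Finset.sum_comm]
    refine Finset.sum_congr rfl fun c _ => Finset.sum_congr rfl fun b _ =>
      Finset.sum_congr rfl fun a _ => ?_
    by_cases h : p a = p b
    · rw [h, zmod2_mul_self]
      ring
    · rw [hMp a b fun e => h (zmod2_add_eq_zero.1 e)]
      ring
  · refine Finset.sum_congr rfl fun a _ => ?_
    rw [Finset.sum_comm]
    refine Finset.sum_congr rfl fun c _ => Finset.sum_congr rfl fun b _ => ?_
    by_cases h : p a = p b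
    · rw [hMs a b, ← h, zmod2_mul_self, add_comm (p a)]
      ring
    · rw [hMp a b fun e => h (zmod2_add_eq_zero.1 e),
        hMp b a fun e => h (zmod2_add_eq_zero.1 e).symm]
      ring

/-- Evaluated on the dual basis vectors `a` and `b`, the invariance condition is, up to a sign, the
entry `(a, b)` of `XM + (XM)^flip`, that is, of `Xv`. -/
theorem mem_ospPart_iff {p : ι → ZMod 2} {v : superSym p 1 2}
    (hv : v ∈ (superPow p 1 2).part 0) {i : ZMod 2} {X : Matrix ι ι ℂ} :
    X ∈ ospPart p v.1 i ↔ X ∈ (gl p).part i ∧ (superPow p 1 2).act X v = 0 := by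
  rw [act_eq_zero_iff]
  have key : ∀ a b, X ∈ (gl p).part i →
      sgn (p b) * sgn ((p a + p b) * p a) * (X * (tensorEquiv p 1 v : Matrix ι ι ℂ)) a b +
        sgn (i * p a) * (sgn ((p a + p b) * p b) *
          (X * (tensorEquiv p 1 v : Matrix ι ι ℂ)) b a) =
      sgn (p b) * sgn ((p a + p b) * p a) *
        (X * (tensorEquiv p 1 v : Matrix ι ι ℂ) +
          superFlip p 1 (X * (tensorEquiv p 1 v : Matrix ι ι ℂ))) a b := by
    intro a b hX
    have hY := mul_even_mem p hX (tensorEquiv_mem_part.2 hv)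
    rw [Matrix.add_apply, superFlip_apply]
    by_cases h : p a + p b = i
    · subst h
      have e : sgn ((p a + p b) * p b) = sgn (p b) * sgn (p a * p b) := by
        rw [← sgn_add]
        congr 1
        generalize p a = x, p b = y
        revert x y
        decide
      rw [e]
      ring
    · rw [hY a b h, hY b a (by rwa [add_comm])]
      ring
  constructor
  · rintro ⟨hX, h⟩
    refine ⟨hX, ?_⟩
    ext a b
    have h1 := h (p a) (Pi.single a 1) (fun c hc => Pi.single_eq_of_ne (fun e => hc (by rw [e])) _)
      (Pi.single b 1)
    rw [inducedForm_invariance hv, neg_eq_zero, Finset.sum_eq_single a, Finset.sum_eq_single b,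
      Pi.single_eq_same, Pi.single_eq_same, one_mul, one_mul, key a b hX] at h1
    · exact (mul_eq_zero.1 h1).resolve_left (mul_ne_zero (sgn_ne_zero _) (sgn_ne_zero _))
    · intro c _ hc
      rw [Pi.single_eq_of_ne hc]
      ring
    · simp
    · intro c _ hc
      simp [Pi.single_eq_of_ne hc]
    · simp
  · rintro ⟨hX, h⟩
    refine ⟨hX, fun j φ hφ ψ => ?_⟩
    rw [inducedForm_invariance hv, neg_eq_zero]
    refine Finset.sum_eq_zero fun a _ => Finset.sum_eq_zero fun b _ => ?_
    by_cases ha : p a = j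
    · rw [← ha, key a b hX, h]
      simp
    · rw [hφ a ha]
      ring

theorem stabilizer_eq_ospDual {p : ι → ZMod 2} {v : superSym p 1 2}
    (hv : v ∈ (superPow p 1 2).part 0) :
    ((superPow p 1 2).stabilizer v hv).carrier = ospDual p v.1 := by
  apply le_antisymm
  · refine ((superPow p 1 2).stabilizer v hv).graded.trans (sup_le_sup ?_ ?_)
    · exact fun X hX => (mem_ospPart_iff hv).2 ⟨hX.2, hX.1⟩
    · exact fun X hX => (mem_ospPart_iff hv).2 ⟨hX.2, hX.1⟩
  · exact sup_le (fun X hX => ((mem_ospPart_iff hv).1 hX).2) fun X hX =>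
      ((mem_ospPart_iff hv).1 hX).2

/-- For `u` even and `w` odd in the kernel of `M`, the pairing `uᵗ(XM + (XM)^flip)w = uᵗXMw + wᵗXMu`
vanishes for all `X`. If both were nonzero, some symmetric matrix would pair nontrivially with them
and be out of reach. -/
theorem eq_zero_or_eq_zero_of_kernel {p : ι → ZMod 2} {M : Matrix ι ι ℂ}
    (h : ∀ W ∈ symMat p 1, ∃ X : Matrix ι ι ℂ, X * M + superFlip p 1 (X * M) = W)
    {u w : ι → ℂ} (hu : u ∈ (std p).part 0) (hw : w ∈ (std p).part 1)
    (hMu : M *ᵥ u = 0) (hMw : M *ᵥ w = 0) : u = 0 ∨ w = 0 := by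
  by_contra hne
  push Not at hne
  obtain ⟨a, ha⟩ := Function.ne_iff.1 hne.1
  obtain ⟨b, hb⟩ := Function.ne_iff.1 hne.2
  obtain ⟨X, hX⟩ := h _ (add_superFlip_mem (mul_one 1) (Matrix.single a b 1))
  have hflip : ∀ Y : Matrix ι ι ℂ, u ⬝ᵥ (superFlip p 1 Y *ᵥ w) = w ⬝ᵥ (Y *ᵥ u) := by
    intro Y
    simp only [dotProduct, Matrix.mulVec, Finset.mul_sum]
    rw [Finset.sum_comm]
    refine Finset.sum_congr rfl fun d _ => Finset.sum_congr rfl fun c _ => ?_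
    rw [superFlip_apply]
    by_cases hc : p c = 0
    · rw [hc, zero_mul, sgn_zero]
      ring
    · rw [hu c hc]
      ring
  have e := congrArg (fun Y : Matrix ι ι ℂ => u ⬝ᵥ (Y *ᵥ w)) hX
  simp only [Matrix.add_mulVec, dotProduct_add, hflip, ← Matrix.mulVec_mulVec, hMu, hMw,
    Matrix.mulVec_zero, dotProduct_zero, add_zero] at e
  have hbu : u b = 0 := hu b fun h0 => hb (hw b (by rw [h0]; decide))
  have hs : ∀ x y : ι → ℂ, x ⬝ᵥ (Matrix.single a b (1 : ℂ) *ᵥ y) = x a * y b := fun x y => by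
    rw [Matrix.single_mulVec, one_mul]
    exact dotProduct_single _ _ _
  rw [hs, hs, hbu, mul_zero, add_zero] at e
  exact mul_ne_zero ha hb e.symm

end Stabilizer

end

section

/-! ### Stabilizers of odd vectors in degree two -/

variable {m n : ℕ}

/-- The odd matrix fixed by the transposition with upper right block `B`. -/
def oddMat (B : Matrix (Fin m) (Fin n) ℂ) : Matrix (Fin m ⊕ Fin n) (Fin m ⊕ Fin n) ℂ :=
  Matrix.fromBlocks 0 B Bᵀ 0

theorem oddMat_mem_symMat (B : Matrix (Fin m) (Fin n) ℂ) : oddMat B ∈ symMat (par m n) 1 := by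
  rw [mem_symMat']
  rintro (a | a) (b | b) <;> simp [oddMat, par, sgn_zero]

theorem oddMat_mem_part (B : Matrix (Fin m) (Fin n) ℂ) : oddMat B ∈ (gl (par m n)).part 1 := by
  rintro (a | a) (b | b) h <;> simp [oddMat, par] at h ⊢

theorem eq_oddMat {M : Matrix (Fin m ⊕ Fin n) (Fin m ⊕ Fin n) ℂ}
    (hM : M ∈ (gl (par m n)).part 1) (hs : M ∈ symMat (par m n) 1) :
    M = oddMat (Matrix.of fun i j => M (Sum.inl i) (Sum.inr j)) := by
  rw [mem_symMat'] at hs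
  ext (a | a) (b | b)
  · exact hM _ _ (by simp [par])
  · rfl
  · rw [hs (Sum.inl b) (Sum.inr a)]
    simp [oddMat, par, sgn_zero]
  · exact hM _ _ (by simp [par, zmod2_one_add_one])

/-- The odd tensor of degree two with block `B`. -/
def oddTensor (B : Matrix (Fin m) (Fin n) ℂ) : superSym (par m n) 1 2 :=
  (tensorEquiv (par m n) 1).symm ⟨oddMat B, oddMat_mem_symMat B⟩

theorem tensorEquiv_oddTensor (B : Matrix (Fin m) (Fin n) ℂ) :
    (tensorEquiv (par m n) 1 (oddTensor B) : Matrix (Fin m ⊕ Fin n) (Fin m ⊕ Fin n) ℂ) =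
      oddMat B := by
  rw [oddTensor, LinearEquiv.apply_symm_apply]

theorem oddTensor_mem (B : Matrix (Fin m) (Fin n) ℂ) :
    oddTensor B ∈ (symPow (par m n) 2).shift.part 0 := by
  change oddTensor B ∈ (superPow (par m n) 1 2).part (0 + 1)
  rw [zero_add, ← tensorEquiv_mem_part, tensorEquiv_oddTensor]
  exact oddMat_mem_part B

theorem exists_eq_oddTensor {v : superSym (par m n) 1 2}
    (hv : v ∈ (symPow (par m n) 2).shift.part 0) :
    ∃ B : Matrix (Fin m) (Fin n) ℂ, v = oddTensor B := by
  change v ∈ (superPow (par m n) 1 2).part (0 + 1) at hv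
  rw [zero_add, ← tensorEquiv_mem_part] at hv
  have h := eq_oddMat hv (tensorEquiv (par m n) 1 v).2
  rw [← tensorEquiv_oddTensor] at h
  exact ⟨_, (tensorEquiv (par m n) 1).injective (Subtype.ext h)⟩

theorem superPow_two_act_scalar {ι : Type*} [Fintype ι] [DecidableEq ι] {p : ι → ZMod 2} {η : ℂ}
    (c : ℂ) (v : superSym p η 2) : (superPow p η 2).act ((c / 2) • 1) v = c • v := by
  apply (tensorEquiv p η).injective
  apply Subtype.ext
  rw [tensorEquiv_act, smul_mul_assoc, one_mul, map_smul, mem_symMat.1 (tensorEquiv p η v).2,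
    map_smul, Submodule.coe_smul]
  module

/-- The left and right kernels of `B` are the even and odd kernels of `oddMat B`. -/
theorem kernel_of_spherical {b : Submodule ℂ (Matrix (Fin m ⊕ Fin n) (Fin m ⊕ Fin n) ℂ)}
    {B : Matrix (Fin m) (Fin n) ℂ}
    (h : (symPow (par m n) 2).shift.IsSphericalVector b (oddTensor B)) {u : Fin m → ℂ}
    {w : Fin n → ℂ} (hu : u ᵥ* B = 0) (hw : B *ᵥ w = 0) : u = 0 ∨ w = 0 := by
  have hs : ∀ W ∈ symMat (par m n) 1, ∃ X : Matrix (Fin m ⊕ Fin n) (Fin m ⊕ Fin n) ℂ,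
      X * oddMat B + superFlip (par m n) 1 (X * oddMat B) = W := by
    intro W hW
    obtain ⟨x, -, c, e⟩ := h.2 ((tensorEquiv (par m n) 1).symm ⟨W, hW⟩)
    have e2 : (superPow (par m n) 1 2).act (x + (c / 2) • 1) (oddTensor B) =
        (tensorEquiv (par m n) 1).symm ⟨W, hW⟩ := by
      rw [map_add, LinearMap.add_apply, superPow_two_act_scalar]
      exact e
    refine ⟨x + (c / 2) • 1, ?_⟩
    have e3 := congrArg (fun t => (tensorEquiv (par m n) 1 t :
      Matrix (Fin m ⊕ Fin n) (Fin m ⊕ Fin n) ℂ)) e2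
    simpa only [tensorEquiv_act, tensorEquiv_oddTensor, LinearEquiv.apply_symm_apply] using e3
  have hu0 : Sum.elim u (0 : Fin n → ℂ) ∈ (std (par m n)).part 0 := by
    rintro (a | a) ha
    · exact absurd rfl ha
    · rfl
  have hw0 : Sum.elim (0 : Fin m → ℂ) w ∈ (std (par m n)).part 1 := by
    rintro (a | a) ha
    · rfl
    · exact absurd rfl ha
  rcases eq_zero_or_eq_zero_of_kernel hs hu0 hw0
    (by rw [oddMat, Matrix.fromBlocks_mulVec]; simp [Matrix.mulVec_transpose, hu])
    (by rw [oddMat, Matrix.fromBlocks_mulVec]; simp [hw]) with h0 | h0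
  · exact Or.inl (funext fun i => congrFun h0 (Sum.inl i))
  · exact Or.inr (funext fun j => congrFun h0 (Sum.inr j))

theorem conj_stabilizer_oddTensor (P : (Matrix (Fin m) (Fin m) ℂ)ˣ)
    (Q : (Matrix (Fin n) (Fin n) ℂ)ˣ) {B B' : Matrix (Fin m) (Fin n) ℂ}
    (h : (P : Matrix (Fin m) (Fin m) ℂ) * B * (Q : Matrix (Fin n) (Fin n) ℂ)ᵀ = B') :
    Conj (par m n) ((symPow (par m n) 2).shift.stabilizer _ (oddTensor_mem B)).carrier
      ((symPow (par m n) 2).shift.stabilizer _ (oddTensor_mem B')).carrier := by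
  -- The block matrix `diag(P, Q)` acts by congruence, hence on the block `B` by `B ↦ P B Qᵗ`.
  refine conj_stabilizer (R := (symPow (par m n) 2).shift) (blockUnit_mem P Q)
    (congrEquiv 1 (blockUnit P Q) (blockUnit_mem P Q))
    (congrEquiv_act (blockUnit P Q) (blockUnit_mem P Q)) _ _ ?_
  apply (tensorEquiv (par m n) 1).injective
  apply Subtype.ext
  rw [tensorEquiv_congrEquiv, tensorEquiv_oddTensor, tensorEquiv_oddTensor, ← h]
  change Matrix.fromBlocks (P : Matrix (Fin m) (Fin m) ℂ) 0 0 (Q : Matrix (Fin n) (Fin n) ℂ) *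
    oddMat B * (Matrix.fromBlocks (P : Matrix (Fin m) (Fin m) ℂ) 0 0
      (Q : Matrix (Fin n) (Fin n) ℂ))ᵀ = _
  rw [oddMat, oddMat, Matrix.fromBlocks_transpose, Matrix.fromBlocks_multiply,
    Matrix.fromBlocks_multiply]
  simp [Matrix.mul_assoc]

theorem mem_stabilizer_oddTensor {B : Matrix (Fin m) (Fin n) ℂ}
    {X : Matrix (Fin m ⊕ Fin n) (Fin m ⊕ Fin n) ℂ} :
    X ∈ ((symPow (par m n) 2).shift.stabilizer _ (oddTensor_mem B)).carrier ↔
      X * oddMat B + superFlip (par m n) 1 (X * oddMat B) = 0 := by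
  rw [← tensorEquiv_oddTensor]
  exact act_eq_zero_iff

/-- Multiplying by `oddMat 1` on the right exchanges the block columns. The equation then says that
the upper right block is skew, the lower left one symmetric, and the diagonal blocks negative
transposes of each other. -/
theorem mem_periPiSpace_iff {X : Matrix (Fin n ⊕ Fin n) (Fin n ⊕ Fin n) ℂ} :
    X ∈ periPiSpace n ↔ X * oddMat 1 + superFlip (par n n) 1 (X * oddMat 1) = 0 := by
  obtain ⟨A, B, C, D, rfl⟩ : ∃ A B C D, X = Matrix.fromBlocks A B C D :=
    ⟨_, _, _, _, (Matrix.fromBlocks_toBlocks X).symm⟩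
  have h1 : Matrix.fromBlocks A B C D * oddMat 1 = Matrix.fromBlocks B A D C := by
    rw [oddMat, Matrix.fromBlocks_multiply]
    simp
  have h2 : superFlip (par n n) 1 (Matrix.fromBlocks B A D C) =
      Matrix.fromBlocks Bᵀ Dᵀ Aᵀ (-Cᵀ) := by
    ext (a | a) (b | b) <;> simp [superFlip_apply, par, sgn_zero, sgn_one]
  have h3 : parityAut n (Matrix.fromBlocks A B C D) = Matrix.fromBlocks D C B A := by
    ext (a | a) (b | b) <;> rfl
  rw [h1, h2, Matrix.fromBlocks_add, ← Matrix.fromBlocks_zero, Matrix.fromBlocks_inj]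
  change parityAut n _ ∈ periSpace n ↔ _
  rw [h3]
  constructor
  · rintro ⟨A', B', C', hB, hC, e⟩
    obtain ⟨rfl, rfl, rfl, rfl⟩ := Matrix.fromBlocks_inj.1 e
    simp [hB, hC]
  · rintro ⟨h4, h5, h6, h7⟩
    refine ⟨D, C, B, ?_, ?_, ?_⟩
    · exact (sub_eq_zero.1 ((sub_eq_add_neg _ _).trans h7)).symm
    · exact eq_neg_of_add_eq_zero_right h4
    · rw [eq_neg_of_add_eq_zero_left h5]

/-- A singular square `B` would have nonzero kernels on both sides, so `B` is invertible and can be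
moved to the identity. -/
theorem symPow_two_shift_stabilizer_conj
    {b : Submodule ℂ (Matrix (Fin n ⊕ Fin n) (Fin n ⊕ Fin n) ℂ)} {v : superSym (par n n) 1 2}
    (hv : (symPow (par n n) 2).shift.IsSphericalVector b v) :
    Conj (par n n) ((symPow (par n n) 2).shift.stabilizer v hv.1).carrier
      (periplecticPi n).carrier := by
  obtain ⟨B, rfl⟩ := exists_eq_oddTensor hv.1
  have hB : IsUnit B.det := by
    rw [isUnit_iff_ne_zero]
    intro h0
    obtain ⟨u, hu, hu'⟩ := Matrix.exists_vecMul_eq_zero_iff.2 h0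
    obtain ⟨w, hw, hw'⟩ := Matrix.exists_mulVec_eq_zero_iff.2 h0
    exact (kernel_of_spherical hv hu' hw').elim hu hw
  obtain ⟨P, rfl⟩ := (Matrix.isUnit_iff_isUnit_det B).2 hB
  have h := conj_stabilizer_oddTensor P⁻¹ 1 (B := (P : Matrix (Fin n) (Fin n) ℂ)) (B' := 1)
    (by simp)
  have e : ((symPow (par n n) 2).shift.stabilizer _ (oddTensor_mem (1 : Matrix _ _ ℂ))).carrier =
      (periplecticPi n).carrier := by
    ext X
    exact mem_stabilizer_oddTensor.trans mem_periPiSpace_iff.symm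
  rwa [e] at h

/-- The matrix of the projection along the first basis vector. -/
def succBlock (n : ℕ) : Matrix (Fin n) (Fin (n + 1)) ℂ :=
  Matrix.of fun i j => if j = i.succ then 1 else 0

theorem exists_mulVec_eq_zero_of_succ (B : Matrix (Fin n) (Fin (n + 1)) ℂ) :
    ∃ w, w ≠ 0 ∧ B *ᵥ w = 0 := by
  have h := LinearMap.ker_ne_bot_of_finrank_lt (f := B.mulVecLin) (by simp)
  obtain ⟨w, hw, hw0⟩ := Submodule.exists_mem_ne_zero_of_ne_bot h
  exact ⟨w, hw0, hw⟩

/-- Trivial left kernel means independent rows, and the row rank is the column rank. -/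
theorem mulVec_surjective_of_vecMul {B : Matrix (Fin m) (Fin n) ℂ}
    (hB : ∀ u, u ᵥ* B = 0 → u = 0) : Function.Surjective B.mulVec := by
  have h1 : LinearIndependent ℂ B.row := by
    rw [← Matrix.vecMul_injective_iff]
    intro u u' h
    refine sub_eq_zero.1 (hB _ ?_)
    rw [Matrix.sub_vecMul]
    exact sub_eq_zero.2 h
  have h2 := h1.rank_matrix
  have h3 : LinearMap.range B.mulVecLin = ⊤ := by
    refine Submodule.eq_top_of_finrank_eq ?_
    rw [Module.finrank_fintype_fun_eq_card]
    exact h2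
  exact LinearMap.range_eq_top.1 h3

theorem exists_unit_mul_eq_succBlock {B : Matrix (Fin n) (Fin (n + 1)) ℂ}
    (hB : ∀ u, u ᵥ* B = 0 → u = 0) :
    ∃ Q : (Matrix (Fin (n + 1)) (Fin (n + 1)) ℂ)ˣ,
      B * (Q : Matrix (Fin (n + 1)) (Fin (n + 1)) ℂ)ᵀ = succBlock n := by
  obtain ⟨w, hw0, hw⟩ := exists_mulVec_eq_zero_of_succ B
  choose r hr using fun i => mulVec_surjective_of_vecMul hB (Pi.single i 1)
  -- The rows are a kernel vector of `B` followed by preimages of the standard basis; `B` separates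
  -- the latter, so all of them are independent.
  set R : Matrix (Fin (n + 1)) (Fin (n + 1)) ℂ := Matrix.of (Fin.cons w r) with hR
  have hBR : B * Rᵀ = succBlock n := by
    ext i j
    change (B *ᵥ R j) i = _
    refine Fin.cases ?_ (fun k => ?_) j
    · change (B *ᵥ w) i = _
      rw [hw]
      simp [succBlock, Fin.ext_iff]
    · change (B *ᵥ r k) i = _
      rw [hr]
      simp [succBlock, Pi.single_apply, Fin.ext_iff, eq_comm]
  have hdet : IsUnit R := by
    rw [Matrix.isUnit_iff_isUnit_det, ← Matrix.det_transpose, isUnit_iff_ne_zero]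
    intro h0
    obtain ⟨c, hc, hRc⟩ := Matrix.exists_mulVec_eq_zero_iff.2 h0
    have h1 : succBlock n *ᵥ c = 0 := by
      rw [← hBR, ← Matrix.mulVec_mulVec, hRc, Matrix.mulVec_zero]
    have h2 : ∀ i : Fin n, c i.succ = 0 := fun i => by
      have := congrFun h1 i
      simpa [succBlock, Matrix.mulVec, dotProduct] using this
    have h3 : c 0 • w = 0 := by
      rw [← hRc]
      ext j
      rw [Matrix.mulVec, dotProduct, Fin.sum_univ_succ]
      simp [h2, hR, mul_comm]
    rcases smul_eq_zero.1 h3 with h4 | h4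
    · exact hc (funext fun j => Fin.cases h4 h2 j)
    · exact hw0 h4
  exact ⟨hdet.unit, hBR⟩

end

section

/-! ### The stabilizer in `ΠS²` of `ℂ^{n|n+1}` -/

variable {n : ℕ}

theorem oddMat_succBlock_some (a b : Fin n ⊕ Fin n) :
    oddMat (succBlock n) (optionEquivInr n n (some a)) (optionEquivInr n n (some b)) =
      oddMat 1 a b := by
  rcases a with a | a <;> rcases b with b | b <;>
    simp [oddMat, succBlock, optionEquivInr, Matrix.one_apply, eq_comm]

theorem oddMat_succBlock_none_left (b : Fin n ⊕ Fin (n + 1)) :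
    oddMat (succBlock n) (optionEquivInr n n none) b = 0 := by
  rcases b with b | b <;> simp [oddMat, succBlock, optionEquivInr, Fin.ext_iff]

theorem oddMat_succBlock_none_right (b : Fin n ⊕ Fin (n + 1)) :
    oddMat (succBlock n) b (optionEquivInr n n none) = 0 := by
  rcases b with b | b <;> simp [oddMat, succBlock, optionEquivInr, Fin.ext_iff]

theorem par_optionEquivInr_some (a : Fin n ⊕ Fin n) :
    par n (n + 1) (optionEquivInr n n (some a)) = par n n a := by
  rcases a with a | a <;> rfl

theorem mul_oddMat_one_apply (r : Fin n ⊕ Fin n → ℂ) (a : Fin n ⊕ Fin n) :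
    ∑ c, r c * oddMat 1 c a.swap = r a := by
  rw [Finset.sum_eq_single a]
  · rcases a with a | a <;> simp [oddMat]
  · intro c _ hc
    rcases a with a | a <;> rcases c with c | c <;> simp [oddMat, Matrix.one_apply] <;>
      exact fun e => absurd (by rw [e]) hc
  · simp

/-- The first odd index is isolated in the normal form: its row and column vanish, and the rest is
`oddMat 1`. So the column of `X` at this index is unconstrained, the rest of its row must vanish,
and the complementary block satisfies the equation of `𝔭(n)^Π`. -/
theorem mem_stabilizer_succBlock {X : Matrix (Fin n ⊕ Fin (n + 1)) (Fin n ⊕ Fin (n + 1)) ℂ} :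
    X ∈ ((symPow (par n (n + 1)) 2).shift.stabilizer _ (oddTensor_mem (succBlock n))).carrier ↔
      restrictMat (optionEquivInr n n) X ∈ periPiSpace n ∧
        ∀ b, X (optionEquivInr n n none) (optionEquivInr n n (some b)) = 0 := by
  rw [mem_stabilizer_oddTensor, mem_periPiSpace_iff]
  have h1 : ∀ a b, (X * oddMat (succBlock n)) a (optionEquivInr n n (some b)) =
      ∑ c, X a (optionEquivInr n n (some c)) * oddMat 1 c b := fun a b => by
    rw [Matrix.mul_apply, sum_eq_add_sum_some (optionEquivInr n n), oddMat_succBlock_none_left,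
      mul_zero, zero_add]
    simp only [oddMat_succBlock_some]
  have h2 : ∀ a, (X * oddMat (succBlock n)) a (optionEquivInr n n none) = 0 := fun a => by
    rw [Matrix.mul_apply]
    exact Finset.sum_eq_zero fun c _ => by rw [oddMat_succBlock_none_right, mul_zero]
  have h3 : ∀ a b, (X * oddMat (succBlock n)) (optionEquivInr n n (some a))
      (optionEquivInr n n (some b)) =
      (restrictMat (optionEquivInr n n) X * oddMat 1 :
        Matrix (Fin n ⊕ Fin n) (Fin n ⊕ Fin n) ℂ) a b :=
    fun a b => by
      rw [h1, Matrix.mul_apply]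
      rfl
  constructor
  · intro h
    constructor
    · ext a b
      have := congrFun (congrFun h (optionEquivInr n n (some a))) (optionEquivInr n n (some b))
      rw [Matrix.add_apply, superFlip_apply, h3, h3, par_optionEquivInr_some,
        par_optionEquivInr_some] at this
      exact this
    · intro b
      have := congrFun (congrFun h (optionEquivInr n n none)) (optionEquivInr n n (some b.swap))
      rw [Matrix.add_apply, superFlip_apply, h1, h2, mul_zero, mul_zero, add_zero,
        mul_oddMat_one_apply] at this
      exact this
  · rintro ⟨h4, h5⟩
    have h6 : ∀ b, (X * oddMat (succBlock n)) (optionEquivInr n n none)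
        (optionEquivInr n n (some b)) = 0 := fun b => by
      rw [h1]
      exact Finset.sum_eq_zero fun c _ => by rw [h5, zero_mul]
    ext a b
    obtain ⟨a, rfl⟩ := (optionEquivInr n n).surjective a
    obtain ⟨b, rfl⟩ := (optionEquivInr n n).surjective b
    rw [Matrix.add_apply, superFlip_apply]
    rcases a with _ | a <;> rcases b with _ | b
    · rw [h2]; simp
    · rw [h6, h2]; simp
    · rw [h6, h2]; simp
    · rw [h3, h3, par_optionEquivInr_some, par_optionEquivInr_some]
      exact congrFun (congrFun h4 a) b

/-- Elements have the shape of a block `Z`, a corner scalar `s` and a column `φ` at the first odd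
index. In a bracket `Z` acts on columns from the left, while `s` multiplies from the right with a
minus sign, whence the character `-1`. The index of the column is odd, which shifts its parity. -/
theorem stabilizer_succBlock_iso :
    ((symPow (par n (n + 1)) 2).shift.stabilizer _ (oddTensor_mem (succBlock n))).toAlg.Iso
      (periSemidirect n) := by
  set S := (symPow (par n (n + 1)) 2).shift.stabilizer _ (oddTensor_mem (succBlock n)) with hS
  set E := optionEquivInr n n with hE
  have hq : ∀ b, par n (n + 1) (E (some b)) = par n n b := par_optionEquivInr_some
  have hz : par n (n + 1) (E none) = 1 := rfl
  have hmem : ∀ X : S.carrier, ∀ b,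
      (X : Matrix (Fin n ⊕ Fin (n + 1)) (Fin n ⊕ Fin (n + 1)) ℂ) (E none) (E (some b)) = 0 :=
    fun X => (mem_stabilizer_succBlock.1 X.2).2
  let f : S.carrier →ₗ[ℂ] ((periplecticPi n).carrier × ℂ) × (Fin n ⊕ Fin n → ℂ) :=
    { toFun := fun X => ((⟨restrictMat E X, (mem_stabilizer_succBlock.1 X.2).1⟩,
        (X : Matrix (Fin n ⊕ Fin (n + 1)) (Fin n ⊕ Fin (n + 1)) ℂ) (E none) (E none)),
        fun a => (X : Matrix (Fin n ⊕ Fin (n + 1)) (Fin n ⊕ Fin (n + 1)) ℂ) (E (some a)) (E none))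
      map_add' := fun X Y => rfl
      map_smul' := fun c X => rfl }
  have hf1 : ∀ X, ((f X).1.1 : Matrix (Fin n ⊕ Fin n) (Fin n ⊕ Fin n) ℂ) = restrictMat E X :=
    fun _ => rfl
  have hf2 : ∀ X, (f X).1.2 =
      (X : Matrix (Fin n ⊕ Fin (n + 1)) (Fin n ⊕ Fin (n + 1)) ℂ) (E none) (E none) :=
    fun _ => rfl
  have hf3 : ∀ X a, (f X).2 a =
      (X : Matrix (Fin n ⊕ Fin (n + 1)) (Fin n ⊕ Fin (n + 1)) ℂ) (E (some a)) (E none) :=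
    fun _ _ => rfl
  have hf : Function.Bijective f := by
    constructor
    · rw [← LinearMap.ker_eq_bot, LinearMap.ker_eq_bot']
      intro X hX
      apply Subtype.ext
      ext a b
      obtain ⟨a, rfl⟩ := E.surjective a
      obtain ⟨b, rfl⟩ := E.surjective b
      rcases a with _ | a <;> rcases b with _ | b
      · exact congrArg (fun x => x.1.2) hX
      · exact hmem X b
      · exact congrFun (congrArg Prod.snd hX) a
      · exact congrFun (congrFun (congrArg (fun x => (x.1.1 :
          Matrix (Fin n ⊕ Fin n) (Fin n ⊕ Fin n) ℂ)) hX) a) b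
    · rintro ⟨⟨Z, s⟩, φ⟩
      obtain ⟨W, hW⟩ : ∃ W : Matrix (Fin n ⊕ Fin (n + 1)) (Fin n ⊕ Fin (n + 1)) ℂ,
          W = Matrix.of fun a b =>
            (E.symm a).elim ((E.symm b).elim s fun _ => 0) fun a' =>
              (E.symm b).elim (φ a') fun b' =>
                (Z : Matrix (Fin n ⊕ Fin n) (Fin n ⊕ Fin n) ℂ) a' b' := ⟨_, rfl⟩
      have e1 : restrictMat E W = (Z : Matrix (Fin n ⊕ Fin n) (Fin n ⊕ Fin n) ℂ) := by
        ext a b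
        rw [restrictMat_apply, hW]
        simp
      have hWS : W ∈ S.carrier := mem_stabilizer_succBlock.2
        ⟨by rw [← hE, e1]; exact Z.2, fun b => by rw [← hE, hW]; simp⟩
      refine ⟨⟨W, hWS⟩, Prod.ext (Prod.ext (Subtype.ext e1) ?_) ?_⟩
      · change W (E none) (E none) = s
        rw [hW]
        simp
      · funext b
        change W (E (some b)) (E none) = φ b
        rw [hW]
        simp
  have hpart : ∀ i, ∀ X ∈ S.toAlg.part i, f X ∈ (periSemidirect n).part i := by
    intro i X hX
    have hX' : (X : Matrix (Fin n ⊕ Fin (n + 1)) (Fin n ⊕ Fin (n + 1)) ℂ) ∈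
        (gl (par n (n + 1))).part i := hX
    refine ⟨⟨restrictMat_mem hq hX', ?_⟩, fun b hb => hX' _ _ ?_⟩
    · change (X : Matrix (Fin n ⊕ Fin (n + 1)) (Fin n ⊕ Fin (n + 1)) ℂ) (E none) (E none) ∈
        (if i = 0 then (⊤ : Submodule ℂ ℂ) else ⊥)
      split_ifs with hi
      · trivial
      · exact hX' _ _ (by rw [hz, zmod2_one_add_one]; exact Ne.symm hi)
    · rw [hz, hq]
      intro e
      apply hb
      rw [← e, add_assoc, zmod2_one_add_one, add_zero]
  refine SuperLieAlg.Iso.of_homogeneous (LinearEquiv.ofBijective f hf) hpart ?_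
  intro i j X hX Y hY
  have hX' : (X : Matrix (Fin n ⊕ Fin (n + 1)) (Fin n ⊕ Fin (n + 1)) ℂ) ∈
    (gl (par n (n + 1))).part i := hX
  have hY' : (Y : Matrix (Fin n ⊕ Fin (n + 1)) (Fin n ⊕ Fin (n + 1)) ℂ) ∈
    (gl (par n (n + 1))).part j := hY
  have hbr : ((S.toAlg.br X Y : S.carrier) :
    Matrix (Fin n ⊕ Fin (n + 1)) (Fin n ⊕ Fin (n + 1)) ℂ) = _ := matBr_apply _ hX' hY'
  refine Eq.trans ?_ (SuperRep.semidirectBr_apply _ (hpart i X hX) (hpart j Y hY)).symm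
  have hbr2 : (gl (par n n)).br (restrictMat E X) (restrictMat E Y) = _ :=
    matBr_apply (par n n) (restrictMat_mem hq hX') (restrictMat_mem hq hY')
  -- The corner entry is even, so it vanishes for odd elements and signs in front of it can be
  -- ignored.
  have hs : ∀ {k : ZMod 2} {Z : Matrix (Fin n ⊕ Fin (n + 1)) (Fin n ⊕ Fin (n + 1)) ℂ},
      Z ∈ (gl (par n (n + 1))).part k → ∀ l, sgn (k * l) * Z (E none) (E none) =
        Z (E none) (E none) := by
    intro k Z hZ l
    rcases zmod2_cases k with rfl | rfl
    · rw [zero_mul, sgn_zero, one_mul]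
    · rw [hZ (E none) (E none) (by rw [hz]; decide), mul_zero]
  have hsX := hs hX' j
  have hsY := hs hY' i
  rw [mul_comm j i] at hsY
  refine Prod.ext (Prod.ext (Subtype.ext ?_) ?_) ?_
  · refine Eq.trans ?_ hbr2.symm
    ext a b
    change ((S.toAlg.br X Y : S.carrier) :
      Matrix (Fin n ⊕ Fin (n + 1)) (Fin n ⊕ Fin (n + 1)) ℂ) (E (some a)) (E (some b)) = _
    rw [hbr]
    simp only [Matrix.sub_apply, Matrix.smul_apply, Matrix.mul_apply, sum_eq_add_sum_some E,
      hmem, mul_zero, zero_add, restrictMat_apply]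
  · change ((S.toAlg.br X Y : S.carrier) :
      Matrix (Fin n ⊕ Fin (n + 1)) (Fin n ⊕ Fin (n + 1)) ℂ) (E none) (E none) = 0
    rw [hbr]
    simp only [Matrix.sub_apply, Matrix.smul_apply, Matrix.mul_apply, sum_eq_add_sum_some E,
      hmem, zero_mul, Finset.sum_const_zero, add_zero, smul_eq_mul]
    linear_combination (-(X : Matrix (Fin n ⊕ Fin (n + 1)) (Fin n ⊕ Fin (n + 1)) ℂ)
      (E none) (E none)) * hsY
  · funext a
    change ((S.toAlg.br X Y : S.carrier) :
      Matrix (Fin n ⊕ Fin (n + 1)) (Fin n ⊕ Fin (n + 1)) ℂ) (E (some a)) (E none) =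
      (((restrictMat E X) *ᵥ (f Y).2) a + (f X).1.2 * (-1 * (f Y).2 a)) - sgn (i * j) *
        (((restrictMat E Y) *ᵥ (f X).2) a + (f Y).1.2 * (-1 * (f X).2 a))
    rw [hbr]
    simp only [Matrix.sub_apply, Matrix.smul_apply, Matrix.mul_apply, sum_eq_add_sum_some E,
      Matrix.mulVec, dotProduct, hf2, hf3, restrictMat_apply, smul_eq_mul]
    linear_combination
      (-(Y : Matrix (Fin n ⊕ Fin (n + 1)) (Fin n ⊕ Fin (n + 1)) ℂ) (E (some a)) (E none)) * hsX -
      (X : Matrix (Fin n ⊕ Fin (n + 1)) (Fin n ⊕ Fin (n + 1)) ℂ) (E (some a)) (E none) * hsY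

theorem symPow_two_shift_stabilizer_iso
    {b : Submodule ℂ (Matrix (Fin n ⊕ Fin (n + 1)) (Fin n ⊕ Fin (n + 1)) ℂ)}
    {v : superSym (par n (n + 1)) 1 2}
    (hv : (symPow (par n (n + 1)) 2).shift.IsSphericalVector b v) :
    ((symPow (par n (n + 1)) 2).shift.stabilizer v hv.1).toAlg.Iso (periSemidirect n) := by
  obtain ⟨B, rfl⟩ := exists_eq_oddTensor hv.1
  obtain ⟨w, hw0, hw⟩ := exists_mulVec_eq_zero_of_succ B
  -- A matrix with one more column than rows has a nonzero right kernel, so sphericity makes the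
  -- left kernel trivial.
  obtain ⟨Q, hQ⟩ := exists_unit_mul_eq_succBlock (B := B) fun u hu =>
    (kernel_of_spherical hv hu hw).resolve_right hw0
  have h := conj_stabilizer_oddTensor 1 Q (B := B) (B' := succBlock n) (by simpa using hQ)
  exact h.iso.trans stabilizer_succBlock_iso

end

/-! ### Equivalences of modules -/

theorem submatrix_surjective {ι κ : Type*} (σ : κ ≃ ι) :
    Function.Surjective fun X : Matrix ι ι ℂ => X.submatrix σ σ := fun Y =>
  ⟨Y.submatrix σ.symm σ.symm, by simp⟩

theorem std_shift_equivalent (m n : ℕ) : (std (par m n)).shift.Equivalent (std (par n m)) :=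
  (std_shift_isoAlong (Equiv.sumComm _ _) (par_swap n m)).equivalent (submatrix_surjective _)

theorem extPow_two_equivalent (m n : ℕ) :
    (extPow (par m n) 2).Equivalent (symPow (par n m) 2) :=
  (extPow_two_isoAlong_symPow_two m n).equivalent (submatrix_surjective _)

theorem symPow_two_shift_isoAlong_parityAut (n : ℕ) :
    SuperRep.IsoAlong (parityAut n) (symPow (par n n) 2).shift (extPow (par n n) 2).shift :=
  (symPow_two_isoAlong_extPow_two n n).shift

theorem extPow_two_shift_equivalent (n : ℕ) :
    (extPow (par n n) 2).shift.Equivalent (symPow (par n n) 2).shift :=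
  (extPow_two_isoAlong_symPow_two n n).shift.equivalent (submatrix_surjective _)

end SuperSph

end

theorem mainTheorem2 :
    -- The classification.
    (∀ m n : ℕ, 1 ≤ m → m ≤ n → (2 ≤ m ∨ 3 ≤ n) →
      (∀ d : ℕ, 1 ≤ d →
        ((symPow (par m n) d).IsNumericallySpherical ↔ d = 1 ∨ d = 2) ∧
        ((extPow (par m n) d).IsNumericallySpherical ↔ d = 1 ∨ d = 2) ∧
        ((symPow (par m n) d).shift.IsNumericallySpherical ↔
          d = 1 ∨ (d = 2 ∧ (n = m ∨ n = m + 1))) ∧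
        ((extPow (par m n) d).shift.IsNumericallySpherical ↔ d = 1 ∨ (d = 2 ∧ n = m)) ∧
        ((symPow (par m n) d).IsNumericallySpherical → (symPow (par m n) d).IsSpherical) ∧
        ((extPow (par m n) d).IsNumericallySpherical → (extPow (par m n) d).IsSpherical) ∧
        ((symPow (par m n) d).shift.IsNumericallySpherical →
          (symPow (par m n) d).shift.IsSpherical) ∧
        ((extPow (par m n) d).shift.IsNumericallySpherical →
          (extPow (par m n) d).shift.IsSpherical))) ∧
    -- The modules of the classification are equivalent to modules of the table.
    (∀ m n : ℕ, 1 ≤ m → 1 ≤ n →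
      SuperRep.IsoAlong id (symPow (par m n) 1) (std (par m n)) ∧
      SuperRep.IsoAlong id (extPow (par m n) 1) (std (par m n)) ∧
      (std (par m n)).shift.Equivalent (std (par n m)) ∧
      (extPow (par m n) 2).Equivalent (symPow (par n m) 2)) ∧
    (∀ n : ℕ, 1 ≤ n →
      SuperRep.IsoAlong (parityAut n) (symPow (par n n) 2).shift (extPow (par n n) 2).shift ∧
      (extPow (par n n) 2).shift.Equivalent (symPow (par n n) 2).shift) ∧
    -- The table: superdimension, Borel subalgebras, stabilizers of spherical vectors.
    (∀ m n : ℕ, 1 ≤ m → 1 ≤ n →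
      (std (par m n)).sdim = (m, n) ∧
      SphericalExactly (std (par m n)) EDString.EndsInEps ∧
      ∀ b, (gl (par m n)).IsBorel b → ∀ v (hv : (std (par m n)).IsSphericalVector b v),
        ((std (par m n)).stabilizer v hv.1).toAlg.Iso (dualStd (par (m - 1) n)).semidirect) ∧
    (∀ m n : ℕ, 1 ≤ m → 1 ≤ n →
      (symPow (par m n) 2).sdim = (n * (n - 1) / 2 + m * (m + 1) / 2, m * n) ∧
      SphericalExactly (symPow (par m n) 2) EDString.EvenDeltas ∧
      ∀ b, (gl (par m n)).IsBorel b → ∀ v (hv : (symPow (par m n) 2).IsSphericalVector b v),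
        ((symPow (par m n) 2).stabilizer v hv.1).carrier = ospDual (par m n) v) ∧
    (∀ n : ℕ, 1 ≤ n →
      (symPow (par n n) 2).shift.sdim = (n ^ 2, n ^ 2) ∧
      SphericalExactly (symPow (par n n) 2).shift EDString.IsEpsDelta ∧
      ∀ b, (gl (par n n)).IsBorel b →
        ∀ v (hv : (symPow (par n n) 2).shift.IsSphericalVector b v),
          Conj (par n n) ((symPow (par n n) 2).shift.stabilizer v hv.1).carrier
            (periplecticPi n).carrier) ∧
    (∀ n : ℕ, 1 ≤ n →
      (symPow (par n (n + 1)) 2).shift.sdim = (n * (n + 1), n * (n + 1)) ∧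
      SphericalExactly (symPow (par n (n + 1)) 2).shift EDString.IsDeltaEpsDelta ∧
      ∀ b, (gl (par n (n + 1))).IsBorel b →
        ∀ v (hv : (symPow (par n (n + 1)) 2).shift.IsSphericalVector b v),
          ((symPow (par n (n + 1)) 2).shift.stabilizer v hv.1).toAlg.Iso (periSemidirect n)) := by
  refine ⟨fun m n hm hmn h2 d hd => classification hm hmn h2 hd, fun m n _ _ =>
    ⟨superPow_one_isoAlong _ 1, superPow_one_isoAlong _ (-1), std_shift_equivalent m n,
      extPow_two_equivalent m n⟩,
    fun n _ => ⟨symPow_two_shift_isoAlong_parityAut n, extPow_two_shift_equivalent n⟩,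
    fun m n hm hn => ?_, fun m n hm hn => ?_, fun n hn => ?_, fun n hn => ?_⟩
  · have : NeZero m := ⟨by omega⟩
    exact ⟨std_sdim m n, std_sphericalExactly m n hm, fun b _ v hv =>
      std_stabilizer_iso m n hm hv.ne_zero hv.1⟩
  · have : NeZero m := ⟨by omega⟩
    have : NeZero n := ⟨by omega⟩
    exact ⟨symPow_two_sdim m n, symPow_two_sphericalExactly, fun b _ v hv =>
      stabilizer_eq_ospDual hv.1⟩
  · have : NeZero n := ⟨by omega⟩
    exact ⟨symPow_two_shift_sdim_eq n, symPow_two_shift_sphericalExactly_eq, fun b _ v hv =>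
      symPow_two_shift_stabilizer_conj hv⟩
  · have : NeZero n := ⟨by omega⟩
    exact ⟨symPow_two_shift_sdim_succ n, symPow_two_shift_sphericalExactly_succ, fun b _ v hv =>
      symPow_two_shift_stabilizer_iso hv⟩
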